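/- Let $\phi:\mathbb C\to\mathbb R$ be a subharmonic function whose distributional Laplacian $\mu=\Delta\phi=\partial_x^2\phi+\partial_y^2\phi$, a locally finite nonnegative Borel measure, is nonzero and doubling: there is $C>0$ with $\mu(D(z,2r))\le C\,\mu(D(z,r))$ for all $z\in\mathbb C$ and $r>0$. For such a weight let $\rho_\phi(z)>0$ denote the radius with $\Delta\phi\bigl(D(z,\rho_\phi(z))\bigr)=1$, and let $$d_\phi(z,\zeta)=\inf_\gamma\int_0^1\frac{|\gamma'(t)|}{\rho_\phi(\gamma(t))}\,dt ,$$ the infimum being taken over piecewise $C^1$ curves $\gamma:[0,1]\to\mathbb C$ from $z$ to $\zeta$; put $d_\phi(z,Z)=\inf_{\zeta\in Z}d_\phi(z,\zeta)$ for $Z\subset\mathbb C$. A set $\Lambda\subset\mathbb C$ is $\rho_\phi$-separated if there is $\delta>0$ with $|\lambda-\lambda'|\ge\delta\max(\rho_\phi(\lambda),\rho_\phi(\lambda'))$ for all $\lambda\ne\lambda'$ in $\Lambda$. Its upper uniform density is $$\mathcal D^+_{\Delta\phi}(\Lambda)=\limsup_{r\to\infty}\ \sup_{z\in\mathbb C}\frac{\#\bigl(\Lambda\cap\overline{D(z,r\rho_\phi(z))}\bigr)}{\Delta\phi\bigl(D(z,r\rho_\phi(z))\bigr)}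 .$$ A multiplier associated to $\phi$ is an entire function $g$ with zero set $\mathcal Z(g)$ such that $\mathcal Z(g)$ is $\rho_\phi$-separated, $\sup_{z\in\mathbb C}d_\phi(z,\mathcal Z(g))<\infty$, and, for some constant $C>0$, $C^{-1}e^{\phi(z)}d_\phi(z,\mathcal Z(g))\le|g(z)|\le C e^{\phi(z)}d_\phi(z,\mathcal Z(g))$ for all $z\in\mathbb C$. A net associated to $\phi$ is the zero set of a multiplier associated to $\phi$. **Theorem.** If $\Lambda\subset\mathbb C$ is $\rho_\phi$-separated and $\mathcal D^+_{\Delta\phi}(\Lambda)<\frac1{2\pi}$, then there exist $\varepsilon\in(0,1)$ and a set $\Sigma\subset\mathbb C$ such that $\Lambda\cup\Sigma$ is $\rho_\phi$-separated and is a net associated to $(1-\varepsilon)\phi$. -/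

import Mathlib

open Filter MeasureTheory Set
open scoped ENNReal NNReal Topology ContDiff

noncomputable section

namespace DoublingFock

/-- A (finite-valued) subharmonic function on `ℂ`: upper semicontinuous and dominated at every point
by its averages over circles centred there. -/
structure IsSubharmonic (φ : ℂ → ℝ) : Prop where
  upperSemicontinuous : UpperSemicontinuous φ
  circleIntegrable : ∀ (z : ℂ) (r : ℝ), 0 < r → CircleIntegrable φ z r
  le_circleAverage : ∀ (z : ℂ) (r : ℝ), 0 < r → φ z ≤ Real.circleAverage φ z r

/-- `μ` is a locally finite Borel measure representing the distributional Laplacian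
`∂²φ/∂x² + ∂²φ/∂y²` of `φ`. -/
def IsDistributionalLaplacian (φ : ℂ → ℝ) (μ : Measure ℂ) : Prop :=
  IsLocallyFiniteMeasure μ ∧
    ∀ η : ℂ → ℝ, ContDiff ℝ ∞ η → HasCompactSupport η →
      ∫ z, φ z * Laplacian.laplacian η z = ∫ z, η z ∂μ

/-- The distributional Laplacian determines the measure. -/
theorem IsDistributionalLaplacian.unique {φ : ℂ → ℝ} {μ ν : Measure ℂ}
    (hμ : IsDistributionalLaplacian φ μ) (hν : IsDistributionalLaplacian φ ν) : μ = ν := by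
  obtain ⟨_, hμ⟩ := hμ
  obtain ⟨_, hν⟩ := hν
  have key : ∀ U : Set ℂ, IsOpen U → Bornology.IsBounded U → μ U = ν U := by
    intro U hU hb
    obtain ⟨f, hfs, hf, hf0⟩ := hU.exists_contDiff_support_eq (n := ⊤)
    let η : ℕ → ℂ → ℝ := fun n z => Real.smoothTransition (n * f z)
    have hsm : ∀ n, ContDiff ℝ ∞ (η n) := fun n =>
      Real.smoothTransition.contDiff.comp (contDiff_const.mul hf)
    have hzero : ∀ n z, z ∉ U → η n z = 0 := by
      intro n z hz
      have h : f z = 0 := by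
        by_contra h
        exact hz (hfs ▸ h)
      simp [η, h, Real.smoothTransition.zero_of_nonpos le_rfl]
    have hcs : ∀ n, HasCompactSupport (η n) := fun n =>
      HasCompactSupport.intro hb.isCompact_closure
        (fun z hz => hzero n z (fun h => hz (subset_closure h)))
    have hlim : ∀ z, Tendsto (fun n => η n z) atTop (𝓝 (U.indicator (fun _ => (1 : ℝ)) z)) := by
      intro z
      by_cases hz : z ∈ U
      · have hpos : 0 < f z := lt_of_le_of_ne (hf0 (mem_range_self z)).1 (Ne.symm (by rw [← hfs] at hz; exact hz))
        rw [indicator_of_mem hz]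
        obtain ⟨N, hN⟩ := exists_nat_gt (1 / f z)
        refine tendsto_const_nhds.congr' ?_
        filter_upwards [eventually_ge_atTop N] with n hn
        refine (Real.smoothTransition.one_of_one_le ?_).symm
        have h1 : 1 / f z ≤ n := hN.le.trans (by exact_mod_cast hn)
        rwa [div_le_iff₀ hpos] at h1
      · rw [indicator_of_notMem hz]
        simp only [hzero _ z hz]
        exact tendsto_const_nhds
    have gen : ∀ τ : Measure ℂ, IsLocallyFiniteMeasure τ →
        τ U < ⊤ ∧ Tendsto (fun n => ∫ z, η n z ∂τ) atTop (𝓝 (τ.real U)) := by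
      intro τ _
      have hfin : τ U < ⊤ := hb.measure_lt_top
      refine ⟨hfin, ?_⟩
      have h := tendsto_integral_of_dominated_convergence (μ := τ) (F := η)
        (U.indicator (fun _ => (1 : ℝ)))
        (fun n => (hsm n).continuous.aestronglyMeasurable)
        ((integrable_indicator_iff hU.measurableSet).2 (integrableOn_const hfin.ne))
        (fun n => Eventually.of_forall fun z => by
          by_cases hz : z ∈ U
          · rw [indicator_of_mem hz, Real.norm_of_nonneg (Real.smoothTransition.nonneg _)]
            exact Real.smoothTransition.le_one _
          · rw [indicator_of_notMem hz, hzero n z hz, norm_zero])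
        (Eventually.of_forall hlim)
      rwa [integral_indicator_const _ hU.measurableSet, smul_eq_mul, mul_one] at h
    obtain ⟨h1, h2⟩ := gen μ inferInstance
    obtain ⟨h3, h4⟩ := gen ν inferInstance
    have h5 : (fun n => ∫ z, η n z ∂μ) = fun n => ∫ z, η n z ∂ν := by
      funext n
      rw [← hμ _ (hsm n) (hcs n), ← hν _ (hsm n) (hcs n)]
    rw [h5] at h2
    exact (measureReal_eq_measureReal_iff h1.ne h3.ne).1 (tendsto_nhds_unique h2 h4)
  have hball : ∀ n : ℕ, μ.restrict (Metric.ball 0 n) = ν.restrict (Metric.ball 0 n) := by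
    intro n
    have : IsFiniteMeasure (μ.restrict (Metric.ball 0 (n : ℝ))) :=
      ⟨by simpa using Metric.isBounded_ball.measure_lt_top⟩
    refine ext_of_generate_finite {U : Set ℂ | IsOpen U} (BorelSpace.measurable_eq)
      isPiSystem_isOpen ?_ ?_
    · intro U hU
      replace hU : IsOpen U := hU
      rw [Measure.restrict_apply (hU.measurableSet),
        Measure.restrict_apply (hU.measurableSet)]
      exact key _ (hU.inter Metric.isOpen_ball)
        (Metric.isBounded_ball.subset inter_subset_right)
    · simpa using key _ Metric.isOpen_ball Metric.isBounded_ball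
  exact Measure.ext_of_iUnion_eq_univ (Metric.iUnion_ball_nat 0) hball

open Classical in
/-- The measure `Δφ`. A locally finite Borel measure on `ℂ` is determined by its integrals
against test functions, so the choice is unique whenever it exists, in particular for all
subharmonic `φ`; the value is `0` if the Laplacian of `φ` is not a locally finite measure. -/
def laplacianMeasure (φ : ℂ → ℝ) : Measure ℂ :=
  if h : ∃ μ : Measure ℂ, IsDistributionalLaplacian φ μ then h.choose else 0

theorem laplacianMeasure_eq {φ : ℂ → ℝ} {μ : Measure ℂ} (h : IsDistributionalLaplacian φ μ) :
    laplacianMeasure φ = μ := by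
  have hex : ∃ μ : Measure ℂ, IsDistributionalLaplacian φ μ := ⟨μ, h⟩
  rw [laplacianMeasure, dif_pos hex]
  exact hex.choose_spec.unique h

/-- A doubling measure on `ℂ`. -/
def IsDoubling (μ : Measure ℂ) : Prop :=
  ∃ C : ℝ≥0, ∀ (z : ℂ) (r : ℝ), 0 < r →
    μ (Metric.ball z (2 * r)) ≤ C * μ (Metric.ball z r)

/-- The radius `ρ_φ(z)`, characterised by `Δφ(D(z, ρ_φ(z))) = 1`. If `Δφ` is doubling and nonzero
there is exactly one such positive radius. -/
def rho (φ : ℂ → ℝ) (z : ℂ) : ℝ :=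
  sInf {r : ℝ | 0 < r ∧ laplacianMeasure φ (Metric.ball z r) = 1}

/-- `ρ_φ`-separated sets of points. -/
def IsRhoSeparated (φ : ℂ → ℝ) (Λ : Set ℂ) : Prop :=
  ∃ δ : ℝ, 0 < δ ∧ ∀ a ∈ Λ, ∀ b ∈ Λ, a ≠ b → δ * max (rho φ a) (rho φ b) ≤ ‖a - b‖

/-- The upper uniform density `𝒟⁺_{Δφ}(Λ)`. -/
def upperDensity (φ : ℂ → ℝ) (Λ : Set ℂ) : ℝ≥0∞ :=
  limsup (fun r : ℝ => ⨆ z : ℂ,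
    ((Λ ∩ Metric.closedBall z (r * rho φ z)).encard : ℝ≥0∞) /
      laplacianMeasure φ (Metric.ball z (r * rho φ z))) atTop

/-- `γ` restricted to `[0,1]` is a piecewise `C¹` curve: it is continuous, and it is `C¹` on each
closed subinterval whose interior avoids a suitable finite set of parameters. -/
def IsPiecewiseC1 (γ : ℝ → ℂ) : Prop :=
  ContinuousOn γ (Icc 0 1) ∧ ∃ S : Finset ℝ, ∀ a b : ℝ, 0 ≤ a → a < b → b ≤ 1 →
    (∀ s ∈ S, s ∉ Ioo a b) → ContDiffOn ℝ 1 γ (Icc a b)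

/-- The length of `γ : [0,1] → ℂ` in the metric `ρ_φ⁻² dz ⊗ dz̄`. -/
def rhoLength (φ : ℂ → ℝ) (γ : ℝ → ℂ) : ℝ≥0∞ :=
  ∫⁻ t in Icc (0 : ℝ) 1, ‖deriv γ t‖ₑ / ENNReal.ofReal (rho φ (γ t))

/-- The distance `d_φ(z, ζ)`. -/
def rhoDist (φ : ℂ → ℝ) (z ζ : ℂ) : ℝ≥0∞ :=
  ⨅ (γ : ℝ → ℂ) (_ : IsPiecewiseC1 γ) (_ : γ 0 = z) (_ : γ 1 = ζ), rhoLength φ γ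

/-- The distance `d_φ(z, Z)` from a point to a set (`∞` if `Z` is empty). -/
def distToSet (φ : ℂ → ℝ) (z : ℂ) (Z : Set ℂ) : ℝ≥0∞ :=
  ⨅ ζ ∈ Z, rhoDist φ z ζ

/-- The zero set of `g`. -/
def zeroSet (g : ℂ → ℂ) : Set ℂ := {z | g z = 0}

/-- `g` is a multiplier associated to `φ`: an entire function with `ρ_φ`-separated zeros at
bounded `d_φ`-distance from every point, such that `|g| ≃ e^φ d_φ(·, 𝒵(g))` on `ℂ`. -/
structure IsMultiplier (φ : ℂ → ℝ) (g : ℂ → ℂ) : Prop where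
  entire : Differentiable ℂ g
  separated : IsRhoSeparated φ (zeroSet g)
  bounded : ⨆ z : ℂ, distToSet φ z (zeroSet g) < ⊤
  growth : ∃ C : ℝ≥0, ∀ z : ℂ,
    ‖g z‖ₑ ≤ C * (ENNReal.ofReal (Real.exp (φ z)) * distToSet φ z (zeroSet g)) ∧
    ENNReal.ofReal (Real.exp (φ z)) * distToSet φ z (zeroSet g) ≤ C * ‖g z‖ₑ

/-- A net associated to `φ`: the zero set of a multiplier associated to `φ`. -/
def IsNet (φ : ℂ → ℝ) (Λ : Set ℂ) : Prop :=
  ∃ g : ℂ → ℂ, IsMultiplier φ g ∧ zeroSet g = Λ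

end DoublingFock

end

/-!
The theorem rests on an explicit construction of an entire function `g` whose zero set contains `Λ`.
Write `μ = Δφ`, let `n` be the counting measure of `Λ` and `ρ(z)` the radius of the disc about `z` of
`μ`-mass `M`, where `M` is a large constant. By doubling all these scales are comparable to `ρ_φ`
(`exists_rad_le_mul_rad`), and `ρ` is comparable to a constant on discs of radius comparable to `ρ`
(`exists_rad_le_mul`).

*Decomposition.* The density hypothesis says that `n ≤ κ μ` on all discs of large mass, for some
`κ < 1 / 2π` (`exists_dominatedOnDiscs`). Choose `ε` with `κ < a = (1 - ε) / 2π`. A covering argument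
over many scales passes from discs to a partition of unity on each member of which `a μ` exceeds `n` by
a large multiple of the unit mass (`exists_isSweep`, `exists_partition_mass_le`). The fractional part
of each excess is moved outwards to a neighbouring piece. Hence `a μ - n` is a locally finite sum of
charges `α_w μ - β_w n`, indexed by a net `W` at the scale `ρ`, supported in discs of radius comparable
to `ρ(w)`, with total mass a bounded positive integer `n_w ≥ 2 K + 1`, where `2 ^ K` is a doubling
constant (`exists_isDecomposition`).

*Local factors.* Each charge is balanced by `n_w` simple zeros `R w` near `w`: the product
`∏ |z - p| · ∏ |z - λ| ^ β_w(λ) · exp (-∫ α_w(ζ) log |z - ζ| dμ(ζ))` is `1 + O((ρ(w) / |z - w|) ^ n_w)`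
away from `w` if `∏ (z - p)` is the polynomial part of the expansion at infinity of the exponential of
the logarithmic potential of the charge. The constant term of this polynomial is free, which makes it
possible to choose the zeros separated from one another and from `Λ` (`exists_localFactor_disc`,
`exists_isBalancing`). The product of all factors converges because `∑ (ρ(w) / |z - w|) ^ (2 K)` is
bounded (`exists_sum_pow_le`).

*The entire function.* Put `Z = Λ ∪ ⋃ R w` and let `U` be `e ^ {(1 - ε) φ}` times the product of the
local factors. On a disc, `(1 - ε) φ` minus the logarithmic potential of the charges `α_w μ` that meet
it is the real part of a holomorphic function, by the Riesz decomposition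
(`exists_holomorphic_re_eq_sub_logPotential`), and the exponents `β_w(λ)` add up to `1`. So on every
disc `U` is the modulus of a holomorphic function, and therefore `U = |g|` for an entire `g`
(`exists_differentiable_norm_eq_factorProduct`).

*Size.* Near `z` only boundedly many factors matter. By scaling, their product is comparable to
`dist(z, Z) / ρ(z)` (`IsBalancing.exists_factorProduct_comparable`), which in turn is comparable to the
distance `d` from `z` to `Z` in the metric of the weight `(1 - ε) φ`: segments bound `d` from above,
and a curve leaving `D(z, s)` with `s ≤ ρ(z)` has length at least a multiple of `s / ρ(z)`
(`exists_distToSet_comparable`).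
-/

open Filter MeasureTheory Set
open scoped ENNReal NNReal Topology ContDiff

noncomputable section

namespace DoublingFock

open Metric

/-! ### Doubling measures -/

/-- A nonzero locally finite measure on `ℂ` that is doubling with constant `2 ^ K`. -/
structure DoublingWith (μ : Measure ℂ) (K : ℕ) : Prop where
  locallyFinite : IsLocallyFiniteMeasure μ
  ne_zero : μ ≠ 0
  le : ∀ (z : ℂ) (r : ℝ), 0 < r → μ (ball z (2 * r)) ≤ 2 ^ K * μ (ball z r)

namespace DoublingWith

variable {μ : Measure ℂ} {K : ℕ}

theorem measure_ball_lt_top (h : DoublingWith μ K) (z : ℂ) (r : ℝ) : μ (ball z r) < ⊤ :=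
  have := h.locallyFinite
  isBounded_ball.measure_lt_top

theorem measure_lt_top (h : DoublingWith μ K) {s : Set ℂ} (hs : Bornology.IsBounded s) :
    μ s < ⊤ :=
  have := h.locallyFinite
  hs.measure_lt_top

theorem real_mono (h : DoublingWith μ K) {s : Set ℂ} {z : ℂ} {r : ℝ} (hs : s ⊆ ball z r) :
    μ.real s ≤ μ.real (ball z r) :=
  measureReal_mono hs (h.measure_ball_lt_top z r).ne

theorem real_le (h : DoublingWith μ K) (z : ℂ) {r : ℝ} (hr : 0 < r) :
    μ.real (ball z (2 * r)) ≤ 2 ^ K * μ.real (ball z r) := by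
  have h1 := h.le z r hr
  have h2 := ENNReal.toReal_mono
    (ENNReal.mul_ne_top (by simp) (h.measure_ball_lt_top z r).ne) h1
  simpa [Measure.real, ENNReal.toReal_mul] using h2

theorem real_pow_le (h : DoublingWith μ K) (z : ℂ) {r : ℝ} (hr : 0 < r) (j : ℕ) :
    μ.real (ball z (2 ^ j * r)) ≤ 2 ^ (K * j) * μ.real (ball z r) := by
  induction j with
  | zero => simp
  | succ j ih =>
    have h1 := h.real_le z (r := 2 ^ j * r) (by positivity)
    calc μ.real (ball z (2 ^ (j + 1) * r)) = μ.real (ball z (2 * (2 ^ j * r))) := by ring_nf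
      _ ≤ 2 ^ K * (2 ^ (K * j) * μ.real (ball z r)) := h1.trans (by gcongr)
      _ = 2 ^ (K * (j + 1)) * μ.real (ball z r) := by ring

/-- The doubling condition iterated: if `|z - ζ| + R ≤ 2 ^ j r` then
`μ(D(ζ, R)) ≤ 2 ^ (K j) μ(D(z, r))`. -/
theorem real_ball_le_of_le (h : DoublingWith μ K) {z ζ : ℂ} {r R : ℝ} (hr : 0 < r) (j : ℕ)
    (hj : dist ζ z + R ≤ 2 ^ j * r) :
    μ.real (ball ζ R) ≤ 2 ^ (K * j) * μ.real (ball z r) :=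
  (h.real_mono (ball_subset_ball' (by linarith))).trans (h.real_pow_le z hr j)

theorem real_pos (h : DoublingWith μ K) (z : ℂ) {r : ℝ} (hr : 0 < r) :
    0 < μ.real (ball z r) := by
  by_contra hc
  have h0 : μ.real (ball z r) = 0 := le_antisymm (not_lt.1 hc) measureReal_nonneg
  apply h.ne_zero
  have h1 : ∀ n : ℕ, μ (ball z (2 ^ n * r)) = 0 := by
    intro n
    have := h.real_pow_le z hr n
    rw [h0, mul_zero] at this
    have h2 : μ.real (ball z (2 ^ n * r)) = 0 := le_antisymm this measureReal_nonneg
    exact (measureReal_eq_zero_iff (h.measure_ball_lt_top _ _).ne).1 h2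
  have h2 : (⋃ n : ℕ, ball z (2 ^ n * r)) = univ := by
    refine eq_univ_of_forall fun w => ?_
    obtain ⟨n, hn⟩ := pow_unbounded_of_one_lt (dist w z / r) one_lt_two
    exact mem_iUnion.2 ⟨n, by rwa [mem_ball, ← div_lt_iff₀ hr]⟩
  rw [← Measure.measure_univ_eq_zero, ← h2]
  exact measure_iUnion_null h1

/-- The ratio in the reverse doubling inequality. -/
def _root_.DoublingFock.reverseRatio (K : ℕ) : ℝ := 1 - (1 / 2) ^ (3 * K)

theorem _root_.DoublingFock.reverseRatio_nonneg (K : ℕ) : 0 ≤ reverseRatio K := by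
  have : ((1 : ℝ) / 2) ^ (3 * K) ≤ 1 := pow_le_one₀ (by norm_num) (by norm_num)
  unfold reverseRatio; linarith

theorem _root_.DoublingFock.reverseRatio_lt_one (K : ℕ) : reverseRatio K < 1 := by
  have : 0 < ((1 : ℝ) / 2) ^ (3 * K) := by positivity
  unfold reverseRatio; linarith

/-- Reverse doubling: `D(z, 4r) \ D(z, r)` contains a disc of radius `r`. -/
theorem real_le_reverse (h : DoublingWith μ K) (z : ℂ) {r : ℝ} (hr : 0 < r) :
    μ.real (ball z r) ≤ reverseRatio K * μ.real (ball z (4 * r)) := by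
  set w : ℂ := z + (2 * r : ℝ)
  have hw : dist w z = 2 * r := by
    simp only [w, dist_self_add_left, Complex.norm_real, Real.norm_eq_abs]
    exact abs_of_pos (by positivity)
  have h1 : μ.real (ball z (4 * r)) ≤ 2 ^ (K * 3) * μ.real (ball w r) :=
    h.real_ball_le_of_le hr 3 (by rw [dist_comm, hw]; linarith)
  have hd : Disjoint (ball z r) (ball w r) :=
    ball_disjoint_ball (by rw [dist_comm, hw]; linarith)
  have h2 : μ.real (ball z r) + μ.real (ball w r) ≤ μ.real (ball z (4 * r)) := by
    rw [← measureReal_union hd measurableSet_ball (h.measure_ball_lt_top _ _).ne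
      (h.measure_ball_lt_top _ _).ne]
    exact h.real_mono (union_subset (ball_subset_ball (by linarith))
      (ball_subset_ball' (by rw [hw]; linarith)))
  have h3 : (1 / 2 : ℝ) ^ (3 * K) * μ.real (ball z (4 * r)) ≤ μ.real (ball w r) := by
    calc (1 / 2 : ℝ) ^ (3 * K) * μ.real (ball z (4 * r))
        ≤ (1 / 2 : ℝ) ^ (3 * K) * (2 ^ (K * 3) * μ.real (ball w r)) := by gcongr
      _ = μ.real (ball w r) := by
        rw [mul_comm K 3, ← mul_assoc, ← mul_pow]; norm_num
  unfold reverseRatio; linarith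

theorem real_le_reverse_pow (h : DoublingWith μ K) (z : ℂ) {r : ℝ} (hr : 0 < r) (j : ℕ) :
    μ.real (ball z r) ≤ reverseRatio K ^ j * μ.real (ball z (4 ^ j * r)) := by
  induction j with
  | zero => simp
  | succ j ih =>
    have h1 := h.real_le_reverse z (r := 4 ^ j * r) (by positivity)
    calc μ.real (ball z r) ≤ reverseRatio K ^ j * μ.real (ball z (4 ^ j * r)) := ih
      _ ≤ reverseRatio K ^ j * (reverseRatio K * μ.real (ball z (4 * (4 ^ j * r)))) := by
        gcongr; exact pow_nonneg (reverseRatio_nonneg K) _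
      _ = _ := by rw [pow_succ, pow_succ]; ring_nf

theorem reverseRatio_pos (h : DoublingWith μ K) : 0 < reverseRatio K := by
  have h1 := h.real_le_reverse 0 one_pos
  have h2 := h.real_pos 0 one_pos
  by_contra hc
  have h3 : reverseRatio K = 0 := le_antisymm (not_lt.1 hc) (reverseRatio_nonneg K)
  rw [h3, zero_mul] at h1; linarith

theorem real_ball_shrink (h : DoublingWith μ K) (z : ℂ) {r : ℝ} (hr : 0 < r) (j : ℕ) :
    μ.real (ball z (r / 4 ^ j)) ≤ reverseRatio K ^ j * μ.real (ball z r) := by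
  have := h.real_le_reverse_pow z (r := r / 4 ^ j) (by positivity) j
  rwa [mul_div_cancel₀ _ (by positivity)] at this

theorem measure_singleton (h : DoublingWith μ K) (z : ℂ) : μ {z} = 0 := by
  have h0 : μ.real {z} = 0 := by
    refine le_antisymm (ge_of_tendsto' (x := atTop) (f := fun j : ℕ =>
      reverseRatio K ^ j * μ.real (ball z 1)) ?_ fun j => ?_) measureReal_nonneg
    · simpa using (tendsto_pow_atTop_nhds_zero_of_lt_one (reverseRatio_nonneg K)
        (reverseRatio_lt_one K)).mul_const (μ.real (ball z 1))
    · refine le_trans (h.real_mono ?_) (h.real_ball_shrink z one_pos j)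
      simp only [singleton_subset_iff, mem_ball, dist_self]; positivity
  exact (measureReal_eq_zero_iff (h.measure_lt_top Bornology.isBounded_singleton).ne).1 h0

/-- Circles are null sets: by the density theorem, since every disc centred on a circle contains a
disc of half the radius inside the circle. -/
theorem measure_sphere (h : DoublingWith μ K) (z : ℂ) {r : ℝ} (hr : 0 < r) :
    μ (sphere z r) = 0 := by
  have := h.locallyFinite
  have hdbl : IsUnifLocDoublingMeasure μ := by
    refine ⟨⟨2 ^ (K + K), ?_⟩⟩
    filter_upwards [self_mem_nhdsWithin] with e (he : 0 < e) x
    calc μ (closedBall x (2 * e)) ≤ μ (ball x (2 * (2 * e))) :=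
          measure_mono (closedBall_subset_ball (by linarith))
      _ ≤ 2 ^ K * (2 ^ K * μ (ball x e)) :=
          (h.le _ _ (by positivity)).trans (by gcongr; exact h.le _ _ he)
      _ ≤ 2 ^ K * (2 ^ K * μ (closedBall x e)) := by gcongr; exact ball_subset_closedBall
      _ = _ := by rw [pow_add]; push_cast; ring
  by_contra hne
  have hae := IsUnifLocDoublingMeasure.ae_tendsto_measure_inter_div μ (sphere z r) 1
  have hae2 := (ae_restrict_iff' isClosed_sphere.measurableSet).1 hae
  have : ∃ x ∈ sphere z r, ∀ {ι : Type} {l : Filter ι} (w : ι → ℂ) (δ : ι → ℝ)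
      (_ : Tendsto δ l (𝓝[>] 0)) (_ : ∀ᶠ j in l, x ∈ closedBall (w j) (1 * δ j)),
      Tendsto (fun j => μ (sphere z r ∩ closedBall (w j) (δ j)) / μ (closedBall (w j) (δ j))) l
        (𝓝 1) := by
    by_contra hcon
    push Not at hcon
    apply hne
    refine measure_mono_null (fun x hx => ?_) hae2
    simp only [mem_compl_iff, mem_ofPred_eq]
    intro hx2
    obtain ⟨ι, l, w, δ, h1, h2, h3⟩ := hcon x hx
    exact h3 (hx2 hx w δ h1 h2)
  obtain ⟨x, hx, hlim⟩ := this
  have hlim := hlim (ι := ℝ) (l := 𝓝[>] 0) (fun _ => x) (fun e => e) tendsto_id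
    (by filter_upwards [self_mem_nhdsWithin] with e (he : 0 < e); simp [he.le])
  have hxr : ‖z - x‖ = r := by rw [← dist_eq_norm, dist_comm]; exact hx
  have hle : ∀ᶠ e in 𝓝[>] (0 : ℝ), μ (sphere z r ∩ closedBall x e) / μ (closedBall x e)
      ≤ ENNReal.ofReal (reverseRatio K) := by
    have : Ioo (0 : ℝ) r ∈ 𝓝[>] (0 : ℝ) := Ioo_mem_nhdsGT hr
    filter_upwards [this] with e he
    obtain ⟨he0, her⟩ := he
    set y : ℂ := x + ((e / 2 / r : ℝ) : ℂ) * (z - x)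
    have hyx : dist y x = e / 2 := by
      simp only [y, dist_self_add_left, norm_mul, hxr, Complex.norm_real, Real.norm_eq_abs]
      rw [abs_of_pos (by positivity)]; field_simp
    have hyz : dist y z = r - e / 2 := by
      have : y - z = ((1 - e / 2 / r : ℝ) : ℂ) * (x - z) := by simp only [y]; push_cast; ring
      rw [dist_eq_norm, this, norm_mul, norm_sub_rev, hxr, Complex.norm_real, Real.norm_eq_abs,
        abs_of_pos]
      · field_simp
      · have : e / 2 / r < 1 := by rw [div_lt_one hr]; linarith
        linarith
    have hb : μ.real (closedBall x e) ≤ 2 ^ (K * 3) * μ.real (ball y (e / 2)) := by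
      refine (h.real_mono (closedBall_subset_ball' (ε₂ := 4 * e) (y := y) ?_)).trans ?_
      · rw [dist_comm, hyx]; linarith
      · exact h.real_ball_le_of_le (by positivity) 3 (by rw [dist_self]; linarith)
    have hd : Disjoint (sphere z r ∩ closedBall x e) (ball y (e / 2)) := by
      rw [Set.disjoint_left]
      rintro p ⟨hp, -⟩ hp2
      rw [mem_sphere] at hp
      rw [mem_ball] at hp2
      have := dist_triangle p y z
      rw [hyz, hp] at this; linarith
    have hfin := fun s (hs : s ⊆ closedBall x e) =>
      (h.measure_lt_top (isBounded_closedBall.subset hs)).ne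
    have hsub : ball y (e / 2) ⊆ closedBall x e :=
      ball_subset_closedBall.trans (closedBall_subset_closedBall' (by rw [hyx]; linarith))
    have h2 : μ.real (sphere z r ∩ closedBall x e) + μ.real (ball y (e / 2))
        ≤ μ.real (closedBall x e) := by
      rw [← measureReal_union hd measurableSet_ball (hfin _ inter_subset_right) (hfin _ hsub)]
      exact measureReal_mono (union_subset inter_subset_right hsub) (hfin _ subset_rfl)
    have h3 : (1 / 2 : ℝ) ^ (3 * K) * μ.real (closedBall x e) ≤ μ.real (ball y (e / 2)) := by
      calc (1 / 2 : ℝ) ^ (3 * K) * μ.real (closedBall x e)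
          ≤ (1 / 2 : ℝ) ^ (3 * K) * (2 ^ (K * 3) * μ.real (ball y (e / 2))) := by gcongr
        _ = μ.real (ball y (e / 2)) := by
          rw [mul_comm K 3, ← mul_assoc, ← mul_pow]; norm_num
    have h4 : μ.real (sphere z r ∩ closedBall x e) ≤ reverseRatio K * μ.real (closedBall x e) := by
      unfold reverseRatio; linarith
    refine ENNReal.div_le_of_le_mul ?_
    rw [← ENNReal.ofReal_toReal (hfin _ inter_subset_right),
      ← ENNReal.ofReal_toReal (hfin _ (subset_refl (closedBall x e))),
      ← ENNReal.ofReal_mul (reverseRatio_nonneg K)]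
    exact ENNReal.ofReal_le_ofReal h4
  have h5 := le_of_tendsto hlim hle
  rw [ENNReal.one_le_ofReal] at h5
  exact absurd (reverseRatio_lt_one K) (not_lt.2 h5)

/-- The mass of `D(z, r)` is continuous in `r`, because circles are null sets. -/
theorem continuousOn_real_ball (h : DoublingWith μ K) (z : ℂ) :
    ContinuousOn (fun r => μ.real (ball z r)) (Ioi 0) := by
  intro r (hr : 0 < r)
  have : Tendsto (fun s => ∫ w, (ball z s).indicator (fun _ => (1 : ℝ)) w ∂μ) (𝓝 r)
      (𝓝 (∫ w, (ball z r).indicator (fun _ => (1 : ℝ)) w ∂μ)) := by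
    refine tendsto_integral_filter_of_dominated_convergence
      ((ball z (r + 1)).indicator (fun _ => (1 : ℝ))) ?_ ?_ ?_ ?_
    · exact Eventually.of_forall fun s =>
        (measurable_const.indicator measurableSet_ball).aestronglyMeasurable
    · filter_upwards [Iio_mem_nhds (show r < r + 1 by linarith)] with s (hs : s < r + 1)
      refine Eventually.of_forall fun w => ?_
      rw [norm_indicator_eq_indicator_norm]
      refine (indicator_le_indicator_of_subset (ball_subset_ball hs.le)
        (fun _ => norm_nonneg _) w).trans ?_
      simp
    · exact (integrable_indicator_iff measurableSet_ball).2
        (integrableOn_const (h.measure_ball_lt_top _ _).ne)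
    · have hs : ∀ᵐ w ∂μ, w ∉ sphere z r := measure_eq_zero_iff_ae_notMem.1 (h.measure_sphere z hr)
      filter_upwards [hs] with w hw
      have hw : dist w z ≠ r := hw
      refine tendsto_const_nhds.congr' ?_
      rcases lt_or_gt_of_ne hw with hlt | hgt
      · filter_upwards [Ioi_mem_nhds hlt] with s hs
        have h1 : w ∈ ball z s := hs
        have h2 : w ∈ ball z r := hlt
        simp [h1, h2]
      · filter_upwards [Iio_mem_nhds hgt] with s hs
        have h1 : w ∉ ball z s := fun h => lt_asymm hs (mem_ball.1 h)
        have h2 : w ∉ ball z r := fun h => lt_asymm hgt (mem_ball.1 h)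
        simp [h1, h2]
  simp only [integral_indicator_const _ measurableSet_ball, smul_eq_mul, mul_one] at this
  exact this.mono_left nhdsWithin_le_nhds

theorem exists_real_ball_lt (h : DoublingWith μ K) (z : ℂ) {M : ℝ} (hM : 0 < M) :
    ∃ r > 0, μ.real (ball z r) < M := by
  have h1 : Tendsto (fun j : ℕ => reverseRatio K ^ j * μ.real (ball z 1)) atTop (𝓝 0) := by
    simpa using (tendsto_pow_atTop_nhds_zero_of_lt_one (reverseRatio_nonneg K)
        (reverseRatio_lt_one K)).mul_const (μ.real (ball z 1))
  obtain ⟨j, hj⟩ := (h1.eventually (gt_mem_nhds hM)).exists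
  exact ⟨1 / 4 ^ j, by positivity, (h.real_ball_shrink z one_pos j).trans_lt hj⟩

theorem exists_le_real_ball (h : DoublingWith μ K) (z : ℂ) {r : ℝ} (hr : 0 < r) (M : ℝ) :
    ∃ j : ℕ, M ≤ μ.real (ball z (4 ^ j * r)) := by
  have hq := h.reverseRatio_pos
  have h1 : Tendsto (fun j : ℕ => reverseRatio K ^ j * M) atTop (𝓝 0) := by
    simpa using (tendsto_pow_atTop_nhds_zero_of_lt_one (reverseRatio_nonneg K)
        (reverseRatio_lt_one K)).mul_const M
  obtain ⟨j, hj⟩ := (h1.eventually (gt_mem_nhds (h.real_pos z hr))).exists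
  refine ⟨j, ?_⟩
  have := hj.trans_le (h.real_le_reverse_pow z hr j)
  exact (lt_of_mul_lt_mul_left this (by positivity)).le

end DoublingWith

/-! ### Discs of prescribed mass -/

/-- The radius of the disc about `z` of mass `M`. -/
def rad (μ : Measure ℂ) (M : ℝ) (z : ℂ) : ℝ :=
  sInf {r : ℝ | 0 < r ∧ μ (ball z r) = ENNReal.ofReal M}

theorem rho_eq_rad (φ : ℂ → ℝ) : rho φ = rad (laplacianMeasure φ) 1 := by
  ext z; simp [rho, rad]

namespace DoublingWith

variable {μ : Measure ℂ} {K : ℕ} {M : ℝ}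

theorem measure_eq_iff (h : DoublingWith μ K) (hM : 0 < M) (z : ℂ) (r : ℝ) :
    μ (ball z r) = ENNReal.ofReal M ↔ μ.real (ball z r) = M := by
  rw [Measure.real, ← ENNReal.toReal_eq_toReal_iff' (h.measure_ball_lt_top z r).ne
    ENNReal.ofReal_ne_top, ENNReal.toReal_ofReal hM.le]

theorem exists_rad_le (h : DoublingWith μ K) (hM : 0 < M) {z : ℂ} {s : ℝ}
    (hMs : M ≤ μ.real (ball z s)) : ∃ r, 0 < r ∧ r ≤ s ∧ μ.real (ball z r) = M := by
  obtain ⟨r0, hr0, hr0M⟩ := h.exists_real_ball_lt z hM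
  have hlt : r0 ≤ s := by
    by_contra hc
    exact absurd (hMs.trans (h.real_mono (ball_subset_ball (not_le.1 hc).le))) (not_le.2 hr0M)
  obtain ⟨r, hr, hrM⟩ := intermediate_value_Icc hlt ((h.continuousOn_real_ball z).mono
    (fun x hx => hr0.trans_le hx.1)) ⟨hr0M.le, hMs⟩
  exact ⟨r, hr0.trans_le hr.1, hr.2, hrM⟩

theorem bddBelow_rad (z : ℂ) :
    BddBelow {r : ℝ | 0 < r ∧ μ (ball z r) = ENNReal.ofReal M} :=
  ⟨0, fun _ hr => hr.1.le⟩

theorem rad_le (h : DoublingWith μ K) (hM : 0 < M) {z : ℂ} {s : ℝ}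
    (hMs : M ≤ μ.real (ball z s)) : rad μ M z ≤ s := by
  obtain ⟨r, hr, hrs, hrM⟩ := h.exists_rad_le hM hMs
  exact (csInf_le (bddBelow_rad z) ⟨hr, (h.measure_eq_iff hM z r).2 hrM⟩).trans hrs

theorem rad_set_nonempty (h : DoublingWith μ K) (hM : 0 < M) (z : ℂ) :
    {r : ℝ | 0 < r ∧ μ (ball z r) = ENNReal.ofReal M}.Nonempty := by
  obtain ⟨j, hj⟩ := h.exists_le_real_ball z one_pos M
  obtain ⟨r, hr, -, hrM⟩ := h.exists_rad_le hM hj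
  exact ⟨r, hr, (h.measure_eq_iff hM z r).2 hrM⟩

theorem rad_pos (h : DoublingWith μ K) (hM : 0 < M) (z : ℂ) : 0 < rad μ M z := by
  obtain ⟨r0, hr0, hr0M⟩ := h.exists_real_ball_lt z hM
  refine hr0.trans_le (le_csInf (h.rad_set_nonempty hM z) fun t ht => ?_)
  by_contra hc
  have := h.real_mono (ball_subset_ball (x := z) (not_le.1 hc).le)
  rw [(h.measure_eq_iff hM z t).1 ht.2] at this
  linarith

theorem real_ball_rad (h : DoublingWith μ K) (hM : 0 < M) (z : ℂ) :
    μ.real (ball z (rad μ M z)) = M := by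
  have hpos := h.rad_pos hM z
  refine le_antisymm ?_ ?_
  · obtain ⟨r, hr⟩ := h.rad_set_nonempty hM z
    exact (h.real_mono (ball_subset_ball (csInf_le (bddBelow_rad z) hr))).trans
      ((h.measure_eq_iff hM z r).1 hr.2).le
  · have hc : Tendsto (fun r => μ.real (ball z r)) (𝓝[>] (rad μ M z))
        (𝓝 (μ.real (ball z (rad μ M z)))) :=
      ((h.continuousOn_real_ball z).continuousAt (Ioi_mem_nhds hpos)).tendsto.mono_left
        nhdsWithin_le_nhds
    refine ge_of_tendsto hc ?_
    filter_upwards [self_mem_nhdsWithin] with s hs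
    obtain ⟨t, ht, hts⟩ := exists_lt_of_csInf_lt (h.rad_set_nonempty hM z) hs
    exact ((h.measure_eq_iff hM z t).1 ht.2).ge.trans (h.real_mono (ball_subset_ball hts.le))

theorem lt_rad (h : DoublingWith μ K) (hM : 0 < M) {z : ℂ} {s : ℝ}
    (hs : μ.real (ball z s) < M) : s < rad μ M z := by
  by_contra hc
  have := h.real_mono (ball_subset_ball (x := z) (not_lt.1 hc))
  rw [h.real_ball_rad hM] at this
  linarith

theorem rad_le_add_dist (h : DoublingWith μ K) (hM : 0 < M) (z ζ : ℂ) :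
    rad μ M z ≤ rad μ M ζ + dist z ζ := by
  have hpos := h.rad_pos hM ζ
  refine h.rad_le hM ?_
  exact (h.real_ball_rad hM ζ).ge.trans
    (h.real_mono (ball_subset_ball' (by rw [dist_comm])))

theorem rad_mono (h : DoublingWith μ K) (hM : 0 < M) {M' : ℝ} (hMM : M ≤ M') (z : ℂ) :
    rad μ M z ≤ rad μ M' z :=
  h.rad_le hM (by rwa [h.real_ball_rad (hM.trans_le hMM)])

theorem pow_mul_rad_le (h : DoublingWith μ K) (hM : 0 < M) {M' : ℝ} (i : ℕ)
    (hMM : 2 ^ (K * i) * M < M') (z : ℂ) : 2 ^ i * rad μ M z ≤ rad μ M' z := by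
  refine (h.lt_rad ((by positivity : 0 < 2 ^ (K * i) * M).trans hMM) ?_).le
  refine (h.real_pow_le z (h.rad_pos hM z) i).trans_lt ?_
  rwa [h.real_ball_rad hM]

theorem rad_le_pow_mul (h : DoublingWith μ K) (hM : 0 < M) {M' : ℝ} (hM' : 0 < M') (j : ℕ)
    (hMM : reverseRatio K ^ j * M' ≤ M) (z : ℂ) : rad μ M' z ≤ 4 ^ j * rad μ M z := by
  have hpos := h.rad_pos hM z
  have hq := h.reverseRatio_pos
  refine h.rad_le hM' ?_
  have := h.real_le_reverse_pow z hpos j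
  rw [h.real_ball_rad hM] at this
  exact le_of_mul_le_mul_left (hMM.trans this) (by positivity)

end DoublingWith

/-- Discs of different prescribed masses have comparable radii. -/
theorem exists_rad_le_mul_rad (K : ℕ) {M M' : ℝ} (hM : 0 < M) (hM' : 0 < M') :
    ∃ C : ℝ, 1 ≤ C ∧ ∀ μ : Measure ℂ, DoublingWith μ K → ∀ z,
      rad μ M' z ≤ C * rad μ M z := by
  have h1 : Tendsto (fun j : ℕ => reverseRatio K ^ j * M') atTop (𝓝 0) := by
    simpa using (tendsto_pow_atTop_nhds_zero_of_lt_one (reverseRatio_nonneg K)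
        (reverseRatio_lt_one K)).mul_const M'
  obtain ⟨j, hj⟩ := (h1.eventually (gt_mem_nhds hM)).exists
  exact ⟨4 ^ j, one_le_pow₀ (by norm_num), fun μ h z => h.rad_le_pow_mul hM hM' j hj.le z⟩

/-- On a disc of radius comparable to `rad μ M` the function `rad μ M` is comparable to a constant,
uniformly in `M`. -/
theorem exists_rad_le_mul (K : ℕ) (A : ℝ) : ∃ C : ℝ, 1 ≤ C ∧ ∀ μ : Measure ℂ, DoublingWith μ K →
    ∀ M : ℝ, 0 < M → ∀ z ζ : ℂ, dist ζ z ≤ A * rad μ M z → rad μ M z ≤ C * rad μ M ζ := by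
  obtain ⟨i, hi⟩ := pow_unbounded_of_one_lt (A + 1) (one_lt_two (α := ℝ))
  have h1 : Tendsto (fun j : ℕ => reverseRatio K ^ j * 2 ^ (K * i)) atTop (𝓝 0) := by
    simpa using (tendsto_pow_atTop_nhds_zero_of_lt_one (reverseRatio_nonneg K)
        (reverseRatio_lt_one K)).mul_const ((2 : ℝ) ^ (K * i))
  obtain ⟨j, hj⟩ := (h1.eventually (gt_mem_nhds one_pos)).exists
  refine ⟨4 ^ j, one_le_pow₀ (by norm_num), fun μ h M hM z ζ hζ => ?_⟩
  have hpos := h.rad_pos hM z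
  have h2 : μ.real (ball ζ (rad μ M z)) ≤ 2 ^ (K * i) * M := by
    refine (h.real_ball_le_of_le hpos i (by nlinarith)).trans_eq ?_
    rw [h.real_ball_rad hM z]
  have h3 : μ.real (ball ζ (rad μ M z / 4 ^ j)) < M := by
    calc μ.real (ball ζ (rad μ M z / 4 ^ j))
        ≤ reverseRatio K ^ j * (2 ^ (K * i) * M) :=
          (h.real_ball_shrink ζ hpos j).trans (by gcongr; exact pow_nonneg (reverseRatio_nonneg K) _)
      _ = (reverseRatio K ^ j * 2 ^ (K * i)) * M := by ring
      _ < 1 * M := by gcongr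
      _ = M := one_mul M
  have := (h.lt_rad hM h3).le
  rwa [div_le_iff₀ (by positivity), mul_comm] at this

/-- A set of points `a` at mutual distances at least `δ` times their values of the scale `ρ`. -/
def SeparatedBy (ρ : ℂ → ℝ) (δ : ℝ) (S : Set ℂ) : Prop :=
  ∀ a ∈ S, ∀ b ∈ S, a ≠ b → δ * max (ρ a) (ρ b) ≤ ‖a - b‖

/-- A separated set has boundedly many points in discs of radius comparable to `rad μ M`. -/
theorem exists_card_le (K : ℕ) (A : ℝ) {δ : ℝ} (hδ : 0 < δ) : ∃ N : ℕ,
    ∀ μ : Measure ℂ, DoublingWith μ K → ∀ M : ℝ, 0 < M → ∀ F : Finset ℂ,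
      SeparatedBy (rad μ M) δ F → ∀ z : ℂ, (∀ a ∈ F, dist a z ≤ A * rad μ M z) → F.card ≤ N := by
  obtain ⟨i, hi⟩ := pow_unbounded_of_one_lt (2 / δ) (one_lt_two (α := ℝ))
  obtain ⟨l, hl⟩ := pow_unbounded_of_one_lt (A + δ / 2 * (1 + A)) (one_lt_two (α := ℝ))
  refine ⟨2 ^ (K * (i + l)), fun μ h M hM F hF z hz => ?_⟩
  have hpos := h.rad_pos hM z
  set B : ℂ → Set ℂ := fun a => ball a (δ / 2 * rad μ M a)
  have hB : ∀ a, M ≤ 2 ^ (K * i) * μ.real (B a) := by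
    intro a
    have hpa := h.rad_pos hM a
    refine (h.real_ball_rad hM a).ge.trans
      (h.real_ball_le_of_le (r := δ / 2 * rad μ M a) (by positivity) i ?_)
    rw [dist_self, zero_add, ← mul_assoc]
    refine le_mul_of_one_le_left hpa.le ?_
    rw [div_lt_iff₀ hδ] at hi; linarith
  have hdisj : (F : Set ℂ).PairwiseDisjoint B := by
    intro a ha b hb hab
    refine ball_disjoint_ball ?_
    rw [dist_eq_norm]
    refine le_trans ?_ (hF a ha b hb hab)
    have h1 := le_max_left (rad μ M a) (rad μ M b)
    have h2 := le_max_right (rad μ M a) (rad μ M b)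
    nlinarith
  have hsub : ∀ a ∈ F, B a ⊆ ball z (2 ^ l * rad μ M z) := by
    intro a ha
    refine ball_subset_ball' ?_
    have h1 := hz a ha
    have h2 := h.rad_le_add_dist hM a z
    nlinarith
  have hsum : ∑ a ∈ F, μ.real (B a) ≤ 2 ^ (K * l) * M := by
    rw [← measureReal_biUnion_finset hdisj (fun a _ => measurableSet_ball)
      (fun a _ => (h.measure_ball_lt_top _ _).ne)]
    refine (h.real_mono (iUnion₂_subset hsub)).trans ?_
    have := h.real_pow_le z hpos l
    rwa [h.real_ball_rad hM] at this
  have h3 : (F.card : ℝ) * M ≤ 2 ^ (K * (i + l)) * M := by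
    calc (F.card : ℝ) * M = ∑ a ∈ F, M := by simp
      _ ≤ ∑ a ∈ F, 2 ^ (K * i) * μ.real (B a) := Finset.sum_le_sum fun a _ => hB a
      _ = 2 ^ (K * i) * ∑ a ∈ F, μ.real (B a) := by rw [Finset.mul_sum]
      _ ≤ 2 ^ (K * i) * (2 ^ (K * l) * M) := by gcongr
      _ = _ := by rw [mul_add, pow_add]; ring
  exact_mod_cast le_of_mul_le_mul_right h3 hM

/-- The set version of `exists_card_le`. -/
theorem exists_ncard_le (K : ℕ) (A : ℝ) {δ : ℝ} (hδ : 0 < δ) : ∃ N : ℕ,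
    ∀ μ : Measure ℂ, DoublingWith μ K → ∀ M : ℝ, 0 < M → ∀ S : Set ℂ,
      SeparatedBy (rad μ M) δ S → ∀ z : ℂ, {a ∈ S | dist a z ≤ A * rad μ M z}.Finite ∧
        {a ∈ S | dist a z ≤ A * rad μ M z}.ncard ≤ N := by
  obtain ⟨N, hN⟩ := exists_card_le K A hδ
  refine ⟨N, fun μ h M hM S hS z => ?_⟩
  have key : ∀ F : Finset ℂ, (F : Set ℂ) ⊆ {a ∈ S | dist a z ≤ A * rad μ M z} → F.card ≤ N :=
    fun F hF => hN μ h M hM F (fun a ha b hb => hS a (hF ha).1 b (hF hb).1) z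
      fun a ha => (hF ha).2
  have hfin : {a ∈ S | dist a z ≤ A * rad μ M z}.Finite := by
    by_contra hinf
    obtain ⟨F, hF, hc⟩ := Set.Infinite.exists_subset_card_eq hinf (N + 1)
    have := key F hF
    omega
  refine ⟨hfin, ?_⟩
  rw [ncard_eq_toFinset_card _ hfin]
  exact key _ (by simp)

theorem SeparatedBy.finite_inter {μ : Measure ℂ} {K : ℕ} (h : DoublingWith μ K) {M : ℝ}
    (hM : 0 < M) {δ : ℝ} (hδ : 0 < δ) {S : Set ℂ} (hS : SeparatedBy (rad μ M) δ S) {B : Set ℂ}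
    (hB : Bornology.IsBounded B) : (S ∩ B).Finite := by
  obtain ⟨R, hR⟩ := hB.subset_closedBall 0
  have hpos := h.rad_pos hM 0
  obtain ⟨N, hN⟩ := exists_ncard_le K (R / rad μ M 0) hδ
  refine (hN μ h M hM S hS 0).1.subset fun a ha => ⟨ha.1, ?_⟩
  rw [div_mul_cancel₀ _ hpos.ne']
  exact hR ha.2

/-- A net at scale `ρ`: a `1/4`-separated set such that every point `z` is within `ρ(z) / 3` of
it. -/
structure IsScaleNet (ρ : ℂ → ℝ) (W : Set ℂ) : Prop where
  separated : SeparatedBy ρ (1 / 4) W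
  exists_near : ∀ z, ∃ w ∈ W, dist z w ≤ ρ z / 3

theorem DoublingWith.exists_isScaleNet {μ : Measure ℂ} {K : ℕ} (h : DoublingWith μ K) {M : ℝ}
    (hM : 0 < M) : ∃ W, IsScaleNet (rad μ M) W := by
  obtain ⟨W, hW⟩ := zorn_subset {S : Set ℂ | SeparatedBy (rad μ M) (1 / 4) S} (by
    intro c hc hchain
    refine ⟨⋃₀ c, ?_, fun s hs => subset_sUnion_of_mem hs⟩
    rintro a ⟨s, hs, has⟩ b ⟨t, ht, hbt⟩ hab
    rcases hchain.total hs ht with hst | hst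
    · exact hc ht a (hst has) b hbt hab
    · exact hc hs a has b (hst hbt) hab)
  refine ⟨W, hW.prop, fun z => ?_⟩
  by_contra! hcon
  have hpos := h.rad_pos hM z
  have hz : z ∉ W := fun hz => by have := hcon z hz; rw [dist_self] at this; linarith
  have hins : SeparatedBy (rad μ M) (1 / 4) (insert z W) := by
    have key : ∀ b ∈ W, 1 / 4 * max (rad μ M z) (rad μ M b) ≤ dist z b := by
      intro b hb
      have h1 := hcon b hb
      have h2 := h.rad_le_add_dist hM b z
      rw [dist_comm] at h2
      rcases max_cases (rad μ M z) (rad μ M b) with ⟨h3, -⟩ | ⟨h3, -⟩ <;> rw [h3] <;> linarith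
    rintro a (rfl | ha) b (rfl | hb) hab
    · exact absurd rfl hab
    · rw [← dist_eq_norm]; exact key b hb
    · rw [← dist_eq_norm, dist_comm, max_comm]; exact key a ha
    · exact hW.prop a ha b hb hab
  exact hz (hW.le_of_ge hins (subset_insert z W) (mem_insert z W))

/-! ### Logarithmic integrals over discs -/

/-- The logarithmic potential of a doubling measure on a disc is at most a multiple of its mass. -/
theorem DoublingWith.lintegral_log_le {μ : Measure ℂ} {K : ℕ} (h : DoublingWith μ K) (z : ℂ) {r : ℝ}
    (hr : 0 < r) : ∫⁻ ζ in ball z r, ENNReal.ofReal (Real.log (r / dist z ζ)) ∂μ ≤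
      ENNReal.ofReal (Real.log 4 / (1 - reverseRatio K) * μ.real (ball z r)) := by
  have hl4 : 0 < Real.log 4 := Real.log_pos (by norm_num)
  have hq0 := reverseRatio_nonneg K
  have hq1 := reverseRatio_lt_one K
  have hpt : ∀ ζ, (ball z r).indicator (fun ζ => ENNReal.ofReal (Real.log (r / dist z ζ))) ζ ≤
      ∑' j : ℕ, (ball z (r / 4 ^ j)).indicator (fun _ => ENNReal.ofReal (Real.log 4)) ζ := by
    intro ζ
    by_cases hζ : ζ ∈ ball z r
    swap
    · rw [indicator_of_notMem hζ]; exact zero_le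
    rw [indicator_of_mem hζ]
    rw [mem_ball, dist_comm] at hζ
    rcases eq_or_lt_of_le (dist_nonneg (x := z) (y := ζ)) with h0 | h0
    · simp [← h0]
    have hex : ∃ n : ℕ, r / 4 ^ n ≤ dist z ζ := by
      obtain ⟨n, hn⟩ := pow_unbounded_of_one_lt (r / dist z ζ) (by norm_num : (1 : ℝ) < 4)
      refine ⟨n, ?_⟩
      rw [div_lt_iff₀ h0] at hn
      rw [div_le_iff₀ (by positivity)]; linarith
    classical
    set n := Nat.find hex
    have hn := Nat.find_spec hex
    have hmin : ∀ j < n, dist z ζ < r / 4 ^ j := fun j hj => not_le.1 (Nat.find_min hex hj)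
    calc ENNReal.ofReal (Real.log (r / dist z ζ))
        ≤ ENNReal.ofReal (n * Real.log 4) := by
          refine ENNReal.ofReal_le_ofReal ?_
          rw [← Real.log_pow]
          refine Real.log_le_log (by positivity) ?_
          rw [div_le_iff₀ (by positivity)] at hn
          rw [div_le_iff₀ h0]; linarith
      _ = ∑ j ∈ Finset.range n,
          (ball z (r / 4 ^ j)).indicator (fun _ => ENNReal.ofReal (Real.log 4)) ζ := by
          rw [Finset.sum_congr rfl fun j hj => indicator_of_mem
            (mem_ball'.2 (hmin j (Finset.mem_range.1 hj))) _]
          rw [Finset.sum_const, Finset.card_range, nsmul_eq_mul,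
            ENNReal.ofReal_mul (Nat.cast_nonneg n), ENNReal.ofReal_natCast]
      _ ≤ _ := ENNReal.sum_le_tsum _
  rw [← lintegral_indicator measurableSet_ball]
  refine (lintegral_mono hpt).trans ?_
  rw [lintegral_tsum fun j => (measurable_const.indicator measurableSet_ball).aemeasurable]
  have hgeo := (hasSum_geometric_of_lt_one hq0 hq1).mul_left (Real.log 4 * μ.real (ball z r))
  have hterm : ∀ j : ℕ, ∫⁻ ζ, (ball z (r / 4 ^ j)).indicator
      (fun _ => ENNReal.ofReal (Real.log 4)) ζ ∂μ ≤
      ENNReal.ofReal (Real.log 4 * μ.real (ball z r) * reverseRatio K ^ j) := by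
    intro j
    rw [lintegral_indicator_const measurableSet_ball,
      ← ENNReal.ofReal_toReal (h.measure_ball_lt_top z (r / 4 ^ j)).ne, ← ENNReal.ofReal_mul hl4.le]
    refine ENNReal.ofReal_le_ofReal ?_
    have := h.real_ball_shrink z hr j
    rw [Measure.real] at this
    calc _ ≤ Real.log 4 * (reverseRatio K ^ j * μ.real (ball z r)) := by gcongr
      _ = _ := by ring
  refine (ENNReal.tsum_le_tsum hterm).trans ?_
  rw [← ENNReal.ofReal_tsum_of_nonneg (fun j => by positivity) hgeo.summable, hgeo.tsum_eq]
  refine ENNReal.ofReal_le_ofReal (le_of_eq ?_)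
  rw [div_eq_mul_inv]; ring

/-! ### Radial functions in the plane -/

theorem circleMap_eq_add_polarCoord (z : ℂ) (p : ℝ × ℝ) :
    circleMap z p.1 p.2 = z + Complex.polarCoord.symm p := by
  rw [Complex.polarCoord_symm_apply, circleMap, Complex.exp_mul_I]
  simp

theorem polarCoord_target_eq :
    polarCoord.target = Ioi (0 : ℝ) ×ˢ Ioo (-Real.pi) Real.pi := rfl

theorem lintegral_eq_polar {f : ℂ → ℝ≥0∞} (hf : Measurable f) (z : ℂ) :
    ∫⁻ w, f w = ∫⁻ r in Ioi (0 : ℝ), ENNReal.ofReal r *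
      ∫⁻ θ in Ioo (-Real.pi) Real.pi, f (circleMap z r θ) := by
  have hm : Measurable fun p : ℝ × ℝ => f (circleMap z p.1 p.2) := by
    refine hf.comp (Continuous.measurable ?_)
    unfold circleMap; fun_prop
  rw [← lintegral_add_left_eq_self f z, ← Complex.lintegral_comp_polarCoord_symm,
    polarCoord_target_eq, Measure.volume_eq_prod, ← Measure.prod_restrict]
  simp_rw [← circleMap_eq_add_polarCoord, smul_eq_mul]
  have hm' : Measurable fun p : ℝ × ℝ => ENNReal.ofReal p.1 * f (circleMap z p.1 p.2) :=
    measurable_fst.ennreal_ofReal.mul hm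
  rw [lintegral_prod _ hm'.aemeasurable]
  refine lintegral_congr fun r => ?_
  have h1 : Measurable fun θ => f (circleMap z r θ) := hm.comp (measurable_prodMk_left (x := r))
  exact lintegral_const_mul (ENNReal.ofReal r) h1

theorem circleAverage_eq_integral_Ioo (f : ℂ → ℝ) (z : ℂ) (r : ℝ) :
    2 * Real.pi * Real.circleAverage f z r =
      ∫ θ in Ioo (-Real.pi) Real.pi, f (circleMap z r θ) := by
  have hp : Function.Periodic (fun θ => f (circleMap z r θ)) (2 * Real.pi) :=
    (periodic_circleMap z r).comp f
  have h := hp.intervalIntegral_add_eq 0 (-Real.pi)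
  rw [zero_add, show -Real.pi + 2 * Real.pi = Real.pi by ring] at h
  rw [Real.circleAverage, h, smul_eq_mul, ← mul_assoc, mul_inv_cancel₀ (by positivity), one_mul,
    intervalIntegral.integral_of_le (by linarith [Real.pi_pos]), integral_Ioc_eq_integral_Ioo]

theorem integral_eq_polar {f : ℂ → ℝ} (hf : Measurable f) (hfi : Integrable f) (z : ℂ) :
    ∫ w, f w = ∫ r in Ioi (0 : ℝ), r * (2 * Real.pi * Real.circleAverage f z r) := by
  have hm : Measurable fun p : ℝ × ℝ => p.1 * f (circleMap z p.1 p.2) := by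
    refine measurable_fst.mul (hf.comp (Continuous.measurable ?_))
    unfold circleMap; fun_prop
  have hi : IntegrableOn (fun p : ℝ × ℝ => p.1 * f (circleMap z p.1 p.2))
      (Ioi 0 ×ˢ Ioo (-Real.pi) Real.pi) := by
    refine ⟨hm.aestronglyMeasurable, ?_⟩
    have h1 : ∫⁻ w, ‖f (z + w)‖ₑ < ⊤ := by
      rw [lintegral_add_left_eq_self (fun w => ‖f w‖ₑ) z]; exact hfi.2
    rw [← Complex.lintegral_comp_polarCoord_symm, polarCoord_target_eq] at h1
    refine lt_of_eq_of_lt ?_ h1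
    refine setLIntegral_congr_fun (measurableSet_Ioi.prod measurableSet_Ioo) fun p hp => ?_
    have hp0 : (0 : ℝ) < p.1 := hp.1
    simp only [enorm_mul, ← circleMap_eq_add_polarCoord, smul_eq_mul, Real.enorm_of_nonneg hp0.le]
  have h2 : ∫ w, f w = ∫ w, f (z + w) := (integral_add_left_eq_self f z).symm
  rw [h2, ← Complex.integral_comp_polarCoord_symm, polarCoord_target_eq]
  simp_rw [← circleMap_eq_add_polarCoord, smul_eq_mul]
  rw [Measure.volume_eq_prod, setIntegral_prod _ (by rwa [Measure.volume_eq_prod] at hi)]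
  refine integral_congr_ae (Eventually.of_forall fun r => ?_)
  simp only
  rw [circleAverage_eq_integral_Ioo, integral_const_mul]

theorem circleAverage_mul_radial (g : ℂ → ℝ) (q : ℝ → ℝ) (z : ℂ) (r : ℝ) :
    Real.circleAverage (fun w => g w * q (‖w - z‖ ^ 2)) z r =
      q (r ^ 2) * Real.circleAverage g z r := by
  have : ∀ θ, ‖circleMap z r θ - z‖ ^ 2 = r ^ 2 := by
    intro θ; rw [circleMap_sub_center, norm_circleMap_zero, sq_abs]
  simp only [Real.circleAverage, this, smul_eq_mul, intervalIntegral.integral_mul_const]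
  ring

theorem integral_mul_radial {g : ℂ → ℝ} (hg : Measurable g) {q : ℝ → ℝ} (hq : Measurable q)
    (z : ℂ) (hi : Integrable fun w => g w * q (‖w - z‖ ^ 2)) :
    ∫ w, g w * q (‖w - z‖ ^ 2) =
      ∫ r in Ioi (0 : ℝ), 2 * Real.pi * (r * q (r ^ 2)) * Real.circleAverage g z r := by
  have hm : Measurable fun w : ℂ => g w * q (‖w - z‖ ^ 2) := hg.mul (hq.comp (by fun_prop))
  rw [integral_eq_polar hm hi z]
  refine integral_congr_ae (Eventually.of_forall fun r => ?_)
  simp only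
  rw [circleAverage_mul_radial]; ring

/-- The Laplacian of a function of `|w - z|²`, as a function of `x = |w - z|²`. -/
def radialLaplacian (k : ℝ → ℝ) (x : ℝ) : ℝ := 4 * (deriv k x + x * deriv (deriv k) x)

theorem laplacian_eq_fderiv {f : ℂ → ℝ} (hf : ContDiff ℝ 2 f) (z : ℂ) :
    Laplacian.laplacian f z = fderiv ℝ (fun w => fderiv ℝ f w 1) z 1 +
      fderiv ℝ (fun w => fderiv ℝ f w Complex.I) z Complex.I := by
  have hd : DifferentiableAt ℝ (fderiv ℝ f) z :=
    ((hf.fderiv_right (m := 1) (by norm_num)).differentiable (by norm_num)) z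
  have h1 : ∀ e : ℂ, fderiv ℝ (fun w => fderiv ℝ f w e) z e = fderiv ℝ (fderiv ℝ f) z e e := by
    intro e
    rw [fderiv_clm_apply hd (by fun_prop)]
    simp
  rw [InnerProductSpace.laplacian_eq_iteratedFDeriv_complexPlane, h1, h1]
  simp [iteratedFDeriv_two_apply]

theorem hasFDerivAt_norm_sub_sq (z w : ℂ) :
    HasFDerivAt (fun w : ℂ => ‖w - z‖ ^ 2)
      ((2 * (w.re - z.re)) • Complex.reCLM + (2 * (w.im - z.im)) • Complex.imCLM) w := by
  have h0 : (fun w : ℂ => ‖w - z‖ ^ 2) = fun w => (w.re - z.re) ^ 2 + (w.im - z.im) ^ 2 := by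
    ext w; rw [Complex.sq_norm, Complex.normSq_apply]; simp; ring
  rw [h0]
  have h1 : HasFDerivAt (fun w : ℂ => w.re - z.re) Complex.reCLM w :=
    Complex.reCLM.hasFDerivAt.sub_const _
  have h2 : HasFDerivAt (fun w : ℂ => w.im - z.im) Complex.imCLM w :=
    Complex.imCLM.hasFDerivAt.sub_const _
  refine ((h1.pow 2).add (h2.pow 2)).congr_fderiv ?_
  simp

theorem contDiff_radial {n : ℕ∞} {k : ℝ → ℝ} (hk : ContDiff ℝ n k) (z : ℂ) :
    ContDiff ℝ n fun w : ℂ => k (‖w - z‖ ^ 2) :=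
  hk.comp ((contDiff_norm_sq ℝ).comp (contDiff_id.sub contDiff_const))

theorem laplacian_radial {k : ℝ → ℝ} (hk : ContDiff ℝ ∞ k) (z w : ℂ) :
    Laplacian.laplacian (fun w : ℂ => k (‖w - z‖ ^ 2)) w = radialLaplacian k (‖w - z‖ ^ 2) := by
  have hk' : ContDiff ℝ ∞ (deriv k) := (contDiff_infty_iff_deriv.1 hk).2
  have hkd : ∀ x, HasDerivAt k (deriv k x) x := fun x =>
    (hk.differentiable (by simp) x).hasDerivAt
  have hkd' : ∀ x, HasDerivAt (deriv k) (deriv (deriv k) x) x := fun x =>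
    (hk'.differentiable (by simp) x).hasDerivAt
  rw [laplacian_eq_fderiv (contDiff_infty.1 (contDiff_radial (n := ⊤) hk z) 2)]
  have h1 : ∀ w : ℂ, HasFDerivAt (fun w : ℂ => k (‖w - z‖ ^ 2)) _ w := fun w =>
    (hkd _).comp_hasFDerivAt w (hasFDerivAt_norm_sub_sq z w)
  have h2 : ∀ w : ℂ, HasFDerivAt (fun w : ℂ => deriv k (‖w - z‖ ^ 2)) _ w := fun w =>
    (hkd' _).comp_hasFDerivAt w (hasFDerivAt_norm_sub_sq z w)
  have h3 : (fun w => fderiv ℝ (fun w : ℂ => k (‖w - z‖ ^ 2)) w 1) =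
      fun w => deriv k (‖w - z‖ ^ 2) * (2 * (w.re - z.re)) := by
    ext w; rw [(h1 w).fderiv]; simp
  have h4 : (fun w => fderiv ℝ (fun w : ℂ => k (‖w - z‖ ^ 2)) w Complex.I) =
      fun w => deriv k (‖w - z‖ ^ 2) * (2 * (w.im - z.im)) := by
    ext w; rw [(h1 w).fderiv]; simp
  have h5 : HasFDerivAt (fun w : ℂ => 2 * (w.re - z.re)) ((2 : ℝ) • Complex.reCLM) w :=
    (Complex.reCLM.hasFDerivAt.sub_const _).const_mul 2
  have h6 : HasFDerivAt (fun w : ℂ => 2 * (w.im - z.im)) ((2 : ℝ) • Complex.imCLM) w :=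
    (Complex.imCLM.hasFDerivAt.sub_const _).const_mul 2
  have h8 : HasFDerivAt (fun w : ℂ => deriv k (‖w - z‖ ^ 2) * (2 * (w.re - z.re))) _ w :=
    (h2 w).mul h5
  have h9 : HasFDerivAt (fun w : ℂ => deriv k (‖w - z‖ ^ 2) * (2 * (w.im - z.im))) _ w :=
    (h2 w).mul h6
  rw [h3, h4, h8.fderiv, h9.fderiv]
  have h7 : ‖w - z‖ ^ 2 = (w.re - z.re) ^ 2 + (w.im - z.im) ^ 2 := by
    rw [Complex.sq_norm, Complex.normSq_apply]; simp; ring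
  simp only [radialLaplacian, _root_.add_apply, _root_.smul_apply,
    Complex.reCLM_apply, Complex.imCLM_apply, smul_eq_mul, Complex.one_re, Complex.one_im,
    Complex.I_re, Complex.I_im]
  nth_rw 6 [h7]
  ring

/-- `k` vanishes to the right of `S`, as do its derivatives. -/
theorem deriv_eq_zero_of_forall_ge {k : ℝ → ℝ} (hk : ContDiff ℝ ∞ k) {S : ℝ}
    (hS : ∀ x ≥ S, k x = 0) : ∀ x ≥ S, deriv k x = 0 := by
  have h1 : ∀ x > S, deriv k x = 0 := by
    intro x hx
    have : k =ᶠ[𝓝 x] fun _ => 0 := by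
      filter_upwards [Ioi_mem_nhds hx] with y hy using hS y (le_of_lt hy)
    rw [this.deriv_eq, deriv_const]
  intro x hx
  rcases eq_or_lt_of_le hx with rfl | hx
  · have hc : Continuous (deriv k) := hk.continuous_deriv (by exact_mod_cast le_top)
    have h2 : Tendsto (deriv k) (𝓝[>] S) (𝓝 (deriv k S)) := hc.continuousAt.mono_left inf_le_left
    refine tendsto_nhds_unique h2 (tendsto_const_nhds.congr' ?_)
    filter_upwards [self_mem_nhdsWithin] with y hy using (h1 y hy).symm
  · exact h1 x hx

theorem radialLaplacian_eq_zero {k : ℝ → ℝ} (hk : ContDiff ℝ ∞ k) {S : ℝ}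
    (hS : ∀ x ≥ S, k x = 0) : ∀ x ≥ S, radialLaplacian k x = 0 := by
  intro x hx
  have h1 := deriv_eq_zero_of_forall_ge hk hS
  rw [radialLaplacian, h1 x hx,
    deriv_eq_zero_of_forall_ge (contDiff_infty_iff_deriv.1 hk).2 h1 x hx]
  ring

theorem continuous_radialLaplacian {k : ℝ → ℝ} (hk : ContDiff ℝ ∞ k) :
    Continuous (radialLaplacian k) := by
  have h1 := (contDiff_infty_iff_deriv.1 hk).2
  have h2 := (contDiff_infty_iff_deriv.1 h1).2
  have := h1.continuous
  have := h2.continuous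
  unfold radialLaplacian
  fun_prop

theorem hasCompactSupport_radial {k : ℝ → ℝ} {S : ℝ} (hS : ∀ x ≥ S ^ 2, k x = 0) (z : ℂ) :
    HasCompactSupport fun w : ℂ => k (‖w - z‖ ^ 2) := by
  refine HasCompactSupport.intro (isCompact_closedBall z |S|) fun w hw => hS _ ?_
  rw [mem_closedBall, dist_eq_norm, not_le] at hw
  rw [ge_iff_le, ← sq_abs]
  gcongr

/-- `log |w - ζ|` is `2π` times a fundamental solution of the Laplacian, tested against radial
functions: integrate in polar coordinates, using the circle averages of the logarithm. -/
theorem integral_log_mul_radialLaplacian {k : ℝ → ℝ} (hk : ContDiff ℝ ∞ k) {S : ℝ} (hS0 : 0 < S)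
    (hS : ∀ x ≥ S ^ 2, k x = 0) {z ζ : ℂ} (hζ : z ≠ ζ)
    (hi : Integrable fun w => Real.log ‖w - ζ‖ * radialLaplacian k (‖w - z‖ ^ 2)) :
    ∫ w, Real.log ‖w - ζ‖ * radialLaplacian k (‖w - z‖ ^ 2) =
      2 * Real.pi * k (‖z - ζ‖ ^ 2) := by
  have hm : Measurable fun w : ℂ => Real.log ‖w - ζ‖ := by fun_prop
  have hcont := continuous_radialLaplacian hk
  have hk' : ContDiff ℝ ∞ (deriv k) := (contDiff_infty_iff_deriv.1 hk).2
  have hkd : ∀ x, HasDerivAt k (deriv k x) x := fun x =>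
    (hk.differentiable (by simp) x).hasDerivAt
  have hkd' : ∀ x, HasDerivAt (deriv k) (deriv (deriv k) x) x := fun x =>
    (hk'.differentiable (by simp) x).hasDerivAt
  have hkS' := deriv_eq_zero_of_forall_ge hk hS
  rw [integral_mul_radial hm hcont.measurable z hi]
  set t := ‖z - ζ‖
  have ht : 0 < t := norm_pos_iff.2 (sub_ne_zero.2 hζ)
  set m : ℝ → ℝ := fun r => 2 * r ^ 2 * deriv k (r ^ 2)
  have hsq : ∀ r : ℝ, HasDerivAt (fun r : ℝ => r ^ 2) (2 * r) r := fun r => by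
    simpa using hasDerivAt_pow 2 r
  have hmd : ∀ r, HasDerivAt m (r * radialLaplacian k (r ^ 2)) r := by
    intro r
    refine (((hsq r).const_mul 2).mul ((hkd' (r ^ 2)).comp r (hsq r))).congr_deriv ?_
    simp only [radialLaplacian, Function.comp]; ring
  set T := max t S
  have hTS : S ^ 2 ≤ T ^ 2 := by gcongr; exact le_max_right _ _
  set I : ℝ → ℝ := fun r => r * radialLaplacian k (r ^ 2) * (Real.log r + Real.posLog (r⁻¹ * t))
  have hav : ∀ r ∈ Ioi (0 : ℝ), 2 * Real.pi * (r * radialLaplacian k (r ^ 2)) *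
      Real.circleAverage (fun w => Real.log ‖w - ζ‖) z r = 2 * Real.pi * I r := by
    intro r (hr : 0 < r)
    rw [circleAverage_log_norm_sub_const_eq_log_radius_add_posLog hr.ne']
    simp only [I]; ring
  rw [setIntegral_congr_fun measurableSet_Ioi hav, integral_const_mul]
  congr 1
  have hI1 : ∀ r ∈ Ioc 0 t, I r = r * radialLaplacian k (r ^ 2) * Real.log t := by
    rintro r ⟨hr, hrt⟩
    simp only [I]
    rw [Real.posLog_eq_log (by
      rw [abs_of_pos (by positivity), inv_mul_eq_div, one_le_div hr]; exact hrt),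
      Real.log_mul (by positivity) ht.ne', Real.log_inv]
    ring
  have hI2 : ∀ r, t ≤ r → I r = r * radialLaplacian k (r ^ 2) * Real.log r := by
    intro r hrt
    have hr : 0 < r := ht.trans_le hrt
    simp only [I]
    rw [(Real.posLog_eq_zero_iff _).2 (by
      rw [abs_of_pos (by positivity), inv_mul_eq_div, div_le_one hr]; exact hrt), add_zero]
  have hI3 : ∀ r, T < r → I r = 0 := by
    intro r hr
    have hrS : S ≤ r := (le_max_right _ _).trans hr.le
    rw [hI2 r ((le_max_left _ _).trans hr.le), radialLaplacian_eq_zero hk hS _ (by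
      rw [ge_iff_le]; gcongr)]
    ring
  have hIi1 : IntervalIntegrable (fun r => r * radialLaplacian k (r ^ 2) * Real.log t)
      volume 0 t := by
    apply Continuous.intervalIntegrable
    fun_prop
  have hIi2 : IntervalIntegrable (fun r => r * radialLaplacian k (r ^ 2) * Real.log r)
      volume t T := by
    apply ContinuousOn.intervalIntegrable
    rw [uIcc_of_le (le_max_left _ _)]
    refine ContinuousOn.mul (by fun_prop) (Real.continuousOn_log.mono fun r hr => ?_)
    exact (ht.trans_le hr.1).ne'
  have hE1 : ∫ r in (0 : ℝ)..t, I r = m t * Real.log t := by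
    rw [intervalIntegral.integral_congr_ae (g := fun r => r * radialLaplacian k (r ^ 2) * Real.log t)
      (Eventually.of_forall fun r hr => hI1 r (by rwa [uIoc_of_le ht.le] at hr)),
      intervalIntegral.integral_mul_const]
    rw [intervalIntegral.integral_eq_sub_of_hasDerivAt (fun r _ => hmd r)
      (Continuous.intervalIntegrable (by fun_prop) _ _)]
    simp [m]
  have hE2 : ∫ r in t..T, I r = k (t ^ 2) - m t * Real.log t := by
    rw [intervalIntegral.integral_congr (g := fun r => r * radialLaplacian k (r ^ 2) * Real.log r)
      (fun r hr => hI2 r (by rw [uIcc_of_le (le_max_left _ _)] at hr; exact hr.1))]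
    rw [intervalIntegral.integral_eq_sub_of_hasDerivAt
      (f := fun r => m r * Real.log r - k (r ^ 2)) (fun r hr => ?_) hIi2]
    · simp only [m]
      rw [hkS' _ hTS, hS _ hTS]; ring
    · rw [uIcc_of_le (le_max_left _ _)] at hr
      have hr0 : 0 < r := ht.trans_le hr.1
      refine (((hmd r).mul (Real.hasDerivAt_log hr0.ne')).sub
        ((hkd (r ^ 2)).comp r (hsq r))).congr_deriv ?_
      simp only [m]; field_simp; ring
  have hII1 : IntervalIntegrable I volume 0 t := by
    refine hIi1.congr_ae ?_
    refine (ae_restrict_iff' measurableSet_uIoc).2 (Eventually.of_forall fun r hr => ?_)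
    exact (hI1 r (by rwa [uIoc_of_le ht.le] at hr)).symm
  have hII2 : IntervalIntegrable I volume t T := by
    refine hIi2.congr_ae ?_
    refine (ae_restrict_iff' measurableSet_uIoc).2 (Eventually.of_forall fun r hr => ?_)
    rw [uIoc_of_le (le_max_left _ _)] at hr
    exact (hI2 r hr.1.le).symm
  have hE3 : ∫ r in Ioi (0 : ℝ), I r = ∫ r in (0 : ℝ)..T, I r := by
    rw [intervalIntegral.integral_of_le (ht.le.trans (le_max_left _ _))]
    refine (setIntegral_eq_of_subset_of_forall_sdiff_eq_zero measurableSet_Ioi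
      Ioc_subset_Ioi_self fun r hr => hI3 r ?_)
    by_contra hc
    exact hr.2 ⟨hr.1, not_lt.1 hc⟩
  rw [hE3, ← intervalIntegral.integral_add_adjacent_intervals hII1 hII2, hE1, hE2]
  ring

/-! ### Logarithmic potentials -/

/-- The constant in the estimate of logarithmic integrals over discs. -/
def logConst (K : ℕ) : ℝ := Real.log 4 / (1 - reverseRatio K)

theorem logConst_nonneg (K : ℕ) : 0 ≤ logConst K :=
  div_nonneg (Real.log_nonneg (by norm_num)) (by linarith [reverseRatio_lt_one K])

namespace DoublingWith

variable {μ : Measure ℂ} {K : ℕ}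

theorem log_div_dist_nonneg {z ζ : ℂ} {r : ℝ} (hζ : ζ ∈ ball z r) :
    0 ≤ Real.log (r / dist z ζ) := by
  rw [mem_ball, dist_comm] at hζ
  rcases eq_or_lt_of_le (dist_nonneg (x := z) (y := ζ)) with h0 | h0
  · simp [← h0]
  · exact Real.log_nonneg ((one_le_div h0).2 hζ.le)

theorem integrableOn_log_div (h : DoublingWith μ K) (z : ℂ) {r : ℝ} (hr : 0 < r) :
    IntegrableOn (fun ζ => Real.log (r / dist z ζ)) (ball z r) μ := by
  have hm : Measurable fun ζ => Real.log (r / dist z ζ) := by fun_prop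
  refine ⟨hm.aestronglyMeasurable, ?_⟩
  rw [hasFiniteIntegral_iff_ofReal]
  · exact (h.lintegral_log_le z hr).trans_lt ENNReal.ofReal_lt_top
  · exact (ae_restrict_iff' measurableSet_ball).2
      (Eventually.of_forall fun ζ hζ => log_div_dist_nonneg hζ)

theorem setIntegral_log_div_le (h : DoublingWith μ K) (z : ℂ) {r : ℝ} (hr : 0 < r) :
    ∫ ζ in ball z r, Real.log (r / dist z ζ) ∂μ ≤ logConst K * μ.real (ball z r) := by
  have hm : Measurable fun ζ => Real.log (r / dist z ζ) := by fun_prop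
  rw [integral_eq_lintegral_of_nonneg_ae ((ae_restrict_iff' measurableSet_ball).2
      (Eventually.of_forall fun ζ hζ => log_div_dist_nonneg hζ)) hm.aestronglyMeasurable]
  refine ENNReal.toReal_le_of_le_ofReal ?_ (h.lintegral_log_le z hr)
  exact mul_nonneg (logConst_nonneg K) measureReal_nonneg

theorem abs_log_le {z ζ : ℂ} {r : ℝ} (hr : 0 < r) (hζ : ζ ∈ ball z r) :
    |Real.log ‖z - ζ‖| ≤ Real.log (r / dist z ζ) + |Real.log r| := by
  have h0 := log_div_dist_nonneg hζ
  rcases eq_or_ne z ζ with rfl | hne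
  · simp
  have hd : 0 < dist z ζ := dist_pos.2 hne
  have h1 : Real.log ‖z - ζ‖ = Real.log r - Real.log (r / dist z ζ) := by
    rw [Real.log_div hr.ne' hd.ne', dist_eq_norm]; ring
  rw [h1]
  calc _ ≤ |Real.log r| + |Real.log (r / dist z ζ)| := abs_sub _ _
    _ = _ := by rw [abs_of_nonneg h0, add_comm]

theorem integrableOn_log_norm_ball (h : DoublingWith μ K) (z : ℂ) {r : ℝ} (hr : 0 < r) :
    IntegrableOn (fun ζ => Real.log ‖z - ζ‖) (ball z r) μ := by
  have hm : Measurable fun ζ => Real.log ‖z - ζ‖ := by fun_prop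
  refine ((h.integrableOn_log_div z hr).add (integrableOn_const (C := |Real.log r|)
    (h.measure_ball_lt_top z r).ne)).mono' hm.aestronglyMeasurable ?_
  exact (ae_restrict_iff' measurableSet_ball).2
      (Eventually.of_forall fun ζ hζ => abs_log_le hr hζ)

theorem setIntegral_abs_log_le (h : DoublingWith μ K) (z : ℂ) {r : ℝ} (hr : 0 < r) :
    ∫ ζ in ball z r, |Real.log ‖z - ζ‖| ∂μ ≤
      (logConst K + |Real.log r|) * μ.real (ball z r) := by
  calc ∫ ζ in ball z r, |Real.log ‖z - ζ‖| ∂μ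
      ≤ ∫ ζ in ball z r, (Real.log (r / dist z ζ) + |Real.log r|) ∂μ := by
        refine setIntegral_mono_on (h.integrableOn_log_norm_ball z hr).abs
          ((h.integrableOn_log_div z hr).add (integrableOn_const
          (h.measure_ball_lt_top z r).ne)) measurableSet_ball fun ζ hζ => abs_log_le hr hζ
    _ = ∫ ζ in ball z r, Real.log (r / dist z ζ) ∂μ + |Real.log r| * μ.real (ball z r) := by
        rw [integral_add (h.integrableOn_log_div z hr) (integrableOn_const
          (h.measure_ball_lt_top z r).ne), setIntegral_const, smul_eq_mul, mul_comm |Real.log r|]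
    _ ≤ _ := by rw [add_mul]; gcongr; exact h.setIntegral_log_div_le z hr

theorem integrableOn_log_norm (h : DoublingWith μ K) (z : ℂ) {s : Set ℂ}
    (hs : Bornology.IsBounded s) : IntegrableOn (fun ζ => Real.log ‖z - ζ‖) s μ := by
  obtain ⟨r, hr⟩ := hs.subset_ball z
  exact (h.integrableOn_log_norm_ball z (r := max r 1) (by positivity)).mono_set
    (hr.trans (ball_subset_ball (le_max_left _ _)))

end DoublingWith

theorem DoublingWith.ae_ne {μ : Measure ℂ} {K : ℕ} (h : DoublingWith μ K) (z : ℂ) :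
    ∀ᵐ ζ ∂μ, ζ ≠ z := by
  simpa using measure_eq_zero_iff_ae_notMem.1 (h.measure_singleton z)

theorem doublingWith_volume : DoublingWith (volume : Measure ℂ) 2 := by
  refine ⟨inferInstance, ?_, fun z r hr => le_of_eq ?_⟩
  · intro h0
    have := measure_ball_pos (volume : Measure ℂ) 0 one_pos
    rw [h0] at this; simp at this
  · rw [Complex.volume_ball, Complex.volume_ball, ENNReal.ofReal_mul (by norm_num)]
    rw [mul_pow, ← mul_assoc]; norm_num

/-- A continuous function of compact support vanishes off some disc. -/
theorem exists_ball_support {A : ℂ → ℝ} (hAc : HasCompactSupport A) :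
    ∃ R > 0, ∀ ζ ∉ ball (0 : ℂ) R, A ζ = 0 := by
  obtain ⟨R, hR⟩ := hAc.isCompact.isBounded.subset_ball 0
  refine ⟨max R 1, by positivity, fun ζ hζ => ?_⟩
  by_contra hc
  exact hζ (ball_subset_ball (le_max_left _ _) (hR (subset_tsupport _ hc)))

theorem setIntegral_eq_integral_of_support {μ : Measure ℂ} {f : ℂ → ℝ} {s : Set ℂ}
    (hf : ∀ ζ ∉ s, f ζ = 0) : ∫ ζ in s, f ζ ∂μ = ∫ ζ, f ζ ∂μ :=
  setIntegral_eq_integral_of_forall_compl_eq_zero hf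

/-- The logarithmic potential of the measure `A μ`. -/
def logPotential (μ : Measure ℂ) (A : ℂ → ℝ) (z : ℂ) : ℝ := ∫ ζ, A ζ * Real.log ‖z - ζ‖ ∂μ

section Potential

variable {μ : Measure ℂ} {K : ℕ} {A : ℂ → ℝ}

theorem DoublingWith.integrable_mul_log (h : DoublingWith μ K) (hA : Continuous A)
    (hAc : HasCompactSupport A) (z : ℂ) : Integrable (fun ζ => A ζ * Real.log ‖z - ζ‖) μ := by
  obtain ⟨b, hb⟩ := hAc.exists_bound_of_continuous hA
  obtain ⟨R, hR, hAR⟩ := exists_ball_support hAc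
  have h1 : IntegrableOn (fun ζ => A ζ * Real.log ‖z - ζ‖) (ball 0 R) μ :=
    (h.integrableOn_log_norm z isBounded_ball).bdd_mul hA.aestronglyMeasurable
      (Eventually.of_forall hb)
  rwa [integrableOn_iff_integrable_of_support_subset] at h1
  intro ζ hζ
  by_contra hc
  exact hζ (by simp [hAR ζ hc])

theorem DoublingWith.continuous_logPotential (h : DoublingWith μ K) (hA : Continuous A)
    (hAc : HasCompactSupport A) : Continuous (logPotential μ A) := by
  have := h.locallyFinite
  obtain ⟨b, hb⟩ := hAc.exists_bound_of_continuous hA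
  have hb0 : 0 ≤ b := (norm_nonneg _).trans (hb 0)
  -- truncated potentials are continuous and converge locally uniformly
  set P : ℝ → ℂ → ℝ := fun s z => ∫ ζ, A ζ * Real.log (max ‖z - ζ‖ s) ∂μ
  have hPc : ∀ s > 0, Continuous (P s) := by
    intro s hs
    have hc : Continuous (Function.uncurry fun z ζ : ℂ => A ζ * Real.log (max ‖z - ζ‖ s)) := by
      refine (hA.comp continuous_snd).mul (Continuous.log (by fun_prop) fun p => ?_)
      exact (hs.trans_le (le_max_right _ _)).ne'
    have := continuous_parametric_integral_of_continuous (μ := μ) hc hAc.isCompact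
    refine this.congr fun z => setIntegral_eq_integral_of_support fun ζ hζ => ?_
    rw [image_eq_zero_of_notMem_tsupport hζ, zero_mul]
  have hPi : ∀ s > 0, ∀ z, Integrable (fun ζ => A ζ * Real.log (max ‖z - ζ‖ s)) μ := by
    intro s hs z
    refine Continuous.integrable_of_hasCompactSupport ?_ hAc.mul_right
    refine hA.mul (Continuous.log (by fun_prop) fun ζ => ?_)
    exact (hs.trans_le (le_max_right _ _)).ne'
  have hdiff : ∀ s > 0, ∀ z, |logPotential μ A z - P s z| ≤
      b * (logConst K * μ.real (ball z s)) := by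
    intro s hs z
    simp only [logPotential, P]
    rw [← integral_sub (h.integrable_mul_log hA hAc z) (hPi s hs z)]
    refine (abs_integral_le_integral_abs).trans ?_
    rw [← setIntegral_eq_integral_of_support (s := ball z s)]
    · calc _ ≤ ∫ ζ in ball z s, b * Real.log (s / dist z ζ) ∂μ := by
            refine setIntegral_mono_on_ae ((h.integrable_mul_log hA hAc z).sub
              (hPi s hs z)).abs.integrableOn ((h.integrableOn_log_div z hs).const_mul b)
              measurableSet_ball ?_
            filter_upwards [h.ae_ne z] with ζ hne hζ
            have h0 := DoublingWith.log_div_dist_nonneg hζ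
            have hζ' : ‖z - ζ‖ < s := by rwa [mem_ball, dist_comm, dist_eq_norm] at hζ
            rw [max_eq_right hζ'.le, ← mul_sub, abs_mul]
            have hd : 0 < dist z ζ := dist_pos.2 hne.symm
            refine mul_le_mul (hb ζ) (le_of_eq ?_) (abs_nonneg _) hb0
            rw [abs_sub_comm, ← dist_eq_norm, ← Real.log_div hs.ne' hd.ne', abs_of_nonneg h0]
        _ ≤ _ := by
            rw [integral_const_mul]; gcongr; exact h.setIntegral_log_div_le z hs
    · intro ζ hζ
      rw [mem_ball, dist_comm, dist_eq_norm, not_lt] at hζ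
      rw [max_eq_left hζ, sub_self, abs_zero]
  rw [continuous_iff_continuousAt]
  intro z
  refine continuousAt_of_locally_uniform_approx_of_continuousAt fun u hu => ?_
  obtain ⟨e, he, heu⟩ := Metric.mem_uniformity_dist.1 hu
  have hlim : Tendsto (fun j : ℕ => b * (logConst K * (reverseRatio K ^ j *
      μ.real (ball z 2)))) atTop (𝓝 0) := by
    have := (tendsto_pow_atTop_nhds_zero_of_lt_one (reverseRatio_nonneg K)
      (reverseRatio_lt_one K)).mul_const (μ.real (ball z 2))
    simpa using (this.const_mul (logConst K)).const_mul b
  obtain ⟨j, hj⟩ := (hlim.eventually (gt_mem_nhds he)).exists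
  refine ⟨ball z 1, ball_mem_nhds z one_pos, P (1 / 4 ^ j), (hPc _ (by positivity)).continuousAt,
    fun y hy => heu ?_⟩
  rw [Real.dist_eq]
  refine (hdiff _ (by positivity) y).trans_lt (lt_of_le_of_lt ?_ hj)
  have h1 := h.real_ball_shrink y one_pos j
  have h2 : μ.real (ball y 1) ≤ μ.real (ball z 2) :=
    h.real_mono (ball_subset_ball' (by rw [mem_ball] at hy; linarith))
  have h3 := logConst_nonneg K
  have h4 := reverseRatio_nonneg K
  gcongr
  exact h1.trans (by gcongr)

/-- Fubini's theorem for the logarithmic kernel. -/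
theorem DoublingWith.integral_logPotential_mul (h : DoublingWith μ K) (hA : Continuous A)
    (hAc : HasCompactSupport A) {L : ℂ → ℝ} (hL : Continuous L) (hLc : HasCompactSupport L) :
    ∫ w, logPotential μ A w * L w =
      ∫ ζ, A ζ * (∫ w, Real.log ‖w - ζ‖ * L w) ∂μ := by
  have := h.locallyFinite
  obtain ⟨b, hb⟩ := hAc.exists_bound_of_continuous hA
  have hb0 : 0 ≤ b := (norm_nonneg _).trans (hb 0)
  obtain ⟨R, hR, hAR⟩ := exists_ball_support hAc
  obtain ⟨R', hR', hLR⟩ := exists_ball_support hLc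
  have hm : Measurable (Function.uncurry fun w ζ : ℂ => A ζ * Real.log ‖w - ζ‖ * L w) :=
    ((hA.measurable.comp measurable_snd).mul (by fun_prop)).mul
      (hL.measurable.comp measurable_fst)
  set C := b * ((logConst K + |Real.log (R + R')|) * μ.real (ball 0 (R + R' + R')))
  have hint : ∀ w, Integrable (fun ζ => A ζ * Real.log ‖w - ζ‖ * L w) μ := fun w =>
    (h.integrable_mul_log hA hAc w).mul_const _
  have hbound : ∀ w, ∫ ζ, ‖A ζ * Real.log ‖w - ζ‖ * L w‖ ∂μ ≤ C * |L w| := by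
    intro w
    by_cases hw : w ∈ ball 0 R'
    swap
    · simp [hLR w hw]
    rw [mem_ball, dist_zero_right] at hw
    have hsub : ball (0 : ℂ) R ⊆ ball w (R + R') := ball_subset_ball' (by
      rw [dist_zero_left]; linarith)
    simp_rw [norm_mul, integral_mul_const, Real.norm_eq_abs]
    gcongr
    rw [← setIntegral_eq_integral_of_support (s := ball w (R + R'))]
    · calc _ ≤ ∫ ζ in ball w (R + R'), b * |Real.log ‖w - ζ‖| ∂μ := by
            refine setIntegral_mono_on ?_ ((h.integrableOn_log_norm_ball w
              (by positivity)).abs.const_mul b) measurableSet_ball fun ζ _ => ?_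
            · simpa only [abs_mul] using (h.integrable_mul_log hA hAc w).abs.integrableOn
            · gcongr; exact hb ζ
        _ ≤ _ := by
            rw [integral_const_mul]
            refine mul_le_mul_of_nonneg_left ((h.setIntegral_abs_log_le w (by positivity)).trans ?_)
              hb0
            have := logConst_nonneg K
            refine mul_le_mul_of_nonneg_left (h.real_mono (ball_subset_ball' ?_)) (by positivity)
            rw [dist_zero_right]; linarith
    · intro ζ hζ
      rw [hAR ζ fun hc => hζ (hsub hc), abs_zero, zero_mul]
  have hprod : Integrable (Function.uncurry fun w ζ : ℂ => A ζ * Real.log ‖w - ζ‖ * L w)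
      (volume.prod μ) := by
    rw [integrable_prod_iff hm.aestronglyMeasurable]
    refine ⟨Eventually.of_forall hint, ?_⟩
    refine Integrable.mono' (g := fun w => C * |L w|)
      ((hL.integrable_of_hasCompactSupport hLc).abs.const_mul C)
      hm.aestronglyMeasurable.norm.integral_prod_right' (Eventually.of_forall fun w => ?_)
    rw [Real.norm_of_nonneg (integral_nonneg fun ζ => norm_nonneg _)]
    exact hbound w
  have := integral_integral_swap hprod
  simp_rw [integral_mul_const] at this
  simp only [logPotential]
  rw [this]
  simp_rw [mul_assoc, integral_const_mul]

end Potential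

/-! ### Riesz decomposition -/

theorem IsSubharmonic.measurable {φ : ℂ → ℝ} (hφ : IsSubharmonic φ) : Measurable φ :=
  hφ.upperSemicontinuous.measurable

theorem IsSubharmonic.exists_forall_le {φ : ℂ → ℝ} (hφ : IsSubharmonic φ) (z : ℂ) (R : ℝ) :
    ∃ m, ∀ w ∈ closedBall z R, φ w ≤ m := by
  rcases (closedBall z R).eq_empty_or_nonempty with he | hne
  · exact ⟨0, by simp [he]⟩
  · obtain ⟨a, -, ha⟩ := UpperSemicontinuousOn.exists_isMaxOn hne
      (isCompact_closedBall z R) (hφ.upperSemicontinuous.upperSemicontinuousOn _)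
    exact ⟨φ a, fun w hw => ha hw⟩

theorem circleIntegrable_integrableOn_Ioo {f : ℂ → ℝ} {z : ℂ} {r : ℝ}
    (hf : CircleIntegrable f z r) :
    IntegrableOn (fun θ => f (circleMap z r θ)) (Ioo (-Real.pi) Real.pi) := by
  have hp : Function.Periodic (fun θ => f (circleMap z r θ)) (2 * Real.pi) :=
    (periodic_circleMap z r).comp f
  have h1 : IntervalIntegrable (fun θ => f (circleMap z r θ)) volume 0 (0 + 2 * Real.pi) := by
    rw [zero_add]; exact hf
  have h2 := hp.intervalIntegrable (by positivity) h1 (-Real.pi) Real.pi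
  rw [intervalIntegrable_iff_integrableOn_Ioo_of_le (by linarith [Real.pi_pos])] at h2
  exact h2

/-- A finite-valued subharmonic function is locally integrable: by the mean value inequality its
integral over a disc is bounded below. -/
theorem IsSubharmonic.integrableOn_ball {φ : ℂ → ℝ} (hφ : IsSubharmonic φ) (z : ℂ) (R : ℝ) :
    IntegrableOn φ (ball z R) := by
  obtain ⟨m, hm⟩ := hφ.exists_forall_le z R
  have hmeas : Measurable fun w => m - φ w := measurable_const.sub hφ.measurable
  have h1 : IntegrableOn (fun w => m - φ w) (ball z R) := by
    refine ⟨hmeas.aestronglyMeasurable, ?_⟩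
    rw [hasFiniteIntegral_iff_ofReal ((ae_restrict_iff' measurableSet_ball).2
      (Eventually.of_forall fun w hw => sub_nonneg.2 (hm w (ball_subset_closedBall hw)))),
      ← lintegral_indicator measurableSet_ball,
      lintegral_eq_polar (hmeas.ennreal_ofReal.indicator measurableSet_ball) z]
    have h2 : ∀ r ∈ Ioi (0 : ℝ), ENNReal.ofReal r * ∫⁻ θ in Ioo (-Real.pi) Real.pi,
        (ball z R).indicator (fun w => ENNReal.ofReal (m - φ w)) (circleMap z r θ) ≤
        (Ioo 0 R).indicator (fun _ => ENNReal.ofReal R *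
          ENNReal.ofReal (2 * Real.pi * (m - φ z))) r := by
      intro r (hr : 0 < r)
      by_cases hrR : r < R
      · rw [indicator_of_mem (show r ∈ Ioo 0 R from ⟨hr, hrR⟩)]
        have hmem : ∀ θ, circleMap z r θ ∈ ball z R := fun θ => by
          rw [mem_ball, dist_eq_norm, circleMap_sub_center, norm_circleMap_zero, abs_of_pos hr]
          exact hrR
        simp_rw [indicator_of_mem (hmem _)]
        have hci := hφ.circleIntegrable z r hr
        have hi : IntegrableOn (fun θ => m - φ (circleMap z r θ)) (Ioo (-Real.pi) Real.pi) :=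
          (integrableOn_const (by simp)).sub (circleIntegrable_integrableOn_Ioo hci)
        rw [← ofReal_integral_eq_lintegral_ofReal hi (Eventually.of_forall fun θ =>
          sub_nonneg.2 (hm _ (ball_subset_closedBall (hmem θ))))]
        gcongr
        have hcst : IntegrableOn (fun _ : ℝ => m) (Ioo (-Real.pi) Real.pi) :=
          integrableOn_const (by simp)
        rw [integral_sub hcst (circleIntegrable_integrableOn_Ioo hci),
          ← circleAverage_eq_integral_Ioo, setIntegral_const, smul_eq_mul, Real.volume_real_Ioo,
          max_eq_left (by linarith [Real.pi_pos])]
        have := hφ.le_circleAverage z r hr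
        nlinarith [Real.pi_pos]
      · rw [indicator_of_notMem (fun h => hrR h.2)]
        have hmem : ∀ θ, circleMap z r θ ∉ ball z R := fun θ => by
          rw [mem_ball, dist_eq_norm, circleMap_sub_center, norm_circleMap_zero, abs_of_pos hr]
          exact hrR
        simp [indicator_of_notMem (hmem _)]
    refine (setLIntegral_mono' measurableSet_Ioi h2).trans_lt ?_
    refine (setLIntegral_le_lintegral _ _).trans_lt ?_
    rw [lintegral_indicator_const measurableSet_Ioo, Real.volume_Ioo]
    exact ENNReal.mul_lt_top (ENNReal.mul_lt_top ENNReal.ofReal_lt_top ENNReal.ofReal_lt_top)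
      ENNReal.ofReal_lt_top
  have h3 := (integrableOn_const (C := m) (measure_ball_lt_top (x := z) (r := R)).ne).sub h1
  refine h3.congr (Eventually.of_forall fun w => ?_)
  simp

/-- A smooth profile equal to `1` on `(-∞, 1]` and to `0` on `[2, ∞)`. -/
def cutoffProfile (x : ℝ) : ℝ := Real.smoothTransition (2 - x)

theorem contDiff_cutoffProfile : ContDiff ℝ ∞ cutoffProfile :=
  Real.smoothTransition.contDiff.comp (contDiff_const.sub contDiff_id)

theorem cutoffProfile_of_le {x : ℝ} (hx : x ≤ 1) : cutoffProfile x = 1 :=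
  Real.smoothTransition.one_of_one_le (by linarith)

theorem cutoffProfile_of_ge {x : ℝ} (hx : 2 ≤ x) : cutoffProfile x = 0 :=
  Real.smoothTransition.zero_of_nonpos (by linarith)

/-- The radial mollifier at scale `s`, as a function of the squared distance `x`: the derivative of
the cutoff, so that `mollifier s (|w|²)` has mass `π`. -/
def mollifier (s x : ℝ) : ℝ := -deriv cutoffProfile (x / s ^ 2) / s ^ 2

theorem contDiff_deriv_cutoffProfile : ContDiff ℝ ∞ (deriv cutoffProfile) :=
  (contDiff_infty_iff_deriv.1 contDiff_cutoffProfile).2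

theorem contDiff_mollifier (s : ℝ) : ContDiff ℝ ∞ (mollifier s) :=
  ((contDiff_deriv_cutoffProfile.comp (contDiff_id.div_const _)).neg).div_const _

theorem mollifier_nonneg (s x : ℝ) : 0 ≤ mollifier s x := by
  have hanti : Antitone cutoffProfile := fun a b hab =>
    Real.smoothTransition.monotone (by linarith)
  have := hanti.deriv_nonpos (x := x / s ^ 2)
  exact div_nonneg (by linarith) (by positivity)

theorem mollifier_eq_zero {s : ℝ} (hs : 0 < s) {x : ℝ} (hx : (2 * s) ^ 2 ≤ x) :
    mollifier s x = 0 := by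
  rw [mollifier, deriv_eq_zero_of_forall_ge contDiff_cutoffProfile
    (fun y hy => cutoffProfile_of_ge hy), neg_zero, zero_div]
  rw [ge_iff_le, le_div_iff₀ (by positivity)]; nlinarith [sq_nonneg s]

theorem hasDerivAt_cutoffProfile_scaled (s x : ℝ) :
    HasDerivAt (fun x => cutoffProfile (x / s ^ 2)) (-mollifier s x) x := by
  have h1 : HasDerivAt cutoffProfile (deriv cutoffProfile (x / s ^ 2)) (x / s ^ 2) :=
    (contDiff_cutoffProfile.differentiable (by simp) _).hasDerivAt
  refine (h1.comp x ((hasDerivAt_id x).div_const (s ^ 2))).congr_deriv ?_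
  simp only [mollifier]; ring

theorem integrable_mollifier {s : ℝ} (hs : 0 < s) (z : ℂ) :
    Integrable fun w : ℂ => mollifier s (‖w - z‖ ^ 2) :=
  (contDiff_radial (n := ⊤) (contDiff_mollifier s) z).continuous.integrable_of_hasCompactSupport
    (hasCompactSupport_radial (S := 2 * s) (fun _ hx => mollifier_eq_zero hs hx) z)

theorem integral_mollifier {s : ℝ} (hs : 0 < s) (z : ℂ) :
    ∫ w : ℂ, mollifier s (‖w - z‖ ^ 2) = Real.pi := by
  have h1 := integral_mul_radial (g := fun _ => 1) measurable_const
    (contDiff_mollifier s).continuous.measurable z (by simpa using integrable_mollifier hs z)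
  simp only [one_mul, Real.circleAverage_const, mul_one] at h1
  have hd : ∀ r, HasDerivAt (fun r : ℝ => -Real.pi * cutoffProfile (r ^ 2 / s ^ 2))
      (2 * Real.pi * (r * mollifier s (r ^ 2))) r := by
    intro r
    have h2 : HasDerivAt (fun r : ℝ => r ^ 2) (2 * r) r := by simpa using hasDerivAt_pow 2 r
    refine (((hasDerivAt_cutoffProfile_scaled s (r ^ 2)).comp r h2).const_mul
      (-Real.pi)).congr_deriv ?_
    ring
  have hc := (contDiff_mollifier s).continuous
  rw [h1, setIntegral_eq_of_subset_of_forall_sdiff_eq_zero (s := Ioc 0 (2 * s))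
    measurableSet_Ioi Ioc_subset_Ioi_self, ← intervalIntegral.integral_of_le (by positivity),
    intervalIntegral.integral_eq_sub_of_hasDerivAt (fun r _ => hd r)
      (Continuous.intervalIntegrable (by fun_prop) _ _)]
  · rw [cutoffProfile_of_ge, cutoffProfile_of_le]
    · ring
    · simp
    · rw [le_div_iff₀ (by positivity)]; nlinarith [sq_nonneg s]
  · intro r hr
    have : 2 * s < r := by
      by_contra hcon
      exact hr.2 ⟨hr.1, not_lt.1 hcon⟩
    rw [mollifier_eq_zero hs (by gcongr)]; ring

/-- The difference of two mollifiers is the Laplacian of a radial function of compact support. -/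
theorem exists_radialLaplacian_eq_sub {s t S : ℝ} (hs : 0 < s) (ht : 0 < t) (hsS : 2 * s ≤ S)
    (htS : 2 * t ≤ S) : ∃ k : ℝ → ℝ, ContDiff ℝ ∞ k ∧ (∀ x ≥ S ^ 2, k x = 0) ∧
      ∀ x, radialLaplacian k x = mollifier s x - mollifier t x := by
  set q : ℝ → ℝ := fun x => (cutoffProfile (x / t ^ 2) - cutoffProfile (x / s ^ 2)) / 4
  have hq : ContDiff ℝ ∞ q := by
    have := contDiff_cutoffProfile
    exact ((this.comp (contDiff_id.div_const _)).sub
      (this.comp (contDiff_id.div_const _))).div_const _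
  have hqd : ∀ x, HasDerivAt q ((mollifier s x - mollifier t x) / 4) x := by
    intro x
    refine (((hasDerivAt_cutoffProfile_scaled t x).sub
      (hasDerivAt_cutoffProfile_scaled s x)).div_const 4).congr_deriv ?_
    ring
  have hq0 : ∀ x, x ≤ min s t ^ 2 → q x = 0 := by
    intro x hx
    have h1 : min s t ^ 2 ≤ s ^ 2 := by gcongr; exact min_le_left _ _
    have h2 : min s t ^ 2 ≤ t ^ 2 := by gcongr; exact min_le_right _ _
    simp only [q]
    rw [cutoffProfile_of_le, cutoffProfile_of_le, sub_self, zero_div]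
    · rw [div_le_one (by positivity)]; linarith
    · rw [div_le_one (by positivity)]; linarith
  have hqS : ∀ x ≥ S ^ 2, q x = 0 := by
    intro x hx
    simp only [q]
    rw [cutoffProfile_of_ge, cutoffProfile_of_ge, sub_self, zero_div]
    · rw [le_div_iff₀ (by positivity)]; nlinarith
    · rw [le_div_iff₀ (by positivity)]; nlinarith
  have hmin : 0 < min s t := lt_min hs ht
  set p : ℝ → ℝ := fun x => q x / x
  have hp : ContDiff ℝ ∞ p := by
    rw [contDiff_iff_contDiffAt]
    intro x
    rcases lt_or_ge x (min s t ^ 2) with hx | hx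
    · have : p =ᶠ[𝓝 x] fun _ => 0 := by
        filter_upwards [Iio_mem_nhds hx] with y hy
        simp only [p]
        rw [hq0 y (le_of_lt hy), zero_div]
      exact contDiffAt_const.congr_of_eventuallyEq this
    · exact hq.contDiffAt.div contDiffAt_id (by have : 0 < x := by nlinarith
                                                exact this.ne')
  refine ⟨fun x => ∫ y in (S ^ 2)..x, p y, ?_, ?_, ?_⟩
  · rw [contDiff_infty_iff_deriv]
    refine ⟨fun x => (hp.continuous.integral_hasStrictDerivAt _ x).hasDerivAt.differentiableAt, ?_⟩
    have : deriv (fun x => ∫ y in (S ^ 2)..x, p y) = p :=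
      funext fun x => hp.continuous.deriv_integral _ _ _
    rwa [this]
  · intro x hx
    simp only
    rw [intervalIntegral.integral_congr (g := fun _ => 0), intervalIntegral.integral_zero]
    intro y hy
    rw [uIcc_of_le hx] at hy
    simp only [p]
    rw [hqS y hy.1, zero_div]
  · intro x
    have : deriv (fun x => ∫ y in (S ^ 2)..x, p y) = p :=
      funext fun x => hp.continuous.deriv_integral _ _ _
    rw [radialLaplacian, this]
    have h1 : ∀ x, x * p x = q x := by
      intro x
      rcases eq_or_ne x 0 with rfl | hx
      · rw [zero_mul, hq0 0 (by positivity)]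
      · simp only [p]; field_simp
    have h2 : HasDerivAt (fun x => x * p x) (1 * p x + x * deriv p x) x :=
      (hasDerivAt_id x).mul (hp.differentiable (by simp) x).hasDerivAt
    have h3 : HasDerivAt q (1 * p x + x * deriv p x) x := by
      convert h2 using 1; ext y; exact (h1 y).symm
    have := h3.unique (hqd x)
    linarith

section Riesz

variable {φ : ℂ → ℝ} {μ : Measure ℂ} {K : ℕ} {A : ℂ → ℝ} {R : ℝ}

/-- Minus the potential of its Laplacian, cut off outside a disc, a subharmonic function is orthogonal
to the Laplacians of the radial test functions supported in the disc. -/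
theorem integral_sub_logPotential_mul_radialLaplacian (hφ : IsSubharmonic φ)
    (h : DoublingWith μ K) (hL : IsDistributionalLaplacian φ μ) (hA : Continuous A)
    (hAc : HasCompactSupport A) (hAR : ∀ z ∈ ball (0 : ℂ) R, A z = 1 / (2 * Real.pi)) {z : ℂ}
    {S : ℝ} (hS : 0 < S) (hzS : ‖z‖ + S ≤ R) {k : ℝ → ℝ} (hk : ContDiff ℝ ∞ k)
    (hkS : ∀ x ≥ S ^ 2, k x = 0) :
    ∫ w, (φ w - logPotential μ A w) * radialLaplacian k (‖w - z‖ ^ 2) = 0 := by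
  set L : ℂ → ℝ := fun w => radialLaplacian k (‖w - z‖ ^ 2)
  have hLcont : Continuous L := (continuous_radialLaplacian hk).comp (by fun_prop)
  have hLc : HasCompactSupport L :=
    hasCompactSupport_radial (radialLaplacian_eq_zero hk hkS) z
  have hkc := hasCompactSupport_radial hkS z
  obtain ⟨R', hR', hLR⟩ := exists_ball_support hLc
  have hφi : Integrable fun w => φ w * L w := by
    have h1 : IntegrableOn (fun w => φ w * L w) (ball 0 R') := by
      obtain ⟨b, hb⟩ := hLc.exists_bound_of_continuous hLcont
      exact (hφ.integrableOn_ball 0 R').mul_bdd (c := b) hLcont.aestronglyMeasurable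
        (Eventually.of_forall hb)
    rwa [integrableOn_iff_integrable_of_support_subset] at h1
    intro ζ hζ
    by_contra hc
    exact hζ (by simp [hLR ζ hc])
  have hPi : Integrable fun w => logPotential μ A w * L w :=
    ((h.continuous_logPotential hA hAc).mul hLcont).integrable_of_hasCompactSupport hLc.mul_left
  have e1 : ∫ w, φ w * L w = ∫ ζ, k (‖ζ - z‖ ^ 2) ∂μ := by
    rw [← hL.2 _ (contDiff_radial (n := ⊤) hk z) hkc]
    exact integral_congr_ae (Eventually.of_forall fun w => by simp only [L, laplacian_radial hk z w])
  have e2 : ∫ w, logPotential μ A w * L w = ∫ ζ, k (‖ζ - z‖ ^ 2) ∂μ := by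
    rw [h.integral_logPotential_mul hA hAc hLcont hLc]
    refine integral_congr_ae ?_
    filter_upwards [h.ae_ne z] with ζ hζ
    rw [integral_log_mul_radialLaplacian hk hS hkS hζ.symm]
    · by_cases hζR : ζ ∈ ball (0 : ℂ) R
      · rw [hAR ζ hζR, norm_sub_rev]
        field_simp
      · have : S ≤ ‖ζ - z‖ := by
          rw [mem_ball, dist_zero_right, not_lt] at hζR
          have := norm_sub_norm_le ζ z
          linarith
        rw [norm_sub_rev z ζ, hkS _ (by rw [ge_iff_le]; gcongr)]
        ring
    · have := doublingWith_volume.integrable_mul_log hLcont hLc ζ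
      refine this.congr (Eventually.of_forall fun w => ?_)
      simp only [L]
      rw [norm_sub_rev ζ w, mul_comm]
  simp_rw [sub_mul]
  rw [integral_sub hφi hPi, e1, e2, sub_self]

/-- `φ - p` agrees with its mollifications, `p` the potential of the Laplacian of `φ`. -/
theorem integral_sub_logPotential_mul_mollifier (hφ : IsSubharmonic φ)
    (h : DoublingWith μ K) (hL : IsDistributionalLaplacian φ μ) (hA : Continuous A)
    (hAc : HasCompactSupport A) (hAR : ∀ z ∈ ball (0 : ℂ) R, A z = 1 / (2 * Real.pi)) {z : ℂ}
    {s : ℝ} (hs : 0 < s) (hzs : ‖z‖ + 2 * s ≤ R) :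
    ∫ w, (φ w - logPotential μ A w) * mollifier s (‖w - z‖ ^ 2) =
      Real.pi * (φ z - logPotential μ A z) := by
  have hPc := h.continuous_logPotential hA hAc
  have hmc : ∀ t, Continuous fun w : ℂ => mollifier t (‖w - z‖ ^ 2) := fun t =>
    (contDiff_radial (n := ⊤) (contDiff_mollifier t) z).continuous
  have hmz : ∀ t > 0, ∀ w ∉ ball z (2 * t), mollifier t (‖w - z‖ ^ 2) = 0 := by
    intro t ht w hw
    rw [mem_ball, dist_eq_norm, not_lt] at hw
    exact mollifier_eq_zero ht (by gcongr)
  have hmcs : ∀ t > 0, HasCompactSupport fun w : ℂ => mollifier t (‖w - z‖ ^ 2) := fun t ht =>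
    hasCompactSupport_radial (S := 2 * t) (fun _ hx => mollifier_eq_zero ht hx) z
  have hφi : ∀ t > 0, Integrable fun w => φ w * mollifier t (‖w - z‖ ^ 2) := by
    intro t ht
    have h1 : IntegrableOn (fun w => φ w * mollifier t (‖w - z‖ ^ 2)) (ball z (2 * t)) := by
      obtain ⟨b, hb⟩ := (hmcs t ht).exists_bound_of_continuous (hmc t)
      exact (hφ.integrableOn_ball z (2 * t)).mul_bdd (c := b) (hmc t).aestronglyMeasurable
        (Eventually.of_forall hb)
    rwa [integrableOn_iff_integrable_of_support_subset] at h1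
    intro ζ hζ
    by_contra hc
    exact hζ (by simp [hmz t ht ζ hc])
  have hPi : ∀ t > 0, Integrable fun w => logPotential μ A w * mollifier t (‖w - z‖ ^ 2) :=
    fun t ht => (hPc.mul (hmc t)).integrable_of_hasCompactSupport (hmcs t ht).mul_left
  -- the mollification does not depend on the scale
  have hconst : ∀ t > 0, t ≤ s → ∫ w, (φ w - logPotential μ A w) * mollifier s (‖w - z‖ ^ 2) =
      ∫ w, (φ w - logPotential μ A w) * mollifier t (‖w - z‖ ^ 2) := by
    intro t ht hts
    obtain ⟨k, hk, hkS, hkL⟩ := exists_radialLaplacian_eq_sub (S := 2 * s) hs ht le_rfl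
      (by linarith)
    have := integral_sub_logPotential_mul_radialLaplacian hφ h hL hA hAc hAR (z := z)
      (by positivity) hzs hk hkS
    simp_rw [hkL, mul_sub] at this
    have hi : ∀ t > 0, Integrable fun w =>
        (φ w - logPotential μ A w) * mollifier t (‖w - z‖ ^ 2) := by
      intro t ht
      simp_rw [sub_mul]
      exact (hφi t ht).sub (hPi t ht)
    rw [integral_sub (hi s hs) (hi t ht)] at this
    linarith
  set V := ∫ w, (φ w - logPotential μ A w) * mollifier s (‖w - z‖ ^ 2)
  -- at a small scale, semicontinuity bounds the mollification of `φ` from above and the mean value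
  -- inequality bounds it from below
  have key : ∀ e > 0, |V - Real.pi * (φ z - logPotential μ A z)| ≤ 2 * Real.pi * e := by
    intro e he
    have h1 := hPc.continuousAt.eventually (Metric.ball_mem_nhds (logPotential μ A z) he)
    have h2 := hφ.upperSemicontinuous z (φ z + e) (by linarith)
    obtain ⟨d, hd, hdb⟩ := Metric.eventually_nhds_iff_ball.1 (h1.and h2)
    set t := min s (d / 2)
    have ht : 0 < t := lt_min hs (by positivity)
    have htd : 2 * t ≤ d := by have := min_le_right s (d / 2); linarith
    have hm0 := mollifier_nonneg t
    have hmi := integrable_mollifier ht z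
    have hmI := integral_mollifier ht z
    rw [hconst t ht (min_le_left _ _)]
    simp_rw [sub_mul]
    rw [integral_sub (hφi t ht) (hPi t ht)]
    have b1 : |(∫ w, logPotential μ A w * mollifier t (‖w - z‖ ^ 2)) -
        Real.pi * logPotential μ A z| ≤ Real.pi * e := by
      have : (∫ w, logPotential μ A w * mollifier t (‖w - z‖ ^ 2)) -
            Real.pi * logPotential μ A z =
          ∫ w, (logPotential μ A w - logPotential μ A z) * mollifier t (‖w - z‖ ^ 2) := by
        simp_rw [sub_mul]
        rw [integral_sub (hPi t ht) (hmi.const_mul _), integral_const_mul, hmI]; ring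
      rw [this]
      refine abs_integral_le_integral_abs.trans ?_
      rw [← hmI, mul_comm, ← integral_const_mul]
      refine integral_mono_of_nonneg (Eventually.of_forall fun w => abs_nonneg _)
        (hmi.const_mul e) (Eventually.of_forall fun w => ?_)
      simp only [abs_mul, abs_of_nonneg (hm0 _)]
      by_cases hw : w ∈ ball z (2 * t)
      · have := (hdb w (ball_subset_ball htd hw)).1
        rw [Real.dist_eq] at this
        exact mul_le_mul_of_nonneg_right this.le (hm0 _)
      · rw [hmz t ht w hw]; simp
    have b2 : ∫ w, φ w * mollifier t (‖w - z‖ ^ 2) ≤ Real.pi * (φ z + e) := by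
      rw [← hmI, mul_comm, ← integral_const_mul]
      refine integral_mono (hφi t ht) (hmi.const_mul _) fun w => ?_
      by_cases hw : w ∈ ball z (2 * t)
      · exact mul_le_mul_of_nonneg_right (hdb w (ball_subset_ball htd hw)).2.le (hm0 _)
      · simp [hmz t ht w hw]
    have b3 : Real.pi * φ z ≤ ∫ w, φ w * mollifier t (‖w - z‖ ^ 2) := by
      have hmm := (contDiff_mollifier t).continuous.measurable
      have hi : Integrable fun w => (φ w - φ z) * mollifier t (‖w - z‖ ^ 2) := by
        simp_rw [sub_mul]
        exact (hφi t ht).sub (hmi.const_mul _)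
      have h3 : 0 ≤ ∫ w, (φ w - φ z) * mollifier t (‖w - z‖ ^ 2) := by
        rw [integral_mul_radial (hφ.measurable.sub_const _) hmm z hi]
        refine setIntegral_nonneg measurableSet_Ioi fun r (hr : 0 < r) => ?_
        have h4 : Real.circleAverage (fun w => φ w - φ z) z r = Real.circleAverage φ z r - φ z := by
          rw [Real.circleAverage_fun_sub (hφ.circleIntegrable z r hr) (circleIntegrable_const _ _ _),
            Real.circleAverage_const]
        have h5 := hφ.le_circleAverage z r hr
        have h6 := hm0 (r ^ 2)
        rw [h4]
        exact mul_nonneg (by positivity) (by linarith)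
      simp_rw [sub_mul] at h3
      rw [integral_sub (hφi t ht) (hmi.const_mul _), integral_const_mul, hmI] at h3
      linarith
    rw [abs_le] at b1 ⊢
    constructor <;> nlinarith [b1.1, b1.2]
  have hz : |V - Real.pi * (φ z - logPotential μ A z)| ≤ 0 := by
    refine le_of_forall_pos_le_add fun e he => ?_
    have := key (e / (2 * Real.pi)) (by positivity)
    rw [mul_div_cancel₀ _ (by positivity)] at this
    linarith
  have := abs_nonpos_iff.1 hz
  linarith

theorem fderiv_convolution_apply {f g : ℂ → ℝ} (hf : LocallyIntegrable f) (hg : ContDiff ℝ ∞ g)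
    (hgc : HasCompactSupport g) (e : ℂ) :
    (fun x => fderiv ℝ (fun x => ∫ t, f t * g (x - t)) x e) =
      fun x => ∫ t, f t * fderiv ℝ g (x - t) e := by
  ext x
  have h1 := (hgc.hasFDerivAt_convolution_right (ContinuousLinearMap.mul ℝ ℝ) hf
    (contDiff_infty.1 hg 1) x).fderiv
  have h2 : (convolution f g (ContinuousLinearMap.mul ℝ ℝ) volume) =
      fun x => ∫ t, f t * g (x - t) := by
    ext x; simp [convolution]
  rw [h2] at h1
  rw [h1, convolution, ContinuousLinearMap.integral_apply]
  · simp
  · exact (HasCompactSupport.convolutionExists_right _ (hgc.fderiv ℝ) hf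
      (hg.continuous_fderiv (by simp)) x)

/-- Riesz decomposition: minus the logarithmic potential of its Laplacian, cut off outside a disc,
a subharmonic function is harmonic on that disc. -/
theorem harmonicOnNhd_sub_logPotential (hφ : IsSubharmonic φ)
    (h : DoublingWith μ K) (hL : IsDistributionalLaplacian φ μ) (hA : Continuous A)
    (hAc : HasCompactSupport A) (hAR : ∀ z ∈ ball (0 : ℂ) R, A z = 1 / (2 * Real.pi)) :
    InnerProductSpace.HarmonicOnNhd (fun z => φ z - logPotential μ A z) (ball 0 R) := by
  intro z hz
  rw [mem_ball, dist_zero_right] at hz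
  set s := (R - ‖z‖) / 4
  have hs : 0 < s := by simp only [s]; linarith
  set f : ℂ → ℝ := (ball (0 : ℂ) R).indicator fun w => φ w - logPotential μ A w
  set g : ℂ → ℝ := fun w => Real.pi⁻¹ * mollifier s (‖w - 0‖ ^ 2)
  have hPc := h.continuous_logPotential hA hAc
  have hf : LocallyIntegrable f := by
    refine Integrable.locallyIntegrable ?_
    rw [integrable_indicator_iff measurableSet_ball]
    refine (hφ.integrableOn_ball 0 R).sub ?_
    exact (hPc.continuousOn.integrableOn_compact (isCompact_closedBall 0 R)).mono_set
      ball_subset_closedBall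
  have hg : ContDiff ℝ ∞ g :=
    contDiff_const.mul (contDiff_radial (n := ⊤) (contDiff_mollifier s) 0)
  have hgc : HasCompactSupport g :=
    (hasCompactSupport_radial (S := 2 * s) (fun _ hx => mollifier_eq_zero hs hx) 0).mul_left
  set F : ℂ → ℝ := fun x => ∫ t, f t * g (x - t)
  have hF2 : F = convolution f g (ContinuousLinearMap.mul ℝ ℝ) volume := by
    ext x; simp [convolution, F]
  have hFc : ContDiff ℝ 2 F := by
    rw [hF2]
    exact contDiff_infty.1 (hgc.contDiff_convolution_right (n := ⊤) _ hf hg) 2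
  have hball : ∀ x ∈ ball z s, ‖x‖ + 2 * s ≤ R := by
    intro x hx
    rw [mem_ball, dist_eq_norm] at hx
    have := norm_sub_norm_le x z
    simp only [s] at *; linarith
  -- inside the disc the cut-off `f` may be replaced by the function itself
  have hloc : ∀ x ∈ ball z s, ∀ q : ℝ → ℝ, (∀ y ≥ (2 * s) ^ 2, q y = 0) → ∀ t,
      f t * q (‖t - x‖ ^ 2) = (φ t - logPotential μ A t) * q (‖t - x‖ ^ 2) := by
    intro x hx q hq t
    by_cases ht : t ∈ ball (0 : ℂ) R
    · simp only [f]; rw [indicator_of_mem ht]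
    · rw [mem_ball, dist_zero_right, not_lt] at ht
      have := norm_sub_norm_le t x
      have := hball x hx
      rw [hq _ (by rw [ge_iff_le]; gcongr; linarith), mul_zero, mul_zero]
  have hFeq : ∀ x ∈ ball z s, φ x - logPotential μ A x = F x := by
    intro x hx
    have h1 := integral_sub_logPotential_mul_mollifier hφ h hL hA hAc hAR hs (hball x hx)
    have h2 : F x = Real.pi⁻¹ * ∫ t, f t * mollifier s (‖t - x‖ ^ 2) := by
      rw [← integral_const_mul]
      refine integral_congr_ae (Eventually.of_forall fun t => ?_)
      simp only [g, sub_zero]; rw [norm_sub_rev]; ring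
    rw [h2, integral_congr_ae (Eventually.of_forall (hloc x hx _ fun y hy =>
      mollifier_eq_zero hs hy)), h1]
    field_simp
  have hlapF : ∀ x ∈ ball z s, Laplacian.laplacian F x = 0 := by
    intro x hx
    have hgd : ∀ e : ℂ, ContDiff ℝ ∞ fun y => fderiv ℝ g y e := fun e =>
      (hg.fderiv_right (m := ∞) (by simp)).clm_apply contDiff_const
    have hgdc : ∀ e : ℂ, HasCompactSupport fun y => fderiv ℝ g y e := fun e =>
      (hgc.fderiv_apply ℝ e)
    have hd2 : ∀ e : ℂ, fderiv ℝ (fun w => fderiv ℝ F w e) x e =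
        ∫ t, f t * fderiv ℝ (fun y => fderiv ℝ g y e) (x - t) e := by
      intro e
      simp only [F]
      rw [fderiv_convolution_apply hf hg hgc e]
      exact congrFun (fderiv_convolution_apply hf (hgd e) (hgdc e) e) x
    have hint : ∀ e : ℂ,
        Integrable fun t => f t * fderiv ℝ (fun y => fderiv ℝ g y e) (x - t) e := by
      intro e
      have := HasCompactSupport.convolutionExists_right (ContinuousLinearMap.mul ℝ ℝ)
        ((hgdc e).fderiv_apply ℝ e) hf
        (((hgd e).fderiv_right (m := ∞) (by simp)).clm_apply contDiff_const).continuous x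
      simpa [ConvolutionExistsAt] using this
    rw [laplacian_eq_fderiv hFc, hd2, hd2, ← integral_add (hint _) (hint _)]
    simp_rw [← mul_add]
    set k : ℝ → ℝ := fun y => Real.pi⁻¹ * mollifier s y
    have hk : ContDiff ℝ ∞ k := contDiff_const.mul (contDiff_mollifier s)
    have hkS : ∀ y ≥ (2 * s) ^ 2, k y = 0 := fun y hy => by
      simp only [k]; rw [mollifier_eq_zero hs hy, mul_zero]
    have hlg : ∀ y, fderiv ℝ (fun y => fderiv ℝ g y 1) y 1 +
        fderiv ℝ (fun y => fderiv ℝ g y Complex.I) y Complex.I = radialLaplacian k (‖y‖ ^ 2) := by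
      intro y
      have h3 := laplacian_radial hk 0 y
      rw [sub_zero] at h3
      rw [← laplacian_eq_fderiv (contDiff_infty.1 hg 2)]
      exact h3
    simp_rw [hlg, norm_sub_rev x]
    rw [integral_congr_ae (Eventually.of_forall (hloc x hx _ (radialLaplacian_eq_zero hk hkS)))]
    exact integral_sub_logPotential_mul_radialLaplacian hφ h hL hA hAc hAR (by positivity)
      (hball x hx) hk hkS
  have hev : (fun z => φ z - logPotential μ A z) =ᶠ[𝓝 z] F := by
    filter_upwards [ball_mem_nhds z hs] with x hx using hFeq x hx
  rw [InnerProductSpace.harmonicAt_congr_nhds hev]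
  refine ⟨hFc.contDiffAt, ?_⟩
  filter_upwards [ball_mem_nhds z hs] with x hx using hlapF x hx

/-- On a disc a subharmonic function is a logarithmic potential plus the real part of a holomorphic
function. -/
theorem exists_holomorphic_re_eq_sub_logPotential (hφ : IsSubharmonic φ)
    (h : DoublingWith μ K) (hL : IsDistributionalLaplacian φ μ) (hA : Continuous A)
    (hAc : HasCompactSupport A) (hAR : ∀ z ∈ ball (0 : ℂ) R, A z = 1 / (2 * Real.pi)) :
    ∃ H : ℂ → ℂ, DifferentiableOn ℂ H (ball 0 R) ∧
      ∀ z ∈ ball (0 : ℂ) R, (H z).re = φ z - logPotential μ A z := by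
  obtain ⟨H, hH, hre⟩ := InnerProductSpace.HarmonicOnNhd.exists_analyticOnNhd_ball_re_eq
    (harmonicOnNhd_sub_logPotential hφ h hL hA hAc hAR)
  exact ⟨H, hH.differentiableOn, fun z hz => hre hz⟩

end Riesz

/-! ### From density on discs to local domination -/

/-- A separated set meets boundedly many discs `D(a, A rad(a))` centred on it, at any point. -/
theorem exists_overlap_le (K : ℕ) (A : ℝ) {δ : ℝ} (hδ : 0 < δ) : ∃ N : ℕ, 0 < N ∧
    ∀ μ : Measure ℂ, DoublingWith μ K → ∀ M : ℝ, 0 < M → ∀ S : Set ℂ,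
      SeparatedBy (rad μ M) δ S → ∀ z : ℂ, {a ∈ S | dist z a ≤ A * rad μ M a}.Finite ∧
        {a ∈ S | dist z a ≤ A * rad μ M a}.ncard ≤ N := by
  obtain ⟨C, hC1, hC⟩ := exists_rad_le_mul K A
  obtain ⟨N, hN⟩ := exists_ncard_le K (|A| * C) hδ
  refine ⟨N + 1, N.succ_pos, fun μ h M hM S hS z => ?_⟩
  obtain ⟨h1, h2⟩ := hN μ h M hM S hS z
  have hsub : {a ∈ S | dist z a ≤ A * rad μ M a} ⊆
      {a ∈ S | dist a z ≤ |A| * C * rad μ M z} := by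
    rintro a ⟨ha, haz⟩
    refine ⟨ha, ?_⟩
    have h3 := hC μ h M hM a z haz
    have h4 := h.rad_pos hM a
    rw [dist_comm]
    calc dist z a ≤ A * rad μ M a := haz
      _ ≤ |A| * rad μ M a := by gcongr; exact le_abs_self A
      _ ≤ |A| * (C * rad μ M z) := by gcongr
      _ = _ := by ring
  exact ⟨h1.subset hsub, (ncard_le_ncard hsub h1).trans (h2.trans N.le_succ)⟩

/-- The function equal to `1` on `D(w, r)`, to `0` off `D(w, 2r)`, and affine in the distance to `w`
in between. -/
def bump (w : ℂ) (r : ℝ) (ζ : ℂ) : ℝ := max 0 (min 1 (2 - dist ζ w / r))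

theorem bump_nonneg (w : ℂ) (r : ℝ) (ζ : ℂ) : 0 ≤ bump w r ζ := le_max_left _ _

theorem bump_le_one (w : ℂ) (r : ℝ) (ζ : ℂ) : bump w r ζ ≤ 1 :=
  max_le zero_le_one (min_le_left _ _)

theorem bump_eq_one {w : ℂ} {r : ℝ} (hr : 0 < r) {ζ : ℂ} (h : dist ζ w ≤ r) : bump w r ζ = 1 := by
  have : dist ζ w / r ≤ 1 := (div_le_one hr).2 h
  rw [bump, min_eq_left (by linarith), max_eq_right zero_le_one]

theorem bump_eq_zero {w : ℂ} {r : ℝ} (hr : 0 < r) {ζ : ℂ} (h : 2 * r ≤ dist ζ w) :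
    bump w r ζ = 0 := by
  have : 2 ≤ dist ζ w / r := (le_div_iff₀ hr).2 h
  rw [bump, max_eq_left ((min_le_right _ _).trans (by linarith))]

theorem continuous_bump (w : ℂ) (r : ℝ) : Continuous (bump w r) := by
  unfold bump; fun_prop

theorem abs_bump_sub_le (w : ℂ) {r : ℝ} (hr : 0 < r) (ζ ξ : ℂ) :
    |bump w r ζ - bump w r ξ| ≤ dist ζ ξ / r := by
  unfold bump
  refine (abs_max_sub_max_le_max _ _ _ _).trans ?_
  rw [sub_self, abs_zero, max_eq_right (abs_nonneg _)]
  refine (abs_min_sub_min_le_max _ _ _ _).trans ?_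
  rw [sub_self, abs_zero, max_eq_right (abs_nonneg _), sub_sub_sub_cancel_left, ← sub_div, abs_div,
    abs_of_pos hr]
  gcongr
  rw [abs_sub_comm]
  exact abs_dist_sub_le ζ ξ w

theorem hasCompactSupport_bump (w : ℂ) {r : ℝ} (hr : 0 < r) : HasCompactSupport (bump w r) := by
  refine HasCompactSupport.intro (isCompact_closedBall w (2 * r)) fun ζ hζ => bump_eq_zero hr ?_
  rw [mem_closedBall, not_le] at hζ; exact hζ.le

theorem integrable_bump (ν : Measure ℂ) [IsLocallyFiniteMeasure ν] (w : ℂ) {r : ℝ} (hr : 0 < r) :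
    Integrable (bump w r) ν :=
  (continuous_bump w r).integrable_of_hasCompactSupport (hasCompactSupport_bump w hr)

/-- The measure `n` is at most `κ μ` on discs of `μ`-mass at least `M₀`. -/
def DominatedOnDiscs (μ n : Measure ℂ) (κ M₀ : ℝ) : Prop :=
  ∀ (z : ℂ) (s : ℝ), M₀ ≤ μ.real (ball z s) → n (ball z s) ≤ ENNReal.ofReal κ * μ (ball z s)

/-- Domination on discs passes to bump functions, whose level sets are discs. -/
theorem DominatedOnDiscs.integral_bump_le {μ n : Measure ℂ} {K : ℕ} (h : DoublingWith μ K)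
    [IsLocallyFiniteMeasure n] {κ M₀ : ℝ} (hκ : 0 ≤ κ)
    (hn : DominatedOnDiscs μ n κ M₀) {w : ℂ} {r : ℝ} (hr : 0 < r) (hM : M₀ ≤ μ.real (ball w r)) :
    ∫ ζ, bump w r ζ ∂n ≤ κ * ∫ ζ, bump w r ζ ∂μ := by
  have := h.locallyFinite
  have hlev : ∀ t ∈ Ioi (0 : ℝ), n {ζ | t < bump w r ζ} ≤
      ENNReal.ofReal κ * μ {ζ | t < bump w r ζ} := by
    intro t (ht : 0 < t)
    rcases lt_or_ge t 1 with ht1 | ht1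
    · have : {ζ | t < bump w r ζ} = ball w ((2 - t) * r) := by
        ext ζ
        rw [mem_ofPred_eq, bump, lt_max_iff, lt_min_iff, mem_ball, ← div_lt_iff₀ hr]
        constructor
        · rintro (h1 | h1)
          · linarith
          · linarith [h1.2]
        · intro h1; exact Or.inr ⟨ht1, by linarith⟩
      rw [this]
      exact hn _ _ (hM.trans (h.real_mono (ball_subset_ball (by nlinarith))))
    · have : {ζ | t < bump w r ζ} = ∅ := by
        ext ζ
        simp only [mem_ofPred_eq, mem_empty_iff_false, iff_false, not_lt]
        exact (bump_le_one w r ζ).trans ht1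
      rw [this]; simp
  have hm := (continuous_bump w r).measurable
  have h0 : ∀ ν : Measure ℂ, 0 ≤ᵐ[ν] bump w r := fun ν =>
    Eventually.of_forall fun ζ => bump_nonneg w r ζ
  rw [integral_eq_lintegral_of_nonneg_ae (h0 n) (continuous_bump w r).aestronglyMeasurable,
    integral_eq_lintegral_of_nonneg_ae (h0 μ) (continuous_bump w r).aestronglyMeasurable]
  have hfin : ∫⁻ ζ, ENNReal.ofReal (bump w r ζ) ∂μ ≠ ⊤ := by
    have := (integrable_bump μ w hr).2
    rw [hasFiniteIntegral_iff_ofReal (h0 μ)] at this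
    exact this.ne
  rw [← ENNReal.toReal_ofReal hκ, ← ENNReal.toReal_mul]
  refine ENNReal.toReal_mono (ENNReal.mul_ne_top ENNReal.ofReal_ne_top hfin) ?_
  rw [lintegral_eq_lintegral_meas_lt n (h0 n) hm.aemeasurable,
    lintegral_eq_lintegral_meas_lt μ (h0 μ) hm.aemeasurable,
    ← lintegral_const_mul' _ _ ENNReal.ofReal_ne_top]
  exact setLIntegral_mono' measurableSet_Ioi hlev

/-- The operator `u ↦ ∑ u(w) b(w) h_w` over a separated set, `h_w` the bump of radius `ρ(w)` about
`w`. -/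
def bumpSum {W : Set ℂ} {ρ : ℂ → ℝ} (hfin : ∀ ζ, {w ∈ W | dist ζ w ≤ 2 * ρ w}.Finite) (b : ℂ → ℝ) :
    (ℂ → ℝ) →ₗ[ℝ] (ℂ → ℝ) where
  toFun u ζ := ∑ w ∈ (hfin ζ).toFinset, u w * (b w * bump w (ρ w) ζ)
  map_add' u v := by ext ζ; simp [add_mul, Finset.sum_add_distrib]
  map_smul' c u := by ext ζ; simp [Finset.mul_sum, mul_assoc]

theorem bumpSum_apply {W : Set ℂ} {ρ : ℂ → ℝ} (hρ : ∀ w, 0 < ρ w)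
    (hfin : ∀ ζ, {w ∈ W | dist ζ w ≤ 2 * ρ w}.Finite) (b u : ℂ → ℝ) (ζ : ℂ) {F : Finset ℂ}
    (hFW : (F : Set ℂ) ⊆ W) (hF : ∀ w ∈ W, dist ζ w ≤ 2 * ρ w → u w ≠ 0 → w ∈ F) :
    bumpSum hfin b u ζ = ∑ w ∈ F, u w * (b w * bump w (ρ w) ζ) := by
  classical
  have h1 : bumpSum hfin b u ζ =
      ∑ w ∈ (hfin ζ).toFinset ∪ F, u w * (b w * bump w (ρ w) ζ) := by
    refine Finset.sum_subset Finset.subset_union_left fun w hw hw2 => ?_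
    have hwF : w ∈ F := (Finset.mem_union.1 hw).resolve_left hw2
    rw [bump_eq_zero (hρ w), mul_zero, mul_zero]
    by_contra hc
    exact hw2 ((hfin ζ).mem_toFinset.2 ⟨hFW hwF, (not_le.1 hc).le⟩)
  rw [h1]
  refine (Finset.sum_subset Finset.subset_union_right fun w hw hw2 => ?_).symm
  have hwF := (hfin ζ).mem_toFinset.1 ((Finset.mem_union.1 hw).resolve_right hw2)
  have : u w = 0 := by
    by_contra hc
    exact hw2 (hF w hwF.1 hwF.2 hc)
  rw [this, zero_mul]

theorem continuous_bumpSum {μ : Measure ℂ} {K : ℕ} (h : DoublingWith μ K) {M : ℝ} (hM : 0 < M)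
    {δ : ℝ} (hδ : 0 < δ) {W : Set ℂ} (hW : SeparatedBy (rad μ M) δ W)
    (hfin : ∀ ζ, {w ∈ W | dist ζ w ≤ 2 * rad μ M w}.Finite) (b u : ℂ → ℝ) :
    Continuous (bumpSum hfin b u) := by
  obtain ⟨C, hC1, hC⟩ := exists_rad_le_mul K 2
  rw [continuous_iff_continuousAt]
  intro ζ₀
  have hpos := h.rad_pos hM ζ₀
  set F := (hW.finite_inter h hM hδ
    (isBounded_closedBall (x := ζ₀) (r := (1 + 4 * C) * rad μ M ζ₀))).toFinset
  have hev : bumpSum hfin b u =ᶠ[𝓝 ζ₀] fun ζ => ∑ w ∈ F, u w * (b w * bump w (rad μ M w) ζ) := by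
    filter_upwards [ball_mem_nhds ζ₀ hpos] with ζ hζ
    refine bumpSum_apply (h.rad_pos hM) hfin b u ζ ?_ fun w hw hζw _ => ?_
    · intro w hw
      have := (Set.Finite.mem_toFinset _).1 (Finset.mem_coe.1 hw)
      exact this.1
    · refine (Set.Finite.mem_toFinset _).2 ⟨hw, ?_⟩
      rw [mem_ball] at hζ
      rw [mem_closedBall]
      have h1 := hC μ h M hM w ζ hζw
      have h2 := h.rad_le_add_dist hM ζ ζ₀
      have h3 := dist_triangle w ζ ζ₀
      rw [dist_comm w ζ] at h3
      nlinarith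
  refine ContinuousAt.congr ?_ hev.symm
  refine Continuous.continuousAt (continuous_finsetSum _ fun w _ => ?_)
  exact continuous_const.mul (continuous_const.mul (continuous_bump _ _))

/-- A positive linear operator `T` that spreads functions over discs on which `n ≤ κ μ`: one has
`∫ T u dn ≤ κ ∫ T u dμ` for `u ≥ 0`, while `T` is local at the scale of mass `M₁` and `T 1` is
within `δ` of `1`. -/
structure IsSweep (μ n : Measure ℂ) (κ M₁ δ : ℝ) (T : (ℂ → ℝ) →ₗ[ℝ] (ℂ → ℝ)) : Prop where
  nonneg : ∀ u : ℂ → ℝ, (∀ x, 0 ≤ u x) → ∀ ζ, 0 ≤ T u ζ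
  eq_zero : ∀ (u : ℂ → ℝ) (ζ : ℂ), (∀ x, dist x ζ ≤ rad μ M₁ ζ → u x = 0) → T u ζ = 0
  continuous : ∀ u, Continuous (T u)
  integral_le : ∀ u : ℂ → ℝ, (∀ x, 0 ≤ u x) → (∃ R, ∀ x ∉ ball (0 : ℂ) R, u x = 0) →
    ∫ ζ, T u ζ ∂n ≤ κ * ∫ ζ, T u ζ ∂μ
  one_le : ∀ ζ, T 1 ζ ≤ 1
  le_one : ∀ ζ, 1 - δ ≤ T 1 ζ

/-- Oscillation at most `η` on the discs `D(w, 2 ρ(w))`. -/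
def OscLe (ρ : ℂ → ℝ) (η : ℝ) (f : ℂ → ℝ) : Prop :=
  ∀ w ζ, dist ζ w ≤ 2 * ρ w → |f ζ - f w| ≤ η

/-- Far from the origin, discs of a given mass do not reach a given disc about the origin. -/
theorem DoublingWith.exists_add_rad_le {μ : Measure ℂ} {K : ℕ} (h : DoublingWith μ K) {M₁ : ℝ}
    (hM₁ : 0 < M₁) (R : ℝ) : ∃ s, ∀ ζ, s ≤ ‖ζ‖ → R + rad μ M₁ ζ ≤ ‖ζ‖ := by
  -- a disc about `ζ` reaching the fixed disc has large mass when `ζ` is far away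
  obtain ⟨j, hj⟩ := h.exists_le_real_ball 0 (r := 1) one_pos (2 ^ (K * 3) * M₁)
  set t := (4 : ℝ) ^ j * 1
  have ht : 0 < t := by positivity
  refine ⟨max (8 * t) (2 * R), fun ζ hζ => ?_⟩
  have h1 : 8 * t ≤ ‖ζ‖ := (le_max_left _ _).trans hζ
  have h2 : 2 * R ≤ ‖ζ‖ := (le_max_right _ _).trans hζ
  have hz : 0 < ‖ζ‖ := by linarith
  have h3 : rad μ M₁ ζ ≤ ‖ζ‖ / 2 := by
    refine h.rad_le hM₁ ?_
    have h4 : μ.real (ball 0 t) ≤ 2 ^ (K * 3) * μ.real (ball ζ (‖ζ‖ / 2)) :=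
      h.real_ball_le_of_le (by positivity) 3 (by rw [dist_zero_left]; linarith)
    exact le_of_mul_le_mul_left (hj.trans h4) (by positivity)
  linarith

theorem IsSweep.hasCompactSupport {μ n : Measure ℂ} {K : ℕ} (h : DoublingWith μ K) {κ M₁ δ : ℝ}
    (hM₁ : 0 < M₁) {T : (ℂ → ℝ) →ₗ[ℝ] (ℂ → ℝ)} (hT : IsSweep μ n κ M₁ δ T) {u : ℂ → ℝ}
    (hu : ∃ R, ∀ x ∉ ball (0 : ℂ) R, u x = 0) : HasCompactSupport (T u) := by
  obtain ⟨R, hR⟩ := hu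
  obtain ⟨s, hs⟩ := h.exists_add_rad_le hM₁ R
  refine HasCompactSupport.intro (isCompact_closedBall 0 s) fun ζ hζ => ?_
  rw [mem_closedBall, dist_zero_right, not_le] at hζ
  refine hT.eq_zero u ζ fun x hx => hR x fun hx2 => ?_
  rw [mem_ball, dist_zero_right] at hx2
  have h1 := hs ζ hζ.le
  have h2 := norm_sub_norm_le ζ x
  rw [dist_comm, dist_eq_norm] at hx
  linarith

theorem IsSweep.zero (μ n : Measure ℂ) (κ M₁ : ℝ) : IsSweep μ n κ M₁ 1 0 := by
  refine ⟨fun u _ ζ => le_rfl, fun u ζ _ => rfl, fun u => continuous_zero, fun u _ _ => ?_,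
    fun ζ => zero_le_one, fun ζ => by simp⟩
  simp

theorem IsScaleNet.exists_dist_le_half {μ : Measure ℂ} {K : ℕ} (h : DoublingWith μ K) {M : ℝ}
    (hM : 0 < M) {W : Set ℂ} (hW : IsScaleNet (rad μ M) W) (z : ℂ) :
    ∃ w ∈ W, dist z w ≤ rad μ M w / 2 := by
  obtain ⟨w, hw, hd⟩ := hW.exists_near z
  exact ⟨w, hw, by have := h.rad_le_add_dist hM z w; linarith⟩

/-- One step of the covering argument: a layer of bumps, much larger than the scale `rad μ M` and
much smaller than the scale on which `T₀ 1` oscillates, absorbs a fixed proportion of `1 - T₀ 1`. -/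
theorem exists_isSweep_step {μ n : Measure ℂ} {K : ℕ} (h : DoublingWith μ K)
    [IsLocallyFiniteMeasure n] {κ M₀ : ℝ} (hκ : 0 ≤ κ) (hM₀ : 0 < M₀)
    (hn : DominatedOnDiscs μ n κ M₀) {N : ℕ} (hN0 : 0 < N)
    (hN : ∀ M : ℝ, 0 < M → ∀ S : Set ℂ, SeparatedBy (rad μ M) (1 / 4) S → ∀ z : ℂ,
      {a ∈ S | dist z a ≤ 2 * rad μ M a}.Finite ∧ {a ∈ S | dist z a ≤ 2 * rad μ M a}.ncard ≤ N)
    {δ : ℝ} (hδ : 0 < δ)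
    (ih : ∀ M ≥ M₀, ∀ η > 0, ∃ M₁ > 0, ∃ T, IsSweep μ n κ M₁ δ T ∧ OscLe (rad μ M) η (T 1)) :
    ∀ M ≥ M₀, ∀ η > 0, ∃ M₁ > 0, ∃ T, IsSweep μ n κ M₁ ((1 - 1 / (2 * N)) * δ) T ∧
      OscLe (rad μ M) η (T 1) := by
  classical
  have := h.locallyFinite
  intro M hM η hη
  have hMpos : 0 < M := hM₀.trans_le hM
  have hNR : (1 : ℝ) ≤ N := by exact_mod_cast hN0
  obtain ⟨i, hi⟩ := pow_unbounded_of_one_lt (max 4 (48 / η)) (one_lt_two (α := ℝ))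
  have hi4 : (4 : ℝ) < 2 ^ i := (le_max_left _ _).trans_lt hi
  have hiη : 48 / η < 2 ^ i := (le_max_right _ _).trans_lt hi
  -- the bumps of the new layer have the scale of mass `M'`, large enough for them to oscillate little
  -- on the scale of mass `M`
  set M' := 2 ^ (K * i) * M + 1
  have hM'pos : 0 < M' := by positivity
  have hMM' : M ≤ M' := by
    have : (1 : ℝ) ≤ 2 ^ (K * i) := one_le_pow₀ (by norm_num)
    simp only [M']; nlinarith
  have hscale : ∀ z, 2 ^ i * rad μ M z ≤ rad μ M' z :=
    h.pow_mul_rad_le hMpos i (by simp only [M']; linarith)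
  set ρ := rad μ M'
  have hρ : ∀ w, 0 < ρ w := h.rad_pos hM'pos
  obtain ⟨M₁, hM₁, T₀, hT₀, hosc⟩ := ih M' (hM.trans hMM') (min (δ / 4) (η / 2)) (by positivity)
  obtain ⟨W, hW⟩ := h.exists_isScaleNet hM'pos
  have hNW := hN M' hM'pos W hW.separated
  have hfin : ∀ ζ, {w ∈ W | dist ζ w ≤ 2 * ρ w}.Finite := fun ζ => (hNW ζ).1
  have hcard : ∀ ζ, ((hfin ζ).toFinset.card : ℝ) ≤ N := fun ζ => by
    rw [← ncard_eq_toFinset_card _ (hfin ζ)]; exact_mod_cast (hNW ζ).2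
  -- at most `N` bumps overlap, so bumps of height `1 / N` times the gap do not overfill it; the term
  -- `δ / 4` absorbs the oscillation of `T₀ 1` on a bump
  set b : ℂ → ℝ := fun w => max 0 (1 - T₀ 1 w - δ / 4) / N
  have hb0 : ∀ w, 0 ≤ b w := fun w => div_nonneg (le_max_left _ _) (by positivity)
  have hT₀1 : ∀ ζ, 0 ≤ T₀ 1 ζ := fun ζ => hT₀.nonneg 1 (fun _ => zero_le_one) ζ
  have hb1 : ∀ w, b w ≤ 1 / N := fun w => by
    refine div_le_div_of_nonneg_right (max_le zero_le_one ?_) (by positivity)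
    linarith [hT₀1 w]
  set L := bumpSum hfin b
  have hL1 : ∀ ζ, L 1 ζ = ∑ w ∈ (hfin ζ).toFinset, b w * bump w (ρ w) ζ := fun ζ => by
    simp [L, bumpSum]
  have hosc' : ∀ w ζ, dist ζ w ≤ 2 * ρ w → |T₀ 1 ζ - T₀ 1 w| ≤ δ / 4 := fun w ζ hζ =>
    (hosc w ζ hζ).trans (min_le_left _ _)
  have hLle : ∀ ζ, L 1 ζ ≤ 1 - T₀ 1 ζ := by
    intro ζ
    have hu : 0 ≤ 1 - T₀ 1 ζ := by linarith [hT₀.one_le ζ]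
    rw [hL1]
    calc ∑ w ∈ (hfin ζ).toFinset, b w * bump w (ρ w) ζ
        ≤ ∑ w ∈ (hfin ζ).toFinset, (1 - T₀ 1 ζ) / N := by
          refine Finset.sum_le_sum fun w hw => ?_
          have hw' := ((hfin ζ).mem_toFinset.1 hw).2
          refine (mul_le_of_le_one_right (hb0 w) (bump_le_one _ _ _)).trans ?_
          refine div_le_div_of_nonneg_right (max_le hu ?_) (by positivity)
          have := (abs_le.1 (hosc' w ζ hw')).2
          linarith
      _ = (hfin ζ).toFinset.card * ((1 - T₀ 1 ζ) / N) := by rw [Finset.sum_const, nsmul_eq_mul]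
      _ ≤ N * ((1 - T₀ 1 ζ) / N) :=
          mul_le_mul_of_nonneg_right (hcard ζ) (div_nonneg hu (by positivity))
      _ = _ := by field_simp
  have hLge : ∀ ζ, (1 - T₀ 1 ζ - δ / 2) / N ≤ L 1 ζ := by
    intro ζ
    obtain ⟨w, hw, hd⟩ := hW.exists_dist_le_half h hM'pos ζ
    have hd' : dist ζ w ≤ rad μ M' w / 2 := hd
    have hmem : w ∈ (hfin ζ).toFinset :=
      (hfin ζ).mem_toFinset.2 ⟨hw, by have := hρ w; simp only [ρ] at *; linarith⟩
    rw [hL1]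
    refine le_trans ?_ (Finset.single_le_sum (f := fun w => b w * bump w (ρ w) ζ)
      (fun w _ => mul_nonneg (hb0 w) (bump_nonneg _ _ _)) hmem)
    rw [bump_eq_one (hρ w) (by have := hρ w; simp only [ρ] at *; linarith), mul_one]
    refine div_le_div_of_nonneg_right (le_trans ?_ (le_max_right _ _)) (by positivity)
    have := (abs_le.1 (hosc' w ζ (by have := hρ w; simp only [ρ] at *; linarith))).1
    linarith
  obtain ⟨C, hC1, hC⟩ := exists_rad_le_mul K 2
  obtain ⟨l, hl⟩ := pow_unbounded_of_one_lt (2 * C) (one_lt_two (α := ℝ))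
  -- the centre of a bump is within the radius of mass `M₂` of every point of its support
  set M₂ := max M₁ (2 ^ (K * l) * M' + 1)
  have hM₂ : 0 < M₂ := hM₁.trans_le (le_max_left _ _)
  have hsc2 : ∀ z, 2 ^ l * ρ z ≤ rad μ M₂ z := h.pow_mul_rad_le hM'pos l
    (lt_of_lt_of_le (by linarith) (le_max_right _ _))
  have hact : ∀ ζ w, dist ζ w ≤ 2 * ρ w → dist w ζ ≤ rad μ M₂ ζ := by
    intro ζ w hd
    have h1 := hC μ h M' hM'pos w ζ hd
    have h2 := hsc2 ζ
    have h3 := hρ ζ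
    rw [dist_comm]
    simp only [ρ] at *
    nlinarith
  refine ⟨M₂, hM₂, T₀ + L, ⟨?_, ?_, ?_, ?_, ?_, ?_⟩, ?_⟩
  · intro u hu ζ
    refine add_nonneg (hT₀.nonneg u hu ζ) ?_
    exact Finset.sum_nonneg fun w _ =>
      mul_nonneg (hu w) (mul_nonneg (hb0 w) (bump_nonneg _ _ _))
  · intro u ζ hu
    have h1 : T₀ u ζ = 0 := hT₀.eq_zero u ζ fun x hx =>
      hu x (hx.trans (h.rad_mono hM₁ (le_max_left _ _) ζ))
    have h2 : L u ζ = 0 := by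
      refine Finset.sum_eq_zero fun w hw => ?_
      rw [hu w (hact ζ w ((hfin ζ).mem_toFinset.1 hw).2), zero_mul]
    simp [h1, h2]
  · intro u
    exact (hT₀.continuous u).add (continuous_bumpSum h hM'pos (by norm_num) hW.separated hfin b u)
  · intro u hu hub
    obtain ⟨R, hR⟩ := hub
    set F := (hW.separated.finite_inter h hM'pos (by norm_num)
      (isBounded_ball (x := (0 : ℂ)) (r := R))).toFinset
    have hFW : ∀ w ∈ F, w ∈ W := fun w hw => ((Set.Finite.mem_toFinset _).1 hw).1
    have hLu : ∀ ζ, L u ζ = ∑ w ∈ F, u w * (b w * bump w (ρ w) ζ) := fun ζ =>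
      bumpSum_apply hρ hfin b u ζ hFW fun w hw _ huw => (Set.Finite.mem_toFinset _).2
        ⟨hw, by by_contra hc; exact huw (hR w hc)⟩
    have hc0 := hT₀.hasCompactSupport h hM₁ ⟨R, hR⟩
    have hi0 : ∀ ν : Measure ℂ, IsLocallyFiniteMeasure ν → Integrable (T₀ u) ν := fun ν _ =>
      (hT₀.continuous u).integrable_of_hasCompactSupport hc0
    have hib : ∀ ν : Measure ℂ, IsLocallyFiniteMeasure ν → ∀ w ∈ F,
        Integrable (fun ζ => u w * (b w * bump w (ρ w) ζ)) ν := fun ν _ w _ =>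
      ((integrable_bump ν w (hρ w)).const_mul _).const_mul _
    have hint : ∀ ν : Measure ℂ, IsLocallyFiniteMeasure ν → ∫ ζ, (T₀ + L) u ζ ∂ν =
        ∫ ζ, T₀ u ζ ∂ν + ∑ w ∈ F, u w * (b w * ∫ ζ, bump w (ρ w) ζ ∂ν) := by
      intro ν hν
      have h1 : ∀ ζ, (T₀ + L) u ζ = T₀ u ζ + ∑ w ∈ F, u w * (b w * bump w (ρ w) ζ) := fun ζ => by
        rw [← hLu ζ]; rfl
      simp_rw [h1]
      rw [integral_add (hi0 ν hν) (integrable_finsetSum _ (hib ν hν)),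
        integral_finsetSum _ (hib ν hν)]
      simp_rw [integral_const_mul]
    rw [hint n inferInstance, hint μ inferInstance, mul_add, Finset.mul_sum]
    refine add_le_add (hT₀.integral_le u hu ⟨R, hR⟩) (Finset.sum_le_sum fun w _ => ?_)
    have := hn.integral_bump_le h hκ (hρ w) (w := w)
      ((hM.trans hMM').trans (h.real_ball_rad hM'pos w).ge)
    calc _ ≤ u w * (b w * (κ * ∫ ζ, bump w (ρ w) ζ ∂μ)) := by
          have := hu w; have := hb0 w; gcongr
      _ = _ := by ring
  · intro ζ
    have := hLle ζ
    simp only [LinearMap.add_apply, Pi.add_apply]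
    linarith
  · intro ζ
    have h1 := hLge ζ
    have h2 := hT₀.le_one ζ
    have h3 := hT₀.one_le ζ
    simp only [LinearMap.add_apply, Pi.add_apply]
    set x := 1 - T₀ 1 ζ
    have hx : x ≤ δ := by simp only [x]; linarith
    have h4 : x - (x - δ / 2) / N ≤ (1 - 1 / (2 * N)) * δ := by
      have h5 : x - (x - δ / 2) / N = x * (1 - 1 / N) + δ / (2 * N) := by field_simp; ring
      have h6 : (1 : ℝ) / N ≤ 1 := by rw [div_le_one (by positivity)]; exact hNR
      have h7 : x * (1 - 1 / N) ≤ δ * (1 - 1 / N) :=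
        mul_le_mul_of_nonneg_right hx (by linarith)
      rw [h5]
      calc _ ≤ δ * (1 - 1 / N) + δ / (2 * N) := by linarith
        _ = _ := by field_simp; ring
    simp only [x] at h4
    linarith
  · intro w₀ ζ hζ
    have h0 : |T₀ 1 ζ - T₀ 1 w₀| ≤ η / 2 :=
      (hosc w₀ ζ (hζ.trans (by have := h.rad_mono hMpos hMM' w₀; linarith))).trans
        (min_le_right _ _)
    set F := (hfin ζ).toFinset ∪ (hfin w₀).toFinset
    have hFW : (F : Set ℂ) ⊆ W := by
      intro w hw
      rcases Finset.mem_union.1 (Finset.mem_coe.1 hw) with hw | hw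
      · exact ((Set.Finite.mem_toFinset _).1 hw).1
      · exact ((Set.Finite.mem_toFinset _).1 hw).1
    have e1 : L 1 ζ = ∑ w ∈ F, 1 * (b w * bump w (ρ w) ζ) :=
      bumpSum_apply hρ hfin b 1 ζ hFW fun w hw hd _ =>
        Finset.mem_union_left _ ((Set.Finite.mem_toFinset _).2 ⟨hw, hd⟩)
    have e2 : L 1 w₀ = ∑ w ∈ F, 1 * (b w * bump w (ρ w) w₀) :=
      bumpSum_apply hρ hfin b 1 w₀ hFW fun w hw hd _ =>
        Finset.mem_union_right _ ((Set.Finite.mem_toFinset _).2 ⟨hw, hd⟩)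
    have hs0 := hscale w₀
    have hcomp : ∀ w ∈ F, ρ w₀ ≤ 6 * ρ w := by
      intro w hw
      have hpw := hρ w
      have hp0 := hρ w₀
      have hr0 := h.rad_pos hMpos w₀
      rcases Finset.mem_union.1 hw with hw | hw
      · have hd := ((Set.Finite.mem_toFinset _).1 hw).2
        have a1 := h.rad_le_add_dist hM'pos w₀ ζ
        have a2 := h.rad_le_add_dist hM'pos ζ w
        rw [dist_comm] at a1
        simp only [ρ] at *
        nlinarith
      · have hd := ((Set.Finite.mem_toFinset _).1 hw).2
        have a2 := h.rad_le_add_dist hM'pos w₀ w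
        simp only [ρ] at *
        linarith
    have hLosc : |L 1 ζ - L 1 w₀| ≤ η / 2 := by
      rw [e1, e2, ← Finset.sum_sub_distrib]
      refine (Finset.abs_sum_le_sum_abs _ _).trans ?_
      calc ∑ w ∈ F, |1 * (b w * bump w (ρ w) ζ) - 1 * (b w * bump w (ρ w) w₀)|
          ≤ ∑ w ∈ F, (1 / N * (12 / 2 ^ i) : ℝ) := by
            refine Finset.sum_le_sum fun w hw => ?_
            rw [one_mul, one_mul, ← mul_sub, abs_mul, abs_of_nonneg (hb0 w)]
            refine mul_le_mul (hb1 w) ((abs_bump_sub_le w (hρ w) ζ w₀).trans ?_) (abs_nonneg _)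
              (by positivity)
            rw [div_le_div_iff₀ (hρ w) (by positivity)]
            have := hcomp w hw
            have hp : (0 : ℝ) < 2 ^ i := by positivity
            calc dist ζ w₀ * 2 ^ i ≤ 2 * rad μ M w₀ * 2 ^ i := by gcongr
              _ = 2 * (2 ^ i * rad μ M w₀) := by ring
              _ ≤ 12 * ρ w := by linarith
        _ = F.card * (1 / N * (12 / 2 ^ i)) := by rw [Finset.sum_const, nsmul_eq_mul]
        _ ≤ (N + N) * (1 / N * (12 / 2 ^ i)) := by
            gcongr
            refine le_trans ?_ (add_le_add (hcard ζ) (hcard w₀))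
            exact_mod_cast Finset.card_union_le _ _
        _ = 24 / 2 ^ i := by field_simp; norm_num
        _ ≤ η / 2 := by
            rw [div_lt_iff₀ hη] at hiη
            rw [div_le_div_iff₀ (by positivity) (by norm_num)]
            linarith
    simp only [LinearMap.add_apply, Pi.add_apply]
    calc _ = |(T₀ 1 ζ - T₀ 1 w₀) + (L 1 ζ - L 1 w₀)| := by congr 1; ring
      _ ≤ _ := (abs_add_le _ _).trans (by linarith)

/-- A covering argument over many scales: if `n ≤ κ μ` on all large discs, then a sweep exists with
`T 1` as close to `1` as desired. -/
theorem exists_isSweep {μ n : Measure ℂ} {K : ℕ} (h : DoublingWith μ K)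
    [IsLocallyFiniteMeasure n] {κ M₀ : ℝ} (hκ : 0 ≤ κ) (hM₀ : 0 < M₀)
    (hn : DominatedOnDiscs μ n κ M₀) {δ : ℝ} (hδ : 0 < δ) :
    ∃ M₁ > 0, ∃ T, IsSweep μ n κ M₁ δ T := by
  obtain ⟨N, hN0, hN⟩ := exists_overlap_le K 2 (δ := 1 / 4) (by norm_num)
  have hNR : (1 : ℝ) ≤ N := by exact_mod_cast hN0
  set q : ℝ := 1 - 1 / (2 * N)
  have hq0 : 0 < q := by
    have : (1 : ℝ) / (2 * N) < 1 := by rw [div_lt_one (by positivity)]; linarith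
    simp only [q]; linarith
  have hq1 : q < 1 := by
    have : (0 : ℝ) < 1 / (2 * N) := by positivity
    simp only [q]; linarith
  have key : ∀ j : ℕ, ∀ M ≥ M₀, ∀ η > 0, ∃ M₁ > 0, ∃ T, IsSweep μ n κ M₁ (q ^ j) T ∧
      OscLe (rad μ M) η (T 1) := by
    intro j
    induction j with
    | zero =>
      intro M _ η hη
      exact ⟨1, one_pos, 0, by simpa using IsSweep.zero μ n κ 1, fun w ζ _ => by simpa using hη.le⟩
    | succ j ih =>
      have := exists_isSweep_step h hκ hM₀ hn hN0 (hN μ h) (pow_pos hq0 j) ih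
      rwa [pow_succ']
  obtain ⟨j, hj⟩ := exists_pow_lt_of_lt_one hδ hq1
  obtain ⟨M₁, hM₁, T, hT, -⟩ := key j M₀ le_rfl 1 one_pos
  exact ⟨M₁, hM₁, T, hT.nonneg, hT.eq_zero, hT.continuous, hT.integral_le, hT.one_le,
    fun ζ => by linarith [hT.le_one ζ]⟩

/-! ### Partitions of unity adapted to a measure and a dominated measure -/

/-- A continuous partition of unity subordinate to the discs `D(w, 2 ρ(w))` about the points of a
scale net. -/
theorem IsScaleNet.exists_partition {μ : Measure ℂ} {K : ℕ} (h : DoublingWith μ K) {M : ℝ}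
    (hM : 0 < M) {N : ℕ} {W : Set ℂ} (hW : IsScaleNet (rad μ M) W)
    (hN : ∀ z : ℂ, {a ∈ W | dist z a ≤ 2 * rad μ M a}.Finite ∧
      {a ∈ W | dist z a ≤ 2 * rad μ M a}.ncard ≤ N) :
    ∃ u : ℂ → ℂ → ℝ, (∀ w, Continuous (u w)) ∧ (∀ w ζ, 0 ≤ u w ζ) ∧
      (∀ w ζ, u w ζ ≤ bump w (rad μ M w) ζ) ∧ (∀ w ζ, bump w (rad μ M w) ζ / N ≤ u w ζ) ∧
      ∀ (ζ : ℂ) (F : Finset ℂ), (F : Set ℂ) ⊆ W →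
        (∀ w ∈ W, dist ζ w ≤ 2 * rad μ M w → w ∈ F) → ∑ w ∈ F, u w ζ = 1 := by
  have hρ := h.rad_pos hM
  have hfin : ∀ ζ, {w ∈ W | dist ζ w ≤ 2 * rad μ M w}.Finite := fun ζ => (hN ζ).1
  set S := bumpSum hfin 1 1
  have hS : ∀ ζ, S ζ = ∑ w ∈ (hfin ζ).toFinset, bump w (rad μ M w) ζ := fun ζ => by
    simp [S, bumpSum]
  have hSc : Continuous S := continuous_bumpSum h hM (by norm_num) hW.separated hfin 1 1
  have hS1 : ∀ ζ, 1 ≤ S ζ := by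
    intro ζ
    obtain ⟨w, hw, hd⟩ := hW.exists_dist_le_half h hM ζ
    have hp := hρ w
    rw [hS]
    refine le_trans (bump_eq_one hp (by linarith)).ge
      (Finset.single_le_sum (f := fun w => bump w (rad μ M w) ζ) (fun w _ => bump_nonneg _ _ _)
        ((hfin ζ).mem_toFinset.2 ⟨hw, by linarith⟩))
  have hSN : ∀ ζ, S ζ ≤ N := by
    intro ζ
    rw [hS]
    refine (Finset.sum_le_card_nsmul _ _ 1 fun w _ => bump_le_one _ _ _).trans ?_
    rw [nsmul_eq_mul, mul_one, ← ncard_eq_toFinset_card _ (hfin ζ)]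
    exact_mod_cast (hN ζ).2
  refine ⟨fun w ζ => bump w (rad μ M w) ζ / S ζ, fun w => ?_, fun w ζ => ?_, fun w ζ => ?_,
    fun w ζ => ?_, fun ζ F hF hFm => ?_⟩
  · exact (continuous_bump _ _).div hSc fun ζ => by linarith [hS1 ζ]
  · exact div_nonneg (bump_nonneg _ _ _) (by linarith [hS1 ζ])
  · exact div_le_self (bump_nonneg _ _ _) (hS1 ζ)
  · have := hS1 ζ
    exact div_le_div_of_nonneg_left (bump_nonneg _ _ _) (by linarith) (hSN ζ)
  · have h1 : S ζ = ∑ w ∈ F, bump w (rad μ M w) ζ := by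
      have := bumpSum_apply hρ hfin 1 1 ζ hF fun w hw hd _ => hFm w hw hd
      simpa using this
    rw [← Finset.sum_div, ← h1, div_self (by linarith [hS1 ζ])]

/-- A partition of unity at a large scale, on each member of which `μ` dominates `n` with a definite
excess. -/
theorem exists_partition_mass_le (K : ℕ) {κ a : ℝ} (hκ : 0 ≤ κ) (hκa : κ < a) {N : ℕ} (hN0 : 0 < N)
    {μ n : Measure ℂ} (h : DoublingWith μ K) [IsLocallyFiniteMeasure n] {M₀ : ℝ} (hM₀ : 0 < M₀)
    (hn : DominatedOnDiscs μ n κ M₀) :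
    ∃ M₂ > 0, ∃ c > 0, ∀ M ≥ M₂, ∀ W : Set ℂ, IsScaleNet (rad μ M) W →
      ∀ u : ℂ → ℂ → ℝ, (∀ w, Continuous (u w)) → (∀ w ζ, 0 ≤ u w ζ) →
      (∀ w ζ, u w ζ ≤ bump w (rad μ M w) ζ) → (∀ w ζ, bump w (rad μ M w) ζ / N ≤ u w ζ) →
      (∀ (ζ : ℂ) (F : Finset ℂ), (F : Set ℂ) ⊆ W →
        (∀ w ∈ W, dist ζ w ≤ 2 * rad μ M w → w ∈ F) → ∑ w ∈ F, u w ζ = 1) →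
      ∃ β : ℂ → ℂ → ℝ, (∀ w, Continuous (β w)) ∧ (∀ w ζ, 0 ≤ β w ζ) ∧ (∀ w ζ, β w ζ ≤ 1) ∧
        (∀ w ζ, 5 * rad μ M w < dist ζ w → β w ζ = 0) ∧
        (∀ (ζ : ℂ) (F : Finset ℂ), (F : Set ℂ) ⊆ W →
          (∀ w ∈ W, dist ζ w ≤ 5 * rad μ M w → w ∈ F) → ∑ w ∈ F, β w ζ = 1) ∧
        ∀ w, c * M ≤ a * ∫ ζ, β w ζ ∂μ - ∫ ζ, β w ζ ∂n := by
  have hNR : (1 : ℝ) ≤ N := by exact_mod_cast hN0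
  have := h.locallyFinite
  set c : ℝ := (a - κ) / (4 * N * 2 ^ K)
  have hc : 0 < c := div_pos (by linarith) (by positivity)
  -- the mass not swept by `T` costs at most `δ κ 2 ^ K M`
  obtain ⟨δ, hδ0, hδ1, hδc⟩ : ∃ δ : ℝ, 0 < δ ∧ δ ≤ 1 / 2 ∧ δ * (κ * 2 ^ K) ≤ c := by
    refine ⟨min (1 / 2) (c / (κ * 2 ^ K + 1)), by positivity, min_le_left _ _, ?_⟩
    calc _ ≤ c / (κ * 2 ^ K + 1) * (κ * 2 ^ K + 1) := by
          gcongr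
          · exact min_le_right _ _
          · linarith
      _ = c := by field_simp
  obtain ⟨M₁, hM₁, T, hT⟩ := exists_isSweep h hκ hM₀ hn hδ0
  refine ⟨max M₀ (2 ^ (K * 2) * M₁ + 1), hM₀.trans_le (le_max_left _ _), c, hc,
    fun M hM W hW u huc hu0 huB huN hu1 => ?_⟩
  have hMM₀ : M₀ ≤ M := (le_max_left _ _).trans hM
  have hMpos : 0 < M := hM₀.trans_le hMM₀
  have hsc : ∀ z, 2 ^ 2 * rad μ M₁ z ≤ rad μ M z := h.pow_mul_rad_le hM₁ 2
    (lt_of_lt_of_le (by linarith) ((le_max_right _ _).trans hM))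
  have hρ := h.rad_pos hMpos
  have hmono : ∀ v v' : ℂ → ℝ, (∀ x, v x ≤ v' x) → ∀ ζ, T v ζ ≤ T v' ζ := by
    intro v v' hv ζ
    have := hT.nonneg (v' - v) (fun x => sub_nonneg.2 (hv x)) ζ
    rw [map_sub, Pi.sub_apply] at this
    linarith
  have hlocal : ∀ (v v' : ℂ → ℝ) ζ, (∀ x, dist x ζ ≤ rad μ M₁ ζ → v x = v' x) →
      T v ζ = T v' ζ := by
    intro v v' ζ hv
    have := hT.eq_zero (v - v') ζ (fun x hx => sub_eq_zero.2 (hv x hx))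
    rw [map_sub, Pi.sub_apply] at this
    linarith
  have hu_le_one : ∀ w ζ, u w ζ ≤ 1 := fun w ζ => (huB w ζ).trans (bump_le_one _ _ _)
  have hu_zero : ∀ w ζ, 2 * rad μ M w ≤ dist ζ w → u w ζ = 0 := fun w ζ hd =>
    le_antisymm ((huB w ζ).trans (bump_eq_zero (hρ w) hd).le) (hu0 w ζ)
  have hu_bdd : ∀ w, ∃ R, ∀ x ∉ ball (0 : ℂ) R, u w x = 0 := fun w => by
    refine ⟨dist w 0 + 2 * rad μ M w, fun x hx => hu_zero w x ?_⟩
    rw [mem_ball, not_lt] at hx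
    linarith [dist_triangle x w 0]
  have hT0 : ∀ w ζ, 0 ≤ T (u w) ζ := fun w ζ => hT.nonneg _ (hu0 w) ζ
  have hTle : ∀ w ζ, T (u w) ζ ≤ T 1 ζ := fun w ζ => hmono _ _ (hu_le_one w) ζ
  have hfar : ∀ w ζ, 5 * rad μ M w < dist ζ w → ∀ x, dist x ζ ≤ rad μ M₁ ζ →
      2 * rad μ M w ≤ dist x w := by
    intro w ζ hd x hx
    have h1 := hsc ζ
    have h2 := h.rad_le_add_dist hMpos ζ w
    have h3 := dist_triangle ζ x w
    rw [dist_comm ζ x] at h3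
    have := hρ w
    linarith
  have hTc : ∀ w, HasCompactSupport (T (u w)) := fun w => hT.hasCompactSupport h hM₁ (hu_bdd w)
  have huC : ∀ w, HasCompactSupport (u w) := fun w =>
    HasCompactSupport.intro (isCompact_closedBall w (2 * rad μ M w)) fun x hx => hu_zero w x
      (by rw [mem_closedBall, not_le] at hx; exact hx.le)
  have hrest : ∀ w ζ, 0 ≤ u w ζ * (1 - T 1 ζ) := fun w ζ =>
    mul_nonneg (hu0 w ζ) (by linarith [hT.one_le ζ])
  have hrestc : ∀ w, Continuous fun ζ => u w ζ * (1 - T 1 ζ) := fun w =>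
    (huc w).mul (continuous_const.sub (hT.continuous 1))
  -- the part `T u_w` is swept over discs on which `n ≤ κ μ`; the rest `u_w (1 - T 1)` restores the
  -- partition of unity and is small
  refine ⟨fun w ζ => T (u w) ζ + u w ζ * (1 - T 1 ζ), fun w => (hT.continuous _).add (hrestc w),
    fun w ζ => add_nonneg (hT0 w ζ) (hrest w ζ), fun w ζ => ?_, fun w ζ hd => ?_,
    fun ζ F hFW hF => ?_, fun w => ?_⟩
  · have h1 := hTle w ζ
    have h2 : u w ζ * (1 - T 1 ζ) ≤ 1 * (1 - T 1 ζ) :=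
      mul_le_mul_of_nonneg_right (hu_le_one w ζ) (by linarith [hT.one_le ζ])
    linarith
  · have h1 : T (u w) ζ = 0 := hT.eq_zero _ _ fun x hx => hu_zero w x (hfar w ζ hd x hx)
    have h2 : u w ζ = 0 := hu_zero w ζ (by linarith [hρ w])
    simp [h1, h2]
  · have h1 : ∑ w ∈ F, u w ζ = 1 := hu1 ζ F hFW fun w hw hd => hF w hw (by linarith [hρ w])
    have h2 : ∑ w ∈ F, T (u w) ζ = T 1 ζ := by
      have h3 : ∑ w ∈ F, T (u w) ζ = T (∑ w ∈ F, u w) ζ := by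
        rw [map_sum, Finset.sum_apply]
      rw [h3]
      refine hlocal _ _ _ fun x hx => ?_
      rw [Finset.sum_apply, Pi.one_apply]
      refine hu1 x F hFW fun w hw hd => hF w hw ?_
      by_contra hc
      have h4 := hsc ζ
      have h2 := h.rad_le_add_dist hMpos ζ w
      have h3 := dist_triangle ζ x w
      rw [dist_comm ζ x] at h3
      have := hρ w
      linarith
    rw [Finset.sum_add_distrib, h2, ← Finset.sum_mul, h1]
    ring
  · have hiT : ∀ ν : Measure ℂ, IsLocallyFiniteMeasure ν → Integrable (T (u w)) ν := fun ν _ =>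
      (hT.continuous _).integrable_of_hasCompactSupport (hTc w)
    have hiu : ∀ ν : Measure ℂ, IsLocallyFiniteMeasure ν → Integrable (u w) ν := fun ν _ =>
      (huc w).integrable_of_hasCompactSupport (huC w)
    have hir : ∀ ν : Measure ℂ, IsLocallyFiniteMeasure ν →
        Integrable (fun ζ => u w ζ * (1 - T 1 ζ)) ν := fun ν _ =>
      (hrestc w).integrable_of_hasCompactSupport (HasCompactSupport.mul_right (huC w))
    rw [integral_add (hiT μ inferInstance) (hir μ inferInstance),
      integral_add (hiT n inferInstance) (hir n inferInstance)]
    have e1 := hT.integral_le (u w) (hu0 w) (hu_bdd w)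
    have e2 : 0 ≤ ∫ ζ, u w ζ * (1 - T 1 ζ) ∂μ := integral_nonneg (hrest w)
    have e3 : ∫ ζ, u w ζ * (1 - T 1 ζ) ∂n ≤ δ * (κ * (2 ^ K * M)) := by
      calc ∫ ζ, u w ζ * (1 - T 1 ζ) ∂n ≤ ∫ ζ, δ * bump w (rad μ M w) ζ ∂n := by
            refine integral_mono (hir n inferInstance)
              ((integrable_bump n w (hρ w)).const_mul _) fun ζ => ?_
            rw [mul_comm]
            refine mul_le_mul ?_ (huB w ζ) (hu0 w ζ) hδ0.le
            linarith [hT.le_one ζ]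
        _ = δ * ∫ ζ, bump w (rad μ M w) ζ ∂n := integral_const_mul _ _
        _ ≤ δ * (κ * ∫ ζ, bump w (rad μ M w) ζ ∂μ) := by
            gcongr
            exact hn.integral_bump_le h hκ (hρ w) (hMM₀.trans (h.real_ball_rad hMpos w).ge)
        _ ≤ δ * (κ * (2 ^ K * M)) := by
            gcongr
            calc ∫ ζ, bump w (rad μ M w) ζ ∂μ
                ≤ ∫ ζ, (ball w (2 * rad μ M w)).indicator (fun _ => (1 : ℝ)) ζ ∂μ := by
                  refine integral_mono (integrable_bump μ w (hρ w))
                    ((integrable_indicator_iff measurableSet_ball).2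
                      (integrableOn_const (h.measure_ball_lt_top _ _).ne)) fun ζ => ?_
                  by_cases hζ : ζ ∈ ball w (2 * rad μ M w)
                  · rw [indicator_of_mem hζ]; exact bump_le_one _ _ _
                  · rw [indicator_of_notMem hζ]
                    rw [mem_ball, not_lt] at hζ
                    exact (bump_eq_zero (hρ w) hζ).le
              _ = μ.real (ball w (2 * rad μ M w)) := by
                  rw [integral_indicator_const _ measurableSet_ball, smul_eq_mul, mul_one]
              _ ≤ 2 ^ K * μ.real (ball w (rad μ M w)) := h.real_le _ (hρ w)
              _ = _ := by rw [h.real_ball_rad hMpos]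
    have e4 : M / (2 * N * 2 ^ K) ≤ ∫ ζ, T (u w) ζ ∂μ := by
      have hlow : ∀ ζ ∈ ball w (rad μ M w / 2), 1 / (2 * N) ≤ T (u w) ζ := by
        intro ζ hζ
        rw [mem_ball] at hζ
        have h1 : T (u w) ζ = T (fun x => max (u w x) (1 / N)) ζ := by
          refine hlocal _ _ _ fun x hx => ?_
          have h4 := hsc ζ
          have h2 := h.rad_le_add_dist hMpos ζ w
          have h3 := dist_triangle x ζ w
          have h5 := huN w x
          rw [bump_eq_one (hρ w) (by linarith [hρ w])] at h5
          rw [max_eq_left h5]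
        have h2 : T ((1 / N : ℝ) • (1 : ℂ → ℝ)) ζ ≤ T (fun x => max (u w x) (1 / N)) ζ := by
          refine hmono _ _ (fun x => ?_) ζ
          simp
        rw [map_smul, Pi.smul_apply, smul_eq_mul] at h2
        have h3 := hT.le_one ζ
        rw [h1]
        refine le_trans ?_ h2
        calc (1 : ℝ) / (2 * N) = 1 / N * (1 / 2) := by field_simp
          _ ≤ 1 / N * T 1 ζ := by gcongr; linarith
      calc M / (2 * N * 2 ^ K) ≤ 1 / (2 * N) * μ.real (ball w (rad μ M w / 2)) := by
            have := h.real_le w (r := rad μ M w / 2) (by linarith [hρ w])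
            rw [mul_div_cancel₀ _ (two_ne_zero), h.real_ball_rad hMpos] at this
            rw [div_le_iff₀ (by positivity)]
            calc M ≤ _ := this
              _ = _ := by field_simp
        _ = ∫ ζ, (ball w (rad μ M w / 2)).indicator (fun _ => (1 / (2 * N) : ℝ)) ζ ∂μ := by
            rw [integral_indicator_const _ measurableSet_ball, smul_eq_mul, mul_comm]
        _ ≤ _ := by
            refine integral_mono ((integrable_indicator_iff measurableSet_ball).2
              (integrableOn_const (h.measure_ball_lt_top _ _).ne)) (hiT μ inferInstance)
              fun ζ => ?_
            by_cases hζ : ζ ∈ ball w (rad μ M w / 2)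
            · rw [indicator_of_mem hζ]; exact hlow ζ hζ
            · rw [indicator_of_notMem hζ]; exact hT0 w ζ
    have e5 : 2 * (c * M) ≤ (a - κ) * ∫ ζ, T (u w) ζ ∂μ := by
      calc 2 * (c * M) = (a - κ) * (M / (2 * N * 2 ^ K)) := by simp only [c]; field_simp; ring
        _ ≤ _ := mul_le_mul_of_nonneg_left e4 (by linarith)
    have e6 : δ * (κ * (2 ^ K * M)) ≤ c * M := by
      calc _ = δ * (κ * 2 ^ K) * M := by ring
        _ ≤ _ := by gcongr
    have e7 : 0 ≤ a * ∫ ζ, u w ζ * (1 - T 1 ζ) ∂μ := mul_nonneg (by linarith) e2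
    linarith

/-! ### Decomposition into pieces of integral mass -/

/-- A splitting of `a μ - n` into pieces `α_w μ - β_w n` of bounded integral mass, localized at the
points of a scale net. -/
structure IsDecomposition (μ n : Measure ℂ) (a M A C : ℝ) (n₀ n₁ : ℕ) (W : Set ℂ)
    (α β : ℂ → ℂ → ℝ) (deg : ℂ → ℕ) : Prop where
  isScaleNet : IsScaleNet (rad μ M) W
  continuous_α : ∀ w, Continuous (α w)
  abs_α_le : ∀ w ζ, |α w ζ| ≤ C
  β_nonneg : ∀ w ζ, 0 ≤ β w ζ
  β_le_one : ∀ w ζ, β w ζ ≤ 1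
  α_eq_zero : ∀ w ∈ W, ∀ ζ, A * rad μ M w < dist ζ w → α w ζ = 0
  β_eq_zero : ∀ w ∈ W, ∀ ζ, A * rad μ M w < dist ζ w → β w ζ = 0
  sum_α : ∀ (ζ : ℂ) (F : Finset ℂ), (F : Set ℂ) ⊆ W →
    (∀ w ∈ W, dist ζ w ≤ A * rad μ M w → w ∈ F) → ∑ w ∈ F, α w ζ = a
  sum_β : ∀ (ζ : ℂ) (F : Finset ℂ), (F : Set ℂ) ⊆ W →
    (∀ w ∈ W, dist ζ w ≤ A * rad μ M w → w ∈ F) → ∑ w ∈ F, β w ζ = 1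
  integral_eq : ∀ w ∈ W, ∫ ζ, α w ζ ∂μ = deg w + ∫ ζ, β w ζ ∂n
  le_deg : ∀ w ∈ W, n₀ ≤ deg w
  deg_le : ∀ w ∈ W, deg w ≤ n₁

/-- Functions defined by recursion along a well-founded tree of children. -/
theorem exists_eq_sum_children {ι : Type*} (f : ι → ℕ) (ch : ι → Finset ι)
    (hch : ∀ w, ∀ k ∈ ch w, f k < f w) (G : ι → ℝ → ℝ) :
    ∃ c : ι → ℝ, ∀ w, c w = G w (∑ k ∈ ch w, c k) := by
  let wf : WellFounded fun x y : ι => f x < f y := (measure f).wf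
  refine ⟨wf.fix fun w ih => G w (∑ k ∈ (ch w).attach, ih k.1 (hch w k.1 k.2)), fun w => ?_⟩
  rw [wf.fix_eq, Finset.sum_attach (ch w) fun k =>
    wf.fix (fun w ih => G w (∑ k ∈ (ch w).attach, ih k.1 (hch w k.1 k.2))) k]

/-- A step outwards in the net, to a neighbour of larger modulus. -/
theorem IsScaleNet.exists_parent {μ : Measure ℂ} {K : ℕ} (h : DoublingWith μ K) {M : ℝ}
    (hM : 0 < M) {W : Set ℂ} (hW : IsScaleNet (rad μ M) W) (w : ℂ) :
    ∃ p ∈ W, ‖w‖ < ‖p‖ ∧ dist p w ≤ 2 * rad μ M w := by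
  have hr := h.rad_pos hM w
  obtain ⟨v, hv, hwv⟩ : ∃ v : ℂ, ‖v‖ = 1 ∧ ‖w + rad μ M w * v‖ = ‖w‖ + rad μ M w := by
    rcases eq_or_ne w 0 with rfl | hw
    · exact ⟨1, by simp, by simp [abs_of_pos (h.rad_pos hM 0)]⟩
    · have hw' : ‖w‖ ≠ 0 := norm_ne_zero_iff.2 hw
      have hwC : (‖w‖ : ℂ) ≠ 0 := by exact_mod_cast hw'
      refine ⟨w / ‖w‖, by simp [hw'], ?_⟩
      have : w + rad μ M w * (w / ‖w‖) = ((‖w‖ + rad μ M w : ℝ) : ℂ) * (w / ‖w‖) := by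
        push_cast
        field_simp
      rw [this, norm_mul, Complex.norm_real, Real.norm_of_nonneg (by positivity), norm_div,
        Complex.norm_real, norm_norm, div_self hw', mul_one]
  set z := w + rad μ M w * v
  have hzw : dist z w = rad μ M w := by
    simp [z, dist_eq_norm, hv, abs_of_pos hr]
  obtain ⟨p, hp, hd⟩ := hW.exists_near z
  have h1 := h.rad_le_add_dist hM z w
  refine ⟨p, hp, ?_, ?_⟩
  · have h2 := norm_sub_norm_le z p
    rw [dist_eq_norm] at hd
    linarith
  · have h2 := dist_triangle p z w
    rw [dist_comm p z] at h2
    linarith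

/-- If `n` is at most `κ μ` on large discs and `κ < a`, then `a μ - n` decomposes into pieces of
positive integral mass: the fractional part of the mass of each piece is passed on to a neighbour
further from the origin. -/
theorem exists_isDecomposition {K : ℕ} {κ a : ℝ} (hκ : 0 ≤ κ) (hκa : κ < a)
    {μ n : Measure ℂ} (h : DoublingWith μ K) [IsLocallyFiniteMeasure n] {M₀ : ℝ} (hM₀ : 0 < M₀)
    (hn : DominatedOnDiscs μ n κ M₀) (n₀ : ℕ) :
    ∃ M > 0, ∃ A ≥ 1, ∃ C > 0, ∃ n₁ W α β deg, IsDecomposition μ n a M A C n₀ n₁ W α β deg := by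
  classical
  have := h.locallyFinite
  have ha : 0 < a := by linarith
  obtain ⟨N, hN0, hN⟩ := exists_overlap_le K 2 (δ := 1 / 4) (by norm_num)
  have hN := hN μ h
  have hNR : (1 : ℝ) ≤ N := by exact_mod_cast hN0
  obtain ⟨M₂, hM₂, c₀, hc₀, hpart⟩ := exists_partition_mass_le K hκ hκa hN0 h hM₀ hn
  set M := M₂ + N / a + (n₀ + 1) / c₀
  have hMM₂ : M₂ ≤ M := by
    have h1 : 0 ≤ (N : ℝ) / a := by positivity
    have h2 : 0 ≤ ((n₀ : ℝ) + 1) / c₀ := by positivity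
    simp only [M]; linarith
  have hMa : N / a ≤ M := by
    have h2 : 0 ≤ ((n₀ : ℝ) + 1) / c₀ := by positivity
    simp only [M]; linarith
  have hMc : (n₀ + 1) / c₀ ≤ M := by
    have h1 : 0 ≤ (N : ℝ) / a := by positivity
    simp only [M]; linarith
  have hM : 0 < M := hM₂.trans_le hMM₂
  have hρ := h.rad_pos hM
  obtain ⟨W, hW⟩ := h.exists_isScaleNet hM
  have hNW := hN M hM W hW.separated
  obtain ⟨u, huc, hu0, huB, huN, hu1⟩ := hW.exists_partition h hM hNW
  obtain ⟨β, hβc, hβ0, hβ1, hβz, hβs, hβm⟩ := hpart M hMM₂ W hW u huc hu0 huB huN hu1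
  have hu_zero : ∀ w ζ, 2 * rad μ M w ≤ dist ζ w → u w ζ = 0 := fun w ζ hd =>
    le_antisymm ((huB w ζ).trans (bump_eq_zero (hρ w) hd).le) (hu0 w ζ)
  have hiu : ∀ w, Integrable (u w) μ := fun w =>
    (huc w).integrable_of_hasCompactSupport
      (HasCompactSupport.intro (isCompact_closedBall w (2 * rad μ M w)) fun x hx => hu_zero w x
        (by rw [mem_closedBall, not_le] at hx; exact hx.le))
  have hiβ : ∀ w, Integrable (β w) μ := fun w =>
    (hβc w).integrable_of_hasCompactSupport
      (HasCompactSupport.intro (isCompact_closedBall w (5 * rad μ M w)) fun x hx => hβz w x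
        (by rw [mem_closedBall, not_le] at hx; exact hx))
  -- the mass of `a u_w μ`
  set b : ℂ → ℝ := fun w => a * ∫ ζ, u w ζ ∂μ
  have hb1 : ∀ w, 1 ≤ b w := by
    intro w
    have h1 : M / N ≤ ∫ ζ, u w ζ ∂μ := by
      calc M / N = ∫ ζ, (ball w (rad μ M w)).indicator (fun _ => (1 / N : ℝ)) ζ ∂μ := by
            rw [integral_indicator_const _ measurableSet_ball, smul_eq_mul, h.real_ball_rad hM]
            ring
        _ ≤ _ := by
            refine integral_mono ((integrable_indicator_iff measurableSet_ball).2
              (integrableOn_const (h.measure_ball_lt_top _ _).ne)) (hiu w) fun ζ => ?_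
            by_cases hζ : ζ ∈ ball w (rad μ M w)
            · rw [indicator_of_mem hζ]
              have := huN w ζ
              rwa [bump_eq_one (hρ w) (mem_ball.1 hζ).le] at this
            · rw [indicator_of_notMem hζ]; exact hu0 w ζ
    have h2 : 1 / a ≤ M / N := by
      rw [div_le_iff₀ ha] at hMa
      rw [div_le_div_iff₀ ha (by positivity)]; linarith
    have h3 := h2.trans h1
    rw [div_le_iff₀ ha] at h3
    simp only [b]; linarith
  have hb0 : ∀ w, b w ≠ 0 := fun w => by linarith [hb1 w]
  -- each net point has a parent of larger modulus, hence finitely many descendants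
  choose par hparW hparn hpard using hW.exists_parent h hM
  have hchfin : ∀ w, {k | k ∈ W ∧ par k = w}.Finite := fun w => by
    refine (hNW w).1.subset ?_
    rintro k ⟨hk, rfl⟩
    exact ⟨hk, hpard k⟩
  set ch : ℂ → Finset ℂ := fun w => (hchfin w).toFinset
  have hmem : ∀ w k, k ∈ ch w ↔ k ∈ W ∧ par k = w := fun w k => (hchfin w).mem_toFinset
  have hchN : ∀ w, ((ch w).card : ℝ) ≤ N := fun w => by
    have h1 : (ch w).card ≤ {a ∈ W | dist w a ≤ 2 * rad μ M a}.ncard := by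
      rw [← ncard_eq_toFinset_card _ (hchfin w)]
      refine ncard_le_ncard ?_ (hNW w).1
      rintro k ⟨hk, rfl⟩
      exact ⟨hk, hpard k⟩
    exact_mod_cast h1.trans (hNW w).2
  have hWfin : ∀ R, (W ∩ ball (0 : ℂ) R).Finite := fun R =>
    hW.separated.finite_inter h hM (by norm_num) isBounded_ball
  have hrank : ∀ w, ∀ k ∈ ch w, (W ∩ ball (0 : ℂ) ‖k‖).ncard < (W ∩ ball (0 : ℂ) ‖w‖).ncard := by
    intro w k hk
    obtain ⟨hkW, rfl⟩ := (hmem _ _).1 hk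
    refine ncard_lt_ncard ⟨inter_subset_inter_right _ (ball_subset_ball (hparn k).le),
      fun hc => ?_⟩ (hWfin _)
    have := (hc ⟨hkW, by simpa using hparn k⟩).2
    simp at this
  -- the mass `m w` at `w` and the masses `c k` received from the children add up to an integer and a
  -- fractional part `c w`, which is passed on to the parent
  set m : ℂ → ℝ := fun w => a * ∫ ζ, β w ζ ∂μ - ∫ ζ, β w ζ ∂n
  obtain ⟨c, hc⟩ := exists_eq_sum_children (fun w => (W ∩ ball (0 : ℂ) ‖w‖).ncard) ch hrank
    fun w s => Int.fract (m w + s)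
  have hc0 : ∀ w, 0 ≤ c w := fun w => by rw [hc]; exact Int.fract_nonneg _
  have hc1 : ∀ w, c w ≤ 1 := fun w => by rw [hc]; exact (Int.fract_lt_one _).le
  set s : ℂ → ℝ := fun w => ∑ k ∈ ch w, c k
  have hs0 : ∀ w, 0 ≤ s w := fun w => Finset.sum_nonneg fun k _ => hc0 k
  have hsN : ∀ w, s w ≤ N := fun w => by
    refine (Finset.sum_le_card_nsmul _ _ 1 fun k _ => hc1 k).trans ?_
    rw [nsmul_eq_mul, mul_one]; exact hchN w
  have hfloor : ∀ w, (⌊m w + s w⌋₊ : ℝ) = m w + s w - c w := fun w => by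
    have h0 : 0 ≤ m w + s w := by
      have h1 : c₀ * M ≤ m w := hβm w
      have := hs0 w; have : 0 ≤ c₀ * M := by positivity
      linarith
    have h1 : (⌊m w + s w⌋₊ : ℝ) = ⌊m w + s w⌋ := by
      exact_mod_cast Int.natCast_floor_eq_floor h0
    rw [h1, hc w]
    simp only [s, Int.fract]
    ring
  -- the density, relative to `μ`, of the mass passed on by `k`
  set f : ℂ → ℂ → ℝ := fun k ζ => c k * (a * u k ζ / b k)
  have hfc : ∀ k, Continuous (f k) := fun k =>
    continuous_const.mul ((continuous_const.mul (huc k)).div_const _)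
  have hf0 : ∀ k ζ, 0 ≤ f k ζ := fun k ζ =>
    mul_nonneg (hc0 k) (div_nonneg (mul_nonneg ha.le (hu0 k ζ)) (by linarith [hb1 k]))
  have hfa : ∀ k ζ, f k ζ ≤ a := fun k ζ => by
    have h1 : a * u k ζ / b k ≤ a := by
      rw [div_le_iff₀ (by linarith [hb1 k])]
      have h2 : u k ζ ≤ 1 := (huB k ζ).trans (bump_le_one _ _ _)
      have h3 := hb1 k
      nlinarith
    calc f k ζ ≤ 1 * (a * u k ζ / b k) := by
          refine mul_le_mul_of_nonneg_right (hc1 k) ?_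
          exact div_nonneg (mul_nonneg ha.le (hu0 k ζ)) (by linarith [hb1 k])
      _ ≤ a := by rwa [one_mul]
  have hfz : ∀ k ζ, 2 * rad μ M k ≤ dist ζ k → f k ζ = 0 := fun k ζ hd => by
    simp [f, hu_zero k ζ hd]
  have hif : ∀ k, Integrable (f k) μ := fun k => (((hiu k).const_mul a).div_const _).const_mul _
  have hfint : ∀ k, ∫ ζ, f k ζ ∂μ = c k := fun k => by
    simp only [f]
    rw [integral_const_mul, integral_div, integral_const_mul]
    exact (congrArg (c k * ·) (div_self (hb0 k))).trans (mul_one _)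
  obtain ⟨C, hC1, hC⟩ := exists_rad_le_mul K 2
  have hCk : ∀ k, rad μ M k ≤ C * rad μ M (par k) := fun k => hC μ h M hM k (par k) (hpard k)
  set A := 5 * C
  have hchz : ∀ w ζ, A * rad μ M w < dist ζ w → ∀ k ∈ ch w, f k ζ = 0 := by
    intro w ζ hd k hk
    obtain ⟨hkW, rfl⟩ := (hmem _ _).1 hk
    refine hfz k ζ ?_
    have h1 := dist_triangle ζ k (par k)
    rw [dist_comm k] at h1
    have h2 := hpard k
    have h3 := hCk k
    have h4 := hρ k
    simp only [A] at hd
    nlinarith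
  have hA5 : ∀ w, 5 * rad μ M w ≤ A * rad μ M w := fun w => by
    have := hρ w
    simp only [A]; nlinarith
  refine ⟨M, hM, A, by simp only [A]; linarith, a * (2 + N), by positivity,
    ⌊a * (2 ^ (K * 3) * M) + N⌋₊, W,
    fun w ζ => a * β w ζ - f w ζ + ∑ k ∈ ch w, f k ζ, β, fun w => ⌊m w + s w⌋₊, hW, fun w => ?_,
    fun w ζ => ?_, hβ0, hβ1, fun w _ ζ hd => ?_, fun w _ ζ hd => hβz w ζ ((hA5 w).trans_lt hd),
    fun ζ F hFW hF => ?_, fun ζ F hFW hF => hβs ζ F hFW fun w hw hd => hF w hw (hd.trans (hA5 w)),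
    fun w _ => ?_, fun w _ => ?_, fun w _ => ?_⟩
  · exact ((continuous_const.mul (hβc w)).sub (hfc w)).add
      (continuous_finsetSum _ fun k _ => hfc k)
  · have h1 : 0 ≤ ∑ k ∈ ch w, f k ζ := Finset.sum_nonneg fun k _ => hf0 k ζ
    have h2 : ∑ k ∈ ch w, f k ζ ≤ N * a := by
      refine (Finset.sum_le_card_nsmul _ _ a fun k _ => hfa k ζ).trans ?_
      rw [nsmul_eq_mul]
      exact mul_le_mul_of_nonneg_right (hchN w) ha.le
    have h3 := hf0 w ζ
    have h4 := hfa w ζ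
    have h5 : 0 ≤ a * β w ζ := mul_nonneg ha.le (hβ0 w ζ)
    have h6 : a * β w ζ ≤ a := mul_le_of_le_one_right ha.le (hβ1 w ζ)
    rw [abs_le]
    constructor <;> nlinarith
  · have h1 : β w ζ = 0 := hβz w ζ ((hA5 w).trans_lt hd)
    have h2 : f w ζ = 0 := hfz w ζ (by have := hA5 w; have := hρ w; linarith)
    rw [h1, h2, Finset.sum_eq_zero (hchz w ζ hd)]
    simp
  · have e1 : ∑ w ∈ F, β w ζ = 1 := hβs ζ F hFW fun w hw hd => hF w hw (hd.trans (hA5 w))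
    -- every nonzero `f k ζ` is subtracted at `k` and added at the parent of `k`
    set P := ((hNW ζ).1).toFinset
    have hP : ∀ k, k ∈ P ↔ k ∈ W ∧ dist ζ k ≤ 2 * rad μ M k := fun k => (hNW ζ).1.mem_toFinset
    have hPF : P ⊆ F := fun k hk => by
      obtain ⟨h1, h2⟩ := (hP k).1 hk
      exact hF k h1 (by have := hA5 k; have := hρ k; linarith)
    have hparF : ∀ k ∈ P, par k ∈ F := fun k hk => by
      obtain ⟨h1, h2⟩ := (hP k).1 hk
      refine hF _ (hparW k) ?_
      have h3 := dist_triangle ζ k (par k)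
      rw [dist_comm k] at h3
      have h4 := hpard k
      have h5 := hCk k
      have h6 := hρ k
      simp only [A]
      nlinarith
    have hoff : ∀ k ∈ W, k ∉ P → f k ζ = 0 := fun k hk hkP => hfz k ζ (by
      by_contra hc
      exact hkP ((hP k).2 ⟨hk, (not_le.1 hc).le⟩))
    have e2 : ∑ w ∈ F, f w ζ = ∑ k ∈ P, f k ζ :=
      (Finset.sum_subset hPF fun k hk hkP => hoff k (hFW hk) hkP).symm
    have e3 : ∑ w ∈ F, ∑ k ∈ ch w, f k ζ = ∑ k ∈ P, f k ζ := by
      rw [← Finset.sum_fiberwise_of_maps_to hparF]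
      refine Finset.sum_congr rfl fun w _ => ?_
      refine (Finset.sum_subset (fun k hk => ?_) fun k hk hkP => ?_).symm
      · obtain ⟨h1, h2⟩ := Finset.mem_filter.1 hk
        exact (hmem _ _).2 ⟨((hP k).1 h1).1, h2⟩
      · obtain ⟨h1, h2⟩ := (hmem _ _).1 hk
        exact hoff k h1 fun hc => hkP (Finset.mem_filter.2 ⟨hc, h2⟩)
    rw [Finset.sum_add_distrib, Finset.sum_sub_distrib, ← Finset.mul_sum, e1, e2, e3]
    ring
  · have i1 : Integrable (fun ζ => a * β w ζ) μ := (hiβ w).const_mul a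
    have i2 : Integrable (fun ζ => a * β w ζ - f w ζ) μ := i1.sub (hif w)
    rw [integral_add i2 (integrable_finsetSum _ fun k _ => hif k), integral_sub i1 (hif w),
      integral_const_mul, integral_finsetSum _ fun k _ => hif k, hfloor]
    simp_rw [hfint]
    simp only [m, s]
    ring
  · refine Nat.le_floor ?_
    have h1 : c₀ * M ≤ m w := hβm w
    have h2 := hs0 w
    rw [div_le_iff₀ hc₀] at hMc
    linarith
  · refine Nat.floor_le_floor ?_
    have h1 := hsN w
    have h2 : ∫ ζ, β w ζ ∂μ ≤ 2 ^ (K * 3) * M := by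
      calc ∫ ζ, β w ζ ∂μ ≤ ∫ ζ, (ball w (2 ^ 3 * rad μ M w)).indicator (fun _ => (1 : ℝ)) ζ ∂μ := by
            refine integral_mono (hiβ w) ((integrable_indicator_iff measurableSet_ball).2
              (integrableOn_const (h.measure_ball_lt_top _ _).ne)) fun ζ => ?_
            by_cases hζ : ζ ∈ ball w (2 ^ 3 * rad μ M w)
            · rw [indicator_of_mem hζ]; exact hβ1 w ζ
            · rw [indicator_of_notMem hζ]
              rw [mem_ball, not_lt] at hζ
              exact (hβz w ζ (by have := hρ w; linarith)).le
        _ = μ.real (ball w (2 ^ 3 * rad μ M w)) := by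
            rw [integral_indicator_const _ measurableSet_ball, smul_eq_mul, mul_one]
        _ ≤ _ := by
            have := h.real_pow_le w (hρ w) 3
            rwa [h.real_ball_rad hM] at this
    have h3 : 0 ≤ ∫ ζ, β w ζ ∂n := integral_nonneg (hβ0 w)
    have h4 : m w ≤ a * (2 ^ (K * 3) * M) := by
      have := mul_le_mul_of_nonneg_left h2 ha.le
      simp only [m]; linarith
    linarith

/-! ### Density and the counting measure -/

theorem exists_doublingWith {φ : ℂ → ℝ} (hne : laplacianMeasure φ ≠ 0)
    (hd : IsDoubling (laplacianMeasure φ)) :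
    IsDistributionalLaplacian φ (laplacianMeasure φ) ∧
      ∃ K, DoublingWith (laplacianMeasure φ) K := by
  have hex : ∃ μ : Measure ℂ, IsDistributionalLaplacian φ μ := by
    by_contra hc
    exact hne (by rw [laplacianMeasure, dif_neg hc])
  obtain ⟨μ, hμ⟩ := hex
  have hL : IsDistributionalLaplacian φ (laplacianMeasure φ) := by rwa [laplacianMeasure_eq hμ]
  obtain ⟨C, hC⟩ := hd
  obtain ⟨K, hK⟩ := pow_unbounded_of_one_lt C (one_lt_two (α := ℝ≥0))
  refine ⟨hL, K, hL.1, hne, fun z r hr => (hC z r hr).trans ?_⟩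
  gcongr
  exact_mod_cast hK.le

theorem IsDistributionalLaplacian.const_mul {φ : ℂ → ℝ} {μ : Measure ℂ}
    (h : IsDistributionalLaplacian φ μ) {c : ℝ} (hc : 0 ≤ c) :
    IsDistributionalLaplacian (fun z => c * φ z) (ENNReal.ofReal c • μ) := by
  obtain ⟨h1, h2⟩ := h
  refine ⟨?_, fun η hη hηc => ?_⟩
  · refine ⟨fun x => ?_⟩
    obtain ⟨s, hs, hsμ⟩ := h1.finiteAtNhds x
    exact ⟨s, hs, by
      rw [Measure.smul_apply, smul_eq_mul]
      exact ENNReal.mul_lt_top ENNReal.ofReal_lt_top hsμ⟩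
  · simp_rw [mul_assoc]
    rw [integral_const_mul, h2 η hη hηc, integral_smul_measure, ENNReal.toReal_ofReal hc,
      smul_eq_mul]

/-- The weight `c φ` has the scale given by discs of `Δφ`-mass `1 / c`. -/
theorem rho_const_mul {φ : ℂ → ℝ} {μ : Measure ℂ} (h : IsDistributionalLaplacian φ μ) {c : ℝ}
    (hc : 0 < c) : rho (fun z => c * φ z) = rad μ (1 / c) := by
  ext z
  rw [rho_eq_rad, laplacianMeasure_eq (h.const_mul hc.le), rad, rad]
  congr 1
  ext r
  simp only [mem_ofPred_eq, Measure.smul_apply, smul_eq_mul]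
  refine and_congr_right fun _ => ?_
  have hc0 : ENNReal.ofReal c ≠ 0 := by simpa using hc
  rw [ENNReal.ofReal_one, one_div, ENNReal.ofReal_inv_of_pos hc]
  constructor
  · intro h1
    exact ENNReal.eq_inv_of_mul_eq_one_left (by rwa [mul_comm])
  · intro h1
    rw [h1, ENNReal.mul_inv_cancel hc0 ENNReal.ofReal_ne_top]

theorem isLocallyFiniteMeasure_count {S : Set ℂ} (hS : ∀ R, (S ∩ ball (0 : ℂ) R).Finite) :
    IsLocallyFiniteMeasure (Measure.count.restrict S) := by
  refine ⟨fun x => ⟨ball 0 (‖x‖ + 1), isOpen_ball.mem_nhds (by simp), ?_⟩⟩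
  rw [Measure.restrict_apply measurableSet_ball, inter_comm, Measure.count_apply_finite _ (hS _)]
  exact ENNReal.natCast_lt_top _

theorem integral_count_restrict {S : Set ℂ} {w : ℂ} {r : ℝ} (hfin : (S ∩ closedBall w r).Finite)
    {f : ℂ → ℝ} (hf : ∀ ζ, r < dist ζ w → f ζ = 0) :
    ∫ ζ, f ζ ∂(Measure.count.restrict S) = ∑ p ∈ hfin.toFinset, f p := by
  have h1 : ∫ ζ, f ζ ∂(Measure.count.restrict S) =
      ∫ ζ in closedBall w r, f ζ ∂(Measure.count.restrict S) := by
    refine (setIntegral_eq_integral_of_forall_compl_eq_zero fun ζ hζ => hf ζ ?_).symm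
    rwa [mem_closedBall, not_le] at hζ
  have h2 : S ∩ closedBall w r = (hfin.toFinset : Set ℂ) := hfin.coe_toFinset.symm
  have h3 : ∫ ζ in S ∩ closedBall w r, f ζ ∂Measure.count =
      ∫ ζ in (hfin.toFinset : Set ℂ), f ζ ∂Measure.count := by rw [← h2]
  rw [h1, Measure.restrict_restrict measurableSet_closedBall, inter_comm, h3, setIntegral_finset]
  · simp [Measure.real]
  · rw [← biUnion_of_singleton (hfin.toFinset : Set ℂ)]
    exact (integrableOn_finite_biUnion (Finset.finite_toSet _)).2 fun x _ =>
      integrableOn_singleton (by simp) (by simp)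

/-- An upper uniform density below `b` bounds the number of points in every disc of large
`Δφ`-mass by `κ` times this mass, `κ < b`. -/
theorem exists_dominatedOnDiscs {φ : ℂ → ℝ} {K : ℕ} (h : DoublingWith (laplacianMeasure φ) K)
    {Λ : Set ℂ} (hfin : ∀ R, (Λ ∩ ball (0 : ℂ) R).Finite)
    {b : ℝ} (hdens : upperDensity φ Λ < ENNReal.ofReal b) :
    ∃ κ, 0 ≤ κ ∧ κ < b ∧ ∃ M₀ > 0,
      DominatedOnDiscs (laplacianMeasure φ) (Measure.count.restrict Λ) κ M₀ := by
  set μ := laplacianMeasure φ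
  obtain ⟨c, hc1, hc2⟩ := exists_between hdens
  have hctop : c ≠ ⊤ := (hc2.trans ENNReal.ofReal_lt_top).ne
  have hev := eventually_lt_of_limsup_lt hc1
  obtain ⟨r₁, hr₁⟩ := eventually_atTop.1 hev
  obtain ⟨i, hi⟩ := pow_unbounded_of_one_lt r₁ (one_lt_two (α := ℝ))
  refine ⟨c.toReal, ENNReal.toReal_nonneg, ?_, 2 ^ (K * i) + 1, by positivity, fun z s hs => ?_⟩
  · rwa [← ENNReal.ofReal_toReal hctop, ENNReal.ofReal_lt_ofReal_iff_of_nonneg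
      ENNReal.toReal_nonneg] at hc2
  · have hρ : 0 < rho φ z := by rw [rho_eq_rad]; exact h.rad_pos one_pos z
    have hs2 : 2 ^ i * rho φ z < s := by
      by_contra hc
      have h1 := h.real_mono (ball_subset_ball (x := z) (not_lt.1 hc))
      have h2 := h.real_pow_le z hρ i
      have h3 : μ.real (ball z (rho φ z)) = 1 := by rw [rho_eq_rad]; exact h.real_ball_rad one_pos z
      rw [h3] at h2
      linarith
    have hs0 : 0 < s := lt_trans (by positivity) hs2
    have hr : r₁ ≤ s / rho φ z := by
      rw [le_div_iff₀ hρ]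
      have := mul_le_mul_of_nonneg_right hi.le hρ.le
      linarith
    have h4 := (hr₁ _ hr).le
    rw [iSup_le_iff] at h4
    have h5 := h4 z
    rw [div_mul_cancel₀ _ hρ.ne'] at h5
    have hne : μ (ball z s) ≠ 0 := by
      have h0 := h.real_pos z hs0
      intro hc
      rw [Measure.real, hc] at h0
      simp at h0
    rw [ENNReal.div_le_iff hne (h.measure_ball_lt_top z s).ne] at h5
    rw [ENNReal.ofReal_toReal hctop]
    refine le_trans ?_ h5
    rw [Measure.restrict_apply measurableSet_ball]
    have hf : (Λ ∩ ball z s).Finite := (hfin (dist z 0 + s)).subset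
      (inter_subset_inter_right _ (ball_subset_ball' (by linarith)))
    rw [inter_comm, Measure.count_apply_finite _ hf]
    have : (hf.toFinset.card : ℕ∞) ≤ (Λ ∩ closedBall z s).encard := by
      rw [← hf.encard_eq_coe_toFinset_card]
      exact encard_le_encard (inter_subset_inter_right _ ball_subset_closedBall)
    exact_mod_cast this

/-! ### Convergence of sums over a net -/

/-- If `D` bounds the rank of each element in the ordering by `f`, then `∑ D⁻²` is bounded. -/
theorem sum_inv_sq_le_of_card_le {ι : Type*} [DecidableEq ι] (f D : ι → ℝ) (s : Finset ι)
    (hD : ∀ w ∈ s, (({v ∈ s | f v ≤ f w} : Finset ι).card : ℝ) ≤ D w) :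
    ∑ w ∈ s, (D w ^ 2)⁻¹ ≤ 2 := by
  have key : (∀ w ∈ s, (({v ∈ s | f v ≤ f w} : Finset ι).card : ℝ) ≤ D w) →
      ∑ w ∈ s, (D w ^ 2)⁻¹ ≤ 2 - 2 / (s.card + 1) := by
    refine Finset.induction_on_max_value f
      (motive := fun s => (∀ w ∈ s, (({v ∈ s | f v ≤ f w} : Finset ι).card : ℝ) ≤ D w) →
        ∑ w ∈ s, (D w ^ 2)⁻¹ ≤ 2 - 2 / (s.card + 1)) s (by simp) ?_
    intro a t hat hmax ih hD
    have h1 := ih fun w hw => le_trans (by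
      exact_mod_cast Finset.card_le_card (Finset.filter_subset_filter _ (Finset.subset_insert _ _)))
      (hD w (Finset.mem_insert_of_mem hw))
    have h2 : ((t.card : ℝ) + 1) ≤ D a := by
      have := hD a (Finset.mem_insert_self _ _)
      rw [Finset.filter_true_of_mem, Finset.card_insert_of_notMem hat] at this
      · exact_mod_cast this
      · intro x hx
        rcases Finset.mem_insert.1 hx with rfl | hx
        · exact le_rfl
        · exact hmax x hx
    rw [Finset.sum_insert hat, Finset.card_insert_of_notMem hat]
    push_cast
    have hk : (0 : ℝ) ≤ t.card := by positivity
    have h3 : (D a ^ 2)⁻¹ ≤ 2 / ((t.card : ℝ) + 1) - 2 / (t.card + 1 + 1) := by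
      calc (D a ^ 2)⁻¹ ≤ (((t.card : ℝ) + 1) ^ 2)⁻¹ := by gcongr
        _ ≤ _ := by
          rw [div_sub_div _ _ (by positivity) (by positivity), inv_eq_one_div,
            div_le_div_iff₀ (by positivity) (by positivity)]
          nlinarith [mul_nonneg hk hk, mul_nonneg (mul_nonneg hk hk) hk]
    linarith
  have h1 : (0 : ℝ) ≤ 2 / (s.card + 1) := by positivity
  linarith [key hD]

/-- The points of a separated set outside their own discs about `z` have summable weights
`(ρ(w) / |z - w|) ^ (2 K)`: by doubling each weight is at most the square of `M / μ(D(z, |z - w|))`,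
and the rank of `w` in the ordering by distance to `z` is at most comparable to the inverse of this
ratio. -/
theorem exists_sum_pow_le (K : ℕ) : ∃ C : ℝ, 0 < C ∧ ∀ μ : Measure ℂ, DoublingWith μ K →
    ∀ M : ℝ, 0 < M → ∀ F : Finset ℂ, SeparatedBy (rad μ M) (1 / 4) (F : Set ℂ) →
      ∀ z : ℂ, (∀ w ∈ F, rad μ M w ≤ dist z w) → ∀ n : ℕ, 2 * K ≤ n →
        ∑ w ∈ F, (rad μ M w / dist z w) ^ n ≤ C := by
  classical
  refine ⟨2 * (2 ^ (K * 4) * 2 ^ (K * 2)) ^ 2, by positivity,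
    fun μ h M hM F hF z hfar n hn => ?_⟩
  have hρ := h.rad_pos hM
  have hd : ∀ w ∈ F, 0 < dist z w := fun w hw => (hρ w).trans_le (hfar w hw)
  set D : ℂ → ℝ := fun w => 2 ^ (K * 4) * (μ.real (ball z (dist z w)) / M)
  have hcount : ∀ w ∈ F, (({v ∈ F | dist z v ≤ dist z w} : Finset ℂ).card : ℝ) ≤ D w := by
    intro w hw
    set G : Finset ℂ := {v ∈ F | dist z v ≤ dist z w}
    have hG : ∀ v ∈ G, v ∈ F ∧ dist z v ≤ dist z w := fun v hv => Finset.mem_filter.1 hv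
    set B : ℂ → Set ℂ := fun v => ball v (rad μ M v / 2 ^ 3)
    have hB : ∀ v, M ≤ 2 ^ (K * 3) * μ.real (B v) := fun v => by
      have hv := hρ v
      have := h.real_pow_le v (r := rad μ M v / 2 ^ 3) (by positivity) 3
      rwa [mul_div_cancel₀ _ (by positivity), h.real_ball_rad hM] at this
    have hdisj : (G : Set ℂ).PairwiseDisjoint B := by
      intro a ha b hb hab
      refine ball_disjoint_ball ?_
      rw [dist_eq_norm]
      refine le_trans ?_ (hF a (hG a ha).1 b (hG b hb).1 hab)
      have h1 := le_max_left (rad μ M a) (rad μ M b)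
      have h2 := le_max_right (rad μ M a) (rad μ M b)
      linarith
    have hsub : ∀ v ∈ G, B v ⊆ ball z (2 * dist z w) := by
      intro v hv
      obtain ⟨h1, h2⟩ := hG v hv
      have h3 := hfar v h1
      refine ball_subset_ball' ?_
      rw [dist_comm v z]
      have := hρ v
      linarith
    have hsum : ∑ v ∈ G, μ.real (B v) ≤ 2 ^ K * μ.real (ball z (dist z w)) := by
      rw [← measureReal_biUnion_finset hdisj (fun a _ => measurableSet_ball)
        (fun a _ => (h.measure_ball_lt_top _ _).ne)]
      exact (h.real_mono (iUnion₂_subset hsub)).trans (h.real_le z (hd w hw))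
    have h3 : (G.card : ℝ) * M ≤ 2 ^ (K * 4) * μ.real (ball z (dist z w)) := by
      calc (G.card : ℝ) * M = ∑ a ∈ G, M := by simp
        _ ≤ ∑ a ∈ G, 2 ^ (K * 3) * μ.real (B a) := Finset.sum_le_sum fun a _ => hB a
        _ = 2 ^ (K * 3) * ∑ a ∈ G, μ.real (B a) := by rw [Finset.mul_sum]
        _ ≤ 2 ^ (K * 3) * (2 ^ K * μ.real (ball z (dist z w))) := by gcongr
        _ = _ := by ring
    simp only [D]
    rwa [← mul_div_assoc, le_div_iff₀ hM]
  have hterm : ∀ w ∈ F, (rad μ M w / dist z w) ^ n ≤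
      (2 ^ (K * 4) * 2 ^ (K * 2)) ^ 2 * (D w ^ 2)⁻¹ := by
    intro w hw
    have hx0 : 0 < rad μ M w / dist z w := div_pos (hρ w) (hd w hw)
    have hx1 : rad μ M w / dist z w ≤ 1 := (div_le_one (hd w hw)).2 (hfar w hw)
    have hm := h.real_pos z (hd w hw)
    -- a dyadic multiple of the radius at `w` comparable to the distance
    obtain ⟨j, hj1, hj2⟩ : ∃ j : ℕ, (2 : ℝ) ^ j ≤ dist z w / rad μ M w ∧
        dist z w / rad μ M w < 2 ^ (j + 1) :=
      exists_nat_pow_near ((one_le_div (hρ w)).2 (hfar w hw)) one_lt_two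
    have h1 : μ.real (ball z (dist z w)) ≤ 2 ^ (K * (j + 2)) * M := by
      rw [← h.real_ball_rad hM w]
      refine h.real_ball_le_of_le (hρ w) _ ?_
      rw [div_lt_iff₀ (hρ w)] at hj2
      rw [pow_succ]; linarith
    have h2 : (rad μ M w / dist z w) ^ K * 2 ^ (K * j) ≤ 1 := by
      rw [pow_mul', ← mul_pow]
      refine pow_le_one₀ (by positivity) ?_
      rw [← inv_div, inv_mul_le_iff₀ (div_pos (hd w hw) (hρ w)), mul_one]
      exact hj1
    have h3 : (rad μ M w / dist z w) ^ K * D w ≤ 2 ^ (K * 4) * 2 ^ (K * 2) := by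
      calc (rad μ M w / dist z w) ^ K * D w
          ≤ (rad μ M w / dist z w) ^ K * (2 ^ (K * 4) * (2 ^ (K * (j + 2)) * M / M)) := by
            simp only [D]; gcongr
        _ = 2 ^ (K * 4) * 2 ^ (K * 2) * ((rad μ M w / dist z w) ^ K * 2 ^ (K * j)) := by
            rw [mul_add, pow_add]; field_simp
        _ ≤ _ := mul_le_of_le_one_right (by positivity) h2
    have hD : 0 < D w := by simp only [D]; positivity
    rw [← div_eq_mul_inv, le_div_iff₀ (by positivity)]
    calc (rad μ M w / dist z w) ^ n * D w ^ 2
        ≤ (rad μ M w / dist z w) ^ (2 * K) * D w ^ 2 := by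
          gcongr ?_ * _
          exact pow_le_pow_of_le_one hx0.le hx1 hn
      _ = ((rad μ M w / dist z w) ^ K * D w) ^ 2 := by rw [pow_mul', ← mul_pow]
      _ ≤ _ := by gcongr
  calc ∑ w ∈ F, (rad μ M w / dist z w) ^ n
      ≤ ∑ w ∈ F, (2 ^ (K * 4) * 2 ^ (K * 2)) ^ 2 * (D w ^ 2)⁻¹ := Finset.sum_le_sum hterm
    _ = (2 ^ (K * 4) * 2 ^ (K * 2)) ^ 2 * ∑ w ∈ F, (D w ^ 2)⁻¹ := by rw [Finset.mul_sum]
    _ ≤ (2 ^ (K * 4) * 2 ^ (K * 2)) ^ 2 * 2 := by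
        gcongr
        exact sum_inv_sq_le_of_card_le (fun v => dist z v) D F hcount
    _ = _ := by ring

/-! ### Polynomials with prescribed expansion at infinity -/

/-- Taylor expansion with remainder of a bounded holomorphic function on the unit disc. -/
theorem exists_taylor (m : ℕ) : ∀ (E : ℝ) (f : ℂ → ℂ), DifferentiableOn ℂ f (ball 0 1) →
    (∀ y ∈ ball (0 : ℂ) 1, ‖f y‖ ≤ E) → ∃ (e : ℕ → ℂ) (g : ℂ → ℂ), e 0 = f 0 ∧
      (∀ k < m, ‖e k‖ ≤ 2 ^ m * E) ∧ (∀ y ∈ ball (0 : ℂ) 1, ‖g y‖ ≤ 2 ^ m * E) ∧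
      ∀ y ∈ ball (0 : ℂ) 1, f y = ∑ k ∈ Finset.range m, e k * y ^ k + y ^ m * g y := by
  induction m with
  | zero => exact fun E f _ hb => ⟨fun _ => f 0, f, rfl, by simp, by simpa using hb, by simp⟩
  | succ m ih =>
    intro E f hd hb
    have h0 : (0 : ℂ) ∈ ball (0 : ℂ) 1 := by simp
    have hE : 0 ≤ E := (norm_nonneg _).trans (hb 0 h0)
    obtain ⟨e, g, -, he, hg, hf⟩ := ih (2 * E) (dslope f 0)
      ((Complex.differentiableOn_dslope (isOpen_ball.mem_nhds h0)).2 hd) (fun y hy => by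
        have := Complex.norm_dslope_le_div_of_mapsTo_ball (R₂ := 2 * E) hd (fun x hx => by
          rw [mem_closedBall, dist_eq_norm]
          linarith [norm_sub_le (f x) (f 0), hb x hx, hb 0 h0]) hy
        rwa [div_one] at this)
    refine ⟨fun k => if k = 0 then f 0 else e (k - 1), g, by simp, fun k hk => ?_, fun y hy => ?_,
      fun y hy => ?_⟩
    · rcases Nat.eq_zero_or_pos k with rfl | hk0
      · simp only [if_true]
        exact (hb 0 h0).trans (le_mul_of_one_le_left hE (one_le_pow₀ one_le_two))
      · simp only [if_neg hk0.ne', pow_succ, mul_assoc]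
        exact he _ (by omega)
    · rw [pow_succ, mul_assoc]; exact hg y hy
    · have h1 : f y = f 0 + y * dslope f 0 y := by
        have := sub_smul_dslope f 0 y
        rw [sub_zero, smul_eq_mul] at this
        rw [this]; ring
      rw [Finset.sum_range_succ', h1, hf y hy, mul_add, Finset.mul_sum]
      simp only [Nat.add_one_ne_zero, if_false, Nat.add_sub_cancel, if_true, pow_zero, mul_one]
      have : ∀ k ∈ Finset.range m, y * (e k * y ^ k) = e k * y ^ (k + 1) := fun k _ => by ring
      rw [Finset.sum_congr rfl this]
      ring

theorem norm_multiset_prod_le {s : Multiset ℂ} {r : ℝ} (h : ∀ x ∈ s, ‖x‖ ≤ r) :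
    ‖s.prod‖ ≤ r ^ s.card := by
  have h1 : ‖s.prod‖ = (s.map (normHom : ℂ →*₀ ℝ)).prod := map_multiset_prod normHom s
  rw [h1]
  exact Multiset.prod_map_le_pow_card (fun x _ => norm_nonneg x) h

/-- The polynomial part of `xⁿ G(1/x)`, with the constant term replaced by a large number, has `n`
simple roots, separated and of bounded modulus, and is asymptotic to `xⁿ G(1/x)` with relative error
`O(|x|⁻ⁿ)`. The large number comes from a range, which leaves freedom in the position of the
roots. -/
theorem exists_localFactor (n₁ : ℕ) {E : ℝ} (hE : 1 ≤ E) :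
    ∃ b ≥ (1 : ℝ), ∃ B ≥ (1 : ℝ), ∃ c > (0 : ℝ), ∀ n, 1 ≤ n → n ≤ n₁ → ∀ G : ℂ → ℂ,
      DifferentiableOn ℂ G (ball 0 1) → G 0 = 1 → (∀ y ∈ ball (0 : ℂ) 1, ‖G y‖ ≤ E) →
      (∀ y ∈ ball (0 : ℂ) 1, 1 ≤ E * ‖G y‖) →
      ∃ (q : ℂ → ℂ) (R : ℝ → Finset ℂ), ∀ t, 1 ≤ t → t ≤ 2 →
        (∀ x, ∏ p ∈ R t, (x - p) = q x - (t * b : ℝ)) ∧ (R t).card = n ∧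
        (∀ p ∈ R t, ‖p‖ ≤ B) ∧ (∀ p ∈ R t, ∀ p' ∈ R t, p ≠ p' → c ≤ ‖p - p'‖) ∧
        ∀ x, 1 < ‖x‖ → ‖(∏ p ∈ R t, (x - p)) / (x ^ n * G x⁻¹) - 1‖ ≤ B / ‖x‖ ^ n := by
  classical
  set T : ℝ := 2 ^ n₁ * E
  have hT : 1 ≤ T := one_le_mul_of_one_le_of_one_le (one_le_pow₀ one_le_two) hE
  set s : ℝ := 2 * n₁ * T + 1
  have hs1 : 1 ≤ s := by
    have : 0 ≤ 2 * (n₁ : ℝ) * T := by positivity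
    simp only [s]; linarith
  set b : ℝ := n₁ * T * s ^ n₁ + 1
  have hb1 : 1 ≤ b := by
    have : 0 ≤ (n₁ : ℝ) * T * s ^ n₁ := by positivity
    simp only [b]; linarith
  set B : ℝ := E * (T + 2 * b)
  have hB1 : 1 ≤ B := one_le_mul_of_one_le_of_one_le hE (by linarith)
  refine ⟨b, hb1, B, hB1, 1 / (2 * (2 * B) ^ n₁), by positivity,
    fun n hn0 hn G hG hG0 hGE hGE' => ?_⟩
  obtain ⟨m, rfl⟩ : ∃ m, n = m + 1 := ⟨n - 1, by omega⟩
  obtain ⟨e, g, he0, he, hg, hexp⟩ := exists_taylor (m + 1) E G hG hGE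
  have hTm : 2 ^ (m + 1) * E ≤ T := by
    simp only [T]; gcongr; exact one_le_two
  have heT : ∀ k < m, ‖e (k + 1)‖ ≤ T := fun k hk => (he _ (by omega)).trans hTm
  set Q : Polynomial ℂ := ∑ k ∈ Finset.range m,
    Polynomial.C (e (k + 1)) * Polynomial.X ^ (m - k)
  set P : ℝ → Polynomial ℂ := fun t =>
    Polynomial.X ^ (m + 1) + (Q - Polynomial.C ((t * b : ℝ) : ℂ))
  have hdeg : ∀ t, (Q - Polynomial.C ((t * b : ℝ) : ℂ)).degree < ((m + 1 : ℕ) : WithBot ℕ) := by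
    intro t
    have h1 : (Q - Polynomial.C ((t * b : ℝ) : ℂ)).degree ≤ (m : WithBot ℕ) := by
      refine (Polynomial.degree_sub_le _ _).trans (max_le ?_ ?_)
      · refine (Polynomial.degree_sum_le _ _).trans (Finset.sup_le fun k _ => ?_)
        refine (Polynomial.degree_C_mul_X_pow_le _ _).trans ?_
        exact_mod_cast Nat.sub_le m k
      · exact Polynomial.degree_C_le.trans (by exact_mod_cast Nat.zero_le m)
    exact h1.trans_lt (by exact_mod_cast Nat.lt_succ_self m)
  have hmonic : ∀ t, (P t).Monic := fun t => Polynomial.monic_X_pow_add (hdeg t)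
  have hnat : ∀ t, (P t).natDegree = m + 1 := fun t => by
    have : (P t).degree = ((m + 1 : ℕ) : WithBot ℕ) := by
      simp only [P]
      rw [Polynomial.degree_add_eq_left_of_degree_lt, Polynomial.degree_X_pow]
      rw [Polynomial.degree_X_pow]; exact hdeg t
    exact Polynomial.natDegree_eq_of_degree_eq_some this
  have hPev : ∀ t x, (P t).eval x =
      x ^ (m + 1) + (∑ k ∈ Finset.range m, e (k + 1) * x ^ (m - k) - (t * b : ℝ)) := by
    intro t x
    simp only [P, Q]
    rw [Polynomial.eval_add, Polynomial.eval_pow, Polynomial.eval_X, Polynomial.eval_sub,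
      Polynomial.eval_C, Polynomial.eval_finsetSum]
    simp
  have hPder : ∀ t x, x * (P t).derivative.eval x = (m + 1 : ℕ) * x ^ (m + 1) +
      ∑ k ∈ Finset.range m, e (k + 1) * ((m - k : ℕ) * x ^ (m - k)) := by
    intro t x
    simp only [P, Q]
    rw [Polynomial.derivative_add, Polynomial.derivative_sub, Polynomial.derivative_C, sub_zero,
      Polynomial.derivative_X_pow, Polynomial.derivative_sum, Polynomial.eval_add,
      Polynomial.eval_finsetSum, mul_add, Finset.mul_sum]
    congr 1
    · simp; ring
    · refine Finset.sum_congr rfl fun k hk => ?_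
      have hk' : m - k = (m - k - 1) + 1 := by have := Finset.mem_range.1 hk; omega
      simp only [Polynomial.derivative_C_mul, Polynomial.derivative_X_pow, Polynomial.eval_mul,
        Polynomial.eval_C, Polynomial.eval_pow, Polynomial.eval_X]
      conv_rhs => rw [hk', pow_succ, ← hk']
      ring
  -- the expansion at infinity
  have hinf : ∀ t x, 1 < ‖x‖ →
      (P t).eval x = x ^ (m + 1) * G x⁻¹ - (g x⁻¹ + (t * b : ℝ)) := by
    intro t x hx
    have hx0 : x ≠ 0 := fun hc => by rw [hc, norm_zero] at hx; linarith
    have hy : x⁻¹ ∈ ball (0 : ℂ) 1 := by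
      rw [mem_ball, dist_zero_right, norm_inv]; exact inv_lt_one_of_one_lt₀ hx
    rw [hPev, hexp _ hy, Finset.sum_range_succ', he0, hG0, mul_add (x ^ (m + 1)),
      mul_add (x ^ (m + 1)), Finset.mul_sum]
    have h1 : ∀ k ∈ Finset.range m, x ^ (m + 1) * (e (k + 1) * x⁻¹ ^ (k + 1)) =
        e (k + 1) * x ^ (m - k) := by
      intro k hk
      have hk' : m + 1 = (m - k) + (k + 1) := by have := Finset.mem_range.1 hk; omega
      rw [hk', pow_add, inv_pow]
      field_simp
    rw [Finset.sum_congr rfl h1]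
    have h2 : x ^ (m + 1) * (x⁻¹ ^ (m + 1) * g x⁻¹) = g x⁻¹ := by
      rw [← mul_assoc, ← mul_pow, mul_inv_cancel₀ hx0, one_pow, one_mul]
    rw [h2]
    ring
  have hgt : ∀ t, 1 ≤ t → t ≤ 2 → ∀ x : ℂ, 1 < ‖x‖ → ‖g x⁻¹ + (t * b : ℝ)‖ ≤ T + 2 * b := by
    intro t h1 h2 x hx
    have hy : x⁻¹ ∈ ball (0 : ℂ) 1 := by
      rw [mem_ball, dist_zero_right, norm_inv]; exact inv_lt_one_of_one_lt₀ hx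
    refine (norm_add_le _ _).trans (add_le_add ((hg _ hy).trans hTm) ?_)
    rw [Complex.norm_real, Real.norm_of_nonneg (by positivity)]
    gcongr
  have hGx : ∀ x : ℂ, 1 < ‖x‖ → 1 ≤ E * ‖G x⁻¹‖ := fun x hx => hGE' _ (by
    rw [mem_ball, dist_zero_right, norm_inv]; exact inv_lt_one_of_one_lt₀ hx)
  have hroot_le : ∀ t, 1 ≤ t → t ≤ 2 → ∀ x, (P t).eval x = 0 → ‖x‖ ≤ B := by
    intro t h1 h2 x hx
    rcases le_or_gt ‖x‖ 1 with hx1 | hx1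
    · exact hx1.trans hB1
    · have h3 := hinf t x hx1
      rw [hx, eq_comm, sub_eq_zero] at h3
      have h4 := congrArg norm h3
      rw [norm_mul, norm_pow] at h4
      calc ‖x‖ ≤ ‖x‖ ^ (m + 1) := le_self_pow₀ hx1.le (by omega)
        _ ≤ ‖x‖ ^ (m + 1) * (E * ‖G x⁻¹‖) := le_mul_of_one_le_right (by positivity) (hGx x hx1)
        _ = E * (‖x‖ ^ (m + 1) * ‖G x⁻¹‖) := by ring
        _ ≤ B := by rw [h4]; simp only [B]; gcongr; exact hgt t h1 h2 x hx1
  have hmn : (m : ℝ) + 1 ≤ n₁ := by exact_mod_cast hn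
  -- the constant term `t b` exceeds the value of the other terms on `|x| ≤ s`
  have hroot_ge : ∀ t, 1 ≤ t → ∀ x, (P t).eval x = 0 → s < ‖x‖ := by
    intro t h1 x hx
    by_contra hc
    rw [not_lt] at hc
    have h3 : ((t * b : ℝ) : ℂ) =
        x ^ (m + 1) + ∑ k ∈ Finset.range m, e (k + 1) * x ^ (m - k) := by
      rw [hPev] at hx; linear_combination -hx
    have h4 := congrArg norm h3
    rw [Complex.norm_real, Real.norm_of_nonneg (by positivity)] at h4
    have hpow : ∀ i ≤ m + 1, ‖x‖ ^ i ≤ s ^ n₁ := fun i hi =>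
      (pow_le_pow_left₀ (norm_nonneg x) hc i).trans (pow_le_pow_right₀ hs1 (by omega))
    have h5 : ‖x ^ (m + 1) + ∑ k ∈ Finset.range m, e (k + 1) * x ^ (m - k)‖ ≤
        T * s ^ n₁ + ∑ k ∈ Finset.range m, T * s ^ n₁ := by
      refine (norm_add_le _ _).trans (add_le_add ?_ ((norm_sum_le _ _).trans
        (Finset.sum_le_sum fun k hk => ?_)))
      · rw [norm_pow]
        exact (hpow _ le_rfl).trans (le_mul_of_one_le_left (by positivity) hT)
      · rw [norm_mul, norm_pow]
        exact mul_le_mul (heT k (Finset.mem_range.1 hk)) (hpow _ (by omega)) (by positivity)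
          (by positivity)
    rw [Finset.sum_const, Finset.card_range, nsmul_eq_mul] at h5
    have h6 : T * s ^ n₁ + m * (T * s ^ n₁) ≤ n₁ * T * s ^ n₁ := by
      calc _ = ((m : ℝ) + 1) * (T * s ^ n₁) := by ring
        _ ≤ n₁ * (T * s ^ n₁) := by gcongr
        _ = _ := by ring
    have h7 : b ≤ t * b := le_mul_of_one_le_left (by linarith) h1
    have h8 : n₁ * T * s ^ n₁ < b := by simp only [b]; linarith
    linarith
  -- outside this disc the leading term dominates the derivative
  have hder : ∀ t, ∀ x, s < ‖x‖ → 1 / 2 ≤ ‖(P t).derivative.eval x‖ := by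
    intro t x hx
    have hx1 : 1 < ‖x‖ := hs1.trans_lt hx
    have h1 : ‖∑ k ∈ Finset.range m, e (k + 1) * ((m - k : ℕ) * x ^ (m - k))‖ ≤
        m * (T * (n₁ * ‖x‖ ^ m)) := by
      refine (norm_sum_le _ _).trans ((Finset.sum_le_card_nsmul _ _ (T * (n₁ * ‖x‖ ^ m))
        fun k hk => ?_).trans (by rw [Finset.card_range, nsmul_eq_mul]))
      rw [norm_mul, norm_mul, norm_pow, Complex.norm_natCast]
      refine mul_le_mul (heT k (Finset.mem_range.1 hk)) (mul_le_mul ?_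
        (pow_le_pow_right₀ hx1.le (Nat.sub_le m k)) (by positivity) (by positivity))
        (by positivity) (by positivity)
      exact_mod_cast (Nat.sub_le m k).trans (by omega)
    have h2 : 2 * (m * (T * (n₁ * ‖x‖ ^ m))) ≤ m * ‖x‖ ^ (m + 1) := by
      calc _ = m * ((2 * n₁ * T) * ‖x‖ ^ m) := by ring
        _ ≤ m * (‖x‖ * ‖x‖ ^ m) := by
          gcongr
          simp only [s] at hx; linarith
        _ = _ := by ring
    have h3 : (m + 1 : ℕ) * ‖x‖ ^ (m + 1) - m * (T * (n₁ * ‖x‖ ^ m)) ≤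
        ‖x‖ * ‖(P t).derivative.eval x‖ := by
      rw [← norm_mul, hPder]
      have h4 := norm_sub_le_norm_add (((m + 1 : ℕ) : ℂ) * x ^ (m + 1))
        (∑ k ∈ Finset.range m, e (k + 1) * ((m - k : ℕ) * x ^ (m - k)))
      rw [norm_mul, norm_pow, Complex.norm_natCast] at h4
      linarith
    have h5 : ‖x‖ ≤ ‖x‖ ^ (m + 1) := le_self_pow₀ hx1.le (by omega)
    have h6 : 1 / 2 * ‖x‖ ≤ ‖x‖ * ‖(P t).derivative.eval x‖ := by
      push_cast at h3
      have : 0 ≤ (m : ℝ) * ‖x‖ ^ (m + 1) := by positivity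
      nlinarith
    have hx0 : 0 < ‖x‖ := by linarith
    nlinarith
  -- the derivative at a root is the product of its differences with the other roots
  have hsep : ∀ t, 1 ≤ t → t ≤ 2 → ∀ p ∈ (P t).roots, ∀ p' ∈ (P t).roots.erase p,
      1 / (2 * (2 * B) ^ n₁) ≤ ‖p - p'‖ := by
    intro t h1 h2 p hp p' hp'
    have hr : ∀ x ∈ (P t).roots, ‖x‖ ≤ B := fun x hx =>
      hroot_le t h1 h2 x (Polynomial.isRoot_of_mem_roots hx)
    have h3 := hder t p (hroot_ge t h1 p (Polynomial.isRoot_of_mem_roots hp))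
    rw [(IsAlgClosed.splits (P t)).eval_root_derivative (hmonic t) hp,
      ← Multiset.prod_map_erase hp', norm_mul] at h3
    have hcard : (((P t).roots.erase p).erase p').card ≤ n₁ := by
      refine (Multiset.card_le_card ((Multiset.erase_le _ _).trans (Multiset.erase_le _ _))).trans ?_
      rw [← (IsAlgClosed.splits (P t)).natDegree_eq_card_roots, hnat]
      exact hn
    have h4 : ‖((((P t).roots.erase p).erase p').map (fun x => p - x)).prod‖ ≤ (2 * B) ^ n₁ := by
      refine (norm_multiset_prod_le (r := 2 * B) fun y hy => ?_).trans ?_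
      · obtain ⟨x, hx, rfl⟩ := Multiset.mem_map.1 hy
        have hx' := Multiset.mem_of_mem_erase (Multiset.mem_of_mem_erase hx)
        linarith [norm_sub_le p x, hr p hp, hr x hx']
      · rw [Multiset.card_map]
        exact pow_le_pow_right₀ (by linarith) hcard
    have h5 := mul_le_mul_of_nonneg_left h4 (norm_nonneg (p - p'))
    rw [div_le_iff₀ (by positivity)]
    linarith
  have hnodup : ∀ t, 1 ≤ t → t ≤ 2 → (P t).roots.Nodup := by
    intro t h1 h2
    rw [Multiset.nodup_iff_count_le_one]
    intro p
    by_contra hc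
    rw [not_le] at hc
    have hp : p ∈ (P t).roots := Multiset.count_pos.1 (by omega)
    have hp' : p ∈ (P t).roots.erase p := Multiset.count_pos.1 (by
      rw [Multiset.count_erase_self]; omega)
    have := hsep t h1 h2 p hp p hp'
    rw [sub_self, norm_zero] at this
    have h3 : 0 < 1 / (2 * (2 * B) ^ n₁) := by positivity
    linarith
  refine ⟨fun x => x ^ (m + 1) + ∑ k ∈ Finset.range m, e (k + 1) * x ^ (m - k),
    fun t => (P t).roots.toFinset, fun t h1 h2 => ?_⟩
  have hprod : ∀ x, ∏ p ∈ (P t).roots.toFinset, (x - p) = (P t).eval x := by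
    intro x
    have h3 := congrArg (Polynomial.eval x)
      ((IsAlgClosed.splits (P t)).eq_prod_roots_of_monic (hmonic t))
    rw [Polynomial.eval_multiset_prod, Multiset.map_map] at h3
    rw [h3, Finset.prod, Multiset.toFinset_val, (hnodup t h1 h2).dedup]
    simp
  refine ⟨fun x => by rw [hprod, hPev]; ring, ?_, fun p hp => ?_, fun p hp p' hp' hne => ?_,
    fun x hx => ?_⟩
  · rw [Multiset.toFinset_card_of_nodup (hnodup t h1 h2),
      ← (IsAlgClosed.splits (P t)).natDegree_eq_card_roots, hnat]
  · exact hroot_le t h1 h2 p (Polynomial.isRoot_of_mem_roots (Multiset.mem_toFinset.1 hp))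
  · exact hsep t h1 h2 p (Multiset.mem_toFinset.1 hp) p'
      ((Multiset.mem_erase_of_ne hne.symm).2 (Multiset.mem_toFinset.1 hp'))
  · have hx0 : x ≠ 0 := fun hc => by rw [hc, norm_zero] at hx; linarith
    have hxG := hGx x hx
    have hG0 : G x⁻¹ ≠ 0 := fun hc => by rw [hc, norm_zero] at hxG; linarith
    have hne : x ^ (m + 1) * G x⁻¹ ≠ 0 := mul_ne_zero (pow_ne_zero _ hx0) hG0
    rw [hprod, hinf t x hx, sub_div, div_self hne, sub_sub_cancel_left, norm_neg, norm_div,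
      norm_mul, norm_pow, div_le_div_iff₀ (by positivity) (by positivity)]
    calc ‖g x⁻¹ + (t * b : ℝ)‖ * ‖x‖ ^ (m + 1) ≤ (T + 2 * b) * ‖x‖ ^ (m + 1) * 1 := by
          rw [mul_one]; gcongr; exact hgt t h1 h2 x hx
      _ ≤ (T + 2 * b) * ‖x‖ ^ (m + 1) * (E * ‖G x⁻¹‖) := by gcongr
      _ = _ := by simp only [B]; ring

/-! ### Local factors -/

theorem half_le_norm_one_sub {y u : ℂ} (hy : ‖y‖ ≤ 1) (hu : ‖u‖ ≤ 1 / 2) :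
    1 / 2 ≤ ‖1 - y * u‖ := by
  have h1 : ‖y * u‖ ≤ 1 / 2 := by
    rw [norm_mul]
    calc ‖y‖ * ‖u‖ ≤ 1 * (1 / 2) := mul_le_mul hy hu (norm_nonneg _) zero_le_one
      _ = _ := one_mul _
  have h2 := norm_sub_norm_le (1 : ℂ) (y * u)
  rw [norm_one] at h2
  linarith

theorem norm_log_one_sub_le {y u : ℂ} (hy : ‖y‖ ≤ 1) (hu : ‖u‖ ≤ 1 / 2) :
    ‖Complex.log (1 - y * u)‖ ≤ 1 := by
  have h1 : ‖-(y * u)‖ ≤ 1 / 2 := by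
    rw [norm_neg, norm_mul]
    calc ‖y‖ * ‖u‖ ≤ 1 * (1 / 2) := mul_le_mul hy hu (norm_nonneg _) zero_le_one
      _ = _ := one_mul _
  have h2 := Complex.norm_log_one_add_half_le_self h1
  rw [← sub_eq_add_neg] at h2
  linarith

theorem hasDerivAt_log_one_sub {y u : ℂ} (hy : ‖y‖ < 1) (hu : ‖u‖ ≤ 1 / 2) :
    HasDerivAt (fun y => Complex.log (1 - y * u)) (-u / (1 - y * u)) y := by
  have h1 : HasDerivAt (fun y : ℂ => 1 - y * u) (-u) y := by
    simpa using ((hasDerivAt_id y).mul_const u).const_sub 1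
  refine h1.clog ?_
  left
  have h2 : ‖y * u‖ < 1 := by
    rw [norm_mul]
    calc ‖y‖ * ‖u‖ ≤ 1 * (1 / 2) := mul_le_mul hy.le hu (norm_nonneg _) zero_le_one
      _ < _ := by norm_num
  have h3 := (Complex.abs_re_le_norm (y * u)).trans_lt h2
  rw [Complex.sub_re, Complex.one_re]
  linarith [(abs_lt.1 h3).2]

section LogIntegral

variable {μ : Measure ℂ} {α : ℂ → ℝ} {w : ℂ} {r : ℝ}

/-- The holomorphic function `y ↦ ∫ α(ζ) log (1 - y (ζ - w) / s) dμ(ζ)`. -/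
def logIntegral (μ : Measure ℂ) (α : ℂ → ℝ) (w : ℂ) (s : ℝ) (y : ℂ) : ℂ :=
  ∫ ζ, (α ζ : ℂ) * Complex.log (1 - y * ((ζ - w) / s)) ∂μ

theorem norm_sub_div_le (hr : 0 < r) {ζ : ℂ} (hζ : dist ζ w ≤ r) :
    ‖(ζ - w) / ((2 * r : ℝ) : ℂ)‖ ≤ 1 / 2 := by
  rw [norm_div, Complex.norm_real, Real.norm_of_nonneg (by positivity), ← dist_eq_norm,
    div_le_iff₀ (by positivity)]
  linarith

theorem norm_logIntegrand_le (hr : 0 < r) (hα : ∀ ζ, r < dist ζ w → α ζ = 0) {y : ℂ}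
    (hy : ‖y‖ ≤ 1) (ζ : ℂ) :
    ‖(α ζ : ℂ) * Complex.log (1 - y * ((ζ - w) / (2 * r : ℝ)))‖ ≤ |α ζ| := by
  rcases lt_or_ge r (dist ζ w) with h1 | h1
  · simp [hα ζ h1]
  · rw [norm_mul, Complex.norm_real, Real.norm_eq_abs]
    exact mul_le_of_le_one_right (abs_nonneg _)
      (norm_log_one_sub_le hy (norm_sub_div_le hr h1))

theorem integrable_abs_of_support [IsLocallyFiniteMeasure μ] (hc : Continuous α)
    (hα : ∀ ζ, r < dist ζ w → α ζ = 0) : Integrable (fun ζ => |α ζ|) μ :=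
  hc.abs.integrable_of_hasCompactSupport (HasCompactSupport.intro (isCompact_closedBall w r)
    fun ζ hζ => by rw [mem_closedBall, not_le] at hζ; simp [hα ζ hζ])

theorem measurable_logIntegrand (hc : Continuous α) (s : ℝ) (y : ℂ) :
    Measurable fun ζ => (α ζ : ℂ) * Complex.log (1 - y * ((ζ - w) / s)) :=
  (Complex.continuous_ofReal.comp hc).measurable.mul
    (Complex.measurable_log.comp (by fun_prop : Continuous fun ζ : ℂ =>
      1 - y * ((ζ - w) / s)).measurable)

theorem integrable_logIntegrand [IsLocallyFiniteMeasure μ] (hc : Continuous α) (hr : 0 < r)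
    (hα : ∀ ζ, r < dist ζ w → α ζ = 0) {y : ℂ} (hy : ‖y‖ ≤ 1) :
    Integrable (fun ζ => (α ζ : ℂ) * Complex.log (1 - y * ((ζ - w) / (2 * r : ℝ)))) μ :=
  (integrable_abs_of_support hc hα).mono' (measurable_logIntegrand hc _ y).aestronglyMeasurable
    (Eventually.of_forall (norm_logIntegrand_le hr hα hy))

theorem norm_logIntegral_le [IsLocallyFiniteMeasure μ] (hc : Continuous α) (hr : 0 < r)
    (hα : ∀ ζ, r < dist ζ w → α ζ = 0) {y : ℂ} (hy : ‖y‖ ≤ 1) :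
    ‖logIntegral μ α w (2 * r) y‖ ≤ ∫ ζ, |α ζ| ∂μ :=
  norm_integral_le_of_norm_le (integrable_abs_of_support hc hα)
    (Eventually.of_forall (norm_logIntegrand_le hr hα hy))

theorem differentiableOn_logIntegral [IsLocallyFiniteMeasure μ] (hc : Continuous α) (hr : 0 < r)
    (hα : ∀ ζ, r < dist ζ w → α ζ = 0) :
    DifferentiableOn ℂ (logIntegral μ α w (2 * r)) (ball 0 1) := by
  intro y hy
  have hy' : ‖y‖ < 1 := by simpa using hy
  have hnhds : ball (0 : ℂ) 1 ∈ 𝓝 y := isOpen_ball.mem_nhds hy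
  refine ((hasDerivAt_integral_of_dominated_loc_of_deriv_le (bound := fun ζ => |α ζ|)
    (F' := fun y ζ => (α ζ : ℂ) * (-((ζ - w) / (2 * r : ℝ)) / (1 - y * ((ζ - w) / (2 * r : ℝ)))))
    hnhds (Eventually.of_forall fun x => (measurable_logIntegrand hc _ x).aestronglyMeasurable)
    (integrable_logIntegrand hc hr hα hy'.le) ?_ ?_ (integrable_abs_of_support hc hα)
    ?_).2).differentiableAt.differentiableWithinAt
  · refine Measurable.aestronglyMeasurable ?_
    exact (Complex.continuous_ofReal.comp hc).measurable.mul
      ((by fun_prop : Continuous fun ζ : ℂ => -((ζ - w) / (2 * r : ℝ))).measurable.div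
        (by fun_prop : Continuous fun ζ : ℂ => 1 - y * ((ζ - w) / (2 * r : ℝ))).measurable)
  · refine Eventually.of_forall fun ζ x hx => ?_
    have hx' : ‖x‖ ≤ 1 := by
      rw [mem_ball, dist_zero_right] at hx; exact hx.le
    rcases lt_or_ge r (dist ζ w) with h1 | h1
    · simp [hα ζ h1]
    · have h2 := norm_sub_div_le hr h1
      have h3 := half_le_norm_one_sub hx' h2
      rw [norm_mul, Complex.norm_real, Real.norm_eq_abs]
      refine mul_le_of_le_one_right (abs_nonneg _) ?_
      rw [norm_div, norm_neg, div_le_one (by linarith)]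
      linarith
  · refine Eventually.of_forall fun ζ x hx => ?_
    have hx' : ‖x‖ < 1 := by
      rw [mem_ball, dist_zero_right] at hx; exact hx
    rcases lt_or_ge r (dist ζ w) with h1 | h1
    · simp only [hα ζ h1, Complex.ofReal_zero, zero_mul]
      exact hasDerivAt_const _ _
    · exact (hasDerivAt_log_one_sub hx' (norm_sub_div_le hr h1)).const_mul _

end LogIntegral

theorem log_norm_one_sub {z w ζ : ℂ} {s : ℝ} (hs : 0 < s) (hz : z ≠ w) (hζ : z ≠ ζ) :
    (Complex.log (1 - ((z - w) / s)⁻¹ * ((ζ - w) / s))).re =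
      Real.log ‖z - ζ‖ - Real.log ‖z - w‖ := by
  have hsC : (s : ℂ) ≠ 0 := by exact_mod_cast hs.ne'
  have hzw : z - w ≠ 0 := sub_ne_zero.2 hz
  have h1 : 1 - ((z - w) / s)⁻¹ * ((ζ - w) / s) = (z - ζ) / (z - w) := by
    field_simp; ring
  rw [Complex.log_re, h1, norm_div, Real.log_div (norm_ne_zero_iff.2 (sub_ne_zero.2 hζ))
    (norm_ne_zero_iff.2 hzw)]

theorem DoublingWith.re_logIntegral {μ : Measure ℂ} {K : ℕ} (h : DoublingWith μ K) {α : ℂ → ℝ}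
    (hc : Continuous α) {w : ℂ} {r : ℝ} (hr : 0 < r) (hα : ∀ ζ, r < dist ζ w → α ζ = 0) {z : ℂ}
    (hz : 2 * r < dist z w) :
    (logIntegral μ α w (2 * r) ((z - w) / (2 * r : ℝ))⁻¹).re =
      logPotential μ α z - Real.log ‖z - w‖ * ∫ ζ, α ζ ∂μ := by
  have := h.locallyFinite
  have hzw : z ≠ w := by
    rintro rfl; rw [dist_self] at hz; linarith
  have hy : ‖((z - w) / ((2 * r : ℝ) : ℂ))⁻¹‖ ≤ 1 := by
    rw [norm_inv, norm_div, Complex.norm_real, Real.norm_of_nonneg (by positivity), inv_div,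
      ← dist_eq_norm, div_le_one (by linarith)]
    exact hz.le
  have hcs : HasCompactSupport α := HasCompactSupport.intro (isCompact_closedBall w r)
    fun ζ hζ => by rw [mem_closedBall, not_le] at hζ; exact hα ζ hζ
  have hi := integrable_logIntegrand (μ := μ) hc hr hα hy
  have h1 : (logIntegral μ α w (2 * r) ((z - w) / (2 * r : ℝ))⁻¹).re =
      ∫ ζ, ((α ζ : ℂ) * Complex.log (1 - ((z - w) / (2 * r : ℝ))⁻¹ *
        ((ζ - w) / (2 * r : ℝ)))).re ∂μ := by
    exact (integral_re hi).symm
  rw [h1, logPotential, ← integral_const_mul, ← integral_sub (h.integrable_mul_log hc hcs z)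
    ((hc.integrable_of_hasCompactSupport hcs).const_mul _)]
  refine integral_congr_ae (Eventually.of_forall fun ζ => ?_)
  simp only
  rcases lt_or_ge r (dist ζ w) with h2 | h2
  · simp [hα ζ h2]
  · have hzζ : z ≠ ζ := by rintro rfl; linarith
    rw [Complex.re_ofReal_mul, log_norm_one_sub (by positivity) hzw hzζ]
    ring

/-- The factor `∏ |z - p| ^ β(p) · exp (-∫ α(ζ) log |z - ζ| dμ(ζ))`. -/
def potentialFactor (μ : Measure ℂ) (α : ℂ → ℝ) (S : Finset ℂ) (β : ℂ → ℝ) (z : ℂ) : ℝ :=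
  (∏ p ∈ S, ‖z - p‖ ^ β p) * Real.exp (-logPotential μ α z)

/-- A charge `α μ - β` of integral total mass `n` on a disc is balanced by `n` simple zeros near the
disc, with a choice of positions, so that the resulting factor is `1 + O(dist⁻ⁿ)`. -/
theorem exists_localFactor_disc {μ : Measure ℂ} {K : ℕ} (h : DoublingWith μ K) (n₁ : ℕ) (T₀ : ℝ) :
    ∃ B ≥ (1 : ℝ), ∃ c > (0 : ℝ), ∀ (w : ℂ) (r : ℝ), 0 < r → ∀ (α : ℂ → ℝ) (S : Finset ℂ)
      (β : ℂ → ℝ) (n : ℕ), Continuous α → (∀ ζ, r < dist ζ w → α ζ = 0) →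
      (∀ p ∈ S, dist p w ≤ r) → (∀ p, 0 ≤ β p) → 1 ≤ n → n ≤ n₁ →
      ∫ ζ, α ζ ∂μ = n + ∑ p ∈ S, β p → ∫ ζ, |α ζ| ∂μ + ∑ p ∈ S, β p ≤ T₀ →
      ∃ R : ℝ → Finset ℂ,
        (∀ t t' z, 1 ≤ t → t ≤ 2 → 1 ≤ t' → t' ≤ 2 → |t - t'| * r ^ n ≤
          ‖∏ p ∈ R t, (z - p) - ∏ p ∈ R t', (z - p)‖) ∧
        ∀ t, 1 ≤ t → t ≤ 2 → (R t).card = n ∧ (∀ p ∈ R t, dist p w ≤ B * r) ∧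
          (∀ p ∈ R t, ∀ p' ∈ R t, p ≠ p' → c * r ≤ ‖p - p'‖) ∧
          ∃ H : ℂ → ℂ, DifferentiableOn ℂ H {z | 2 * r < dist z w} ∧
            ∀ z, 2 * r < dist z w →
              ‖H z‖ = (∏ p ∈ R t, ‖z - p‖) * potentialFactor μ α S β z ∧
              ‖H z - 1‖ ≤ B * (2 * r / dist z w) ^ n := by
  have := h.locallyFinite
  obtain ⟨b, hb1, B, hB1, c, hc, hloc⟩ := exists_localFactor n₁ (E := Real.exp |T₀|)
    (Real.one_le_exp (abs_nonneg _))
  refine ⟨2 * B, by linarith, 2 * c, by positivity,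
    fun w r hr α S β n hαc hα hS hβ hn1 hn hmass hT => ?_⟩
  set s : ℝ := 2 * r
  have hs : 0 < s := by positivity
  have hsC : (s : ℂ) ≠ 0 := by exact_mod_cast hs.ne'
  set L : ℂ → ℂ := fun y => logIntegral μ α w s y -
    ∑ p ∈ S, (β p : ℂ) * Complex.log (1 - y * ((p - w) / s))
  have hLle : ∀ y ∈ ball (0 : ℂ) 1, ‖L y‖ ≤ |T₀| := by
    intro y hy
    have hy' : ‖y‖ ≤ 1 := by rw [mem_ball, dist_zero_right] at hy; exact hy.le
    refine (norm_sub_le _ _).trans (le_trans ?_ (hT.trans (le_abs_self _)))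
    refine add_le_add (norm_logIntegral_le hαc hr hα hy') ((norm_sum_le _ _).trans
      (Finset.sum_le_sum fun p hp => ?_))
    rw [norm_mul, Complex.norm_real, Real.norm_of_nonneg (hβ p)]
    exact mul_le_of_le_one_right (hβ p) (norm_log_one_sub_le hy' (norm_sub_div_le hr (hS p hp)))
  have hLd : DifferentiableOn ℂ L (ball 0 1) := by
    refine (differentiableOn_logIntegral hαc hr hα).sub
      (DifferentiableOn.fun_sum fun p hp y hy => ?_)
    have hy' : ‖y‖ < 1 := by simpa using hy
    exact ((hasDerivAt_log_one_sub hy' (norm_sub_div_le hr (hS p hp))).const_mul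
      _).differentiableAt.differentiableWithinAt
  set G : ℂ → ℂ := fun y => Complex.exp (L y)
  have hGd : DifferentiableOn ℂ G (ball 0 1) := hLd.cexp
  have hG0 : G 0 = 1 := by simp [G, L, logIntegral]
  have hGle : ∀ y ∈ ball (0 : ℂ) 1, ‖G y‖ ≤ Real.exp |T₀| := fun y hy => by
    rw [Complex.norm_exp]
    exact Real.exp_le_exp.2 ((le_abs_self _).trans ((Complex.abs_re_le_norm _).trans (hLle y hy)))
  have hGge : ∀ y ∈ ball (0 : ℂ) 1, 1 ≤ Real.exp |T₀| * ‖G y‖ := fun y hy => by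
    rw [Complex.norm_exp, ← Real.exp_add]
    refine Real.one_le_exp ?_
    have := (abs_le.1 ((Complex.abs_re_le_norm (L y)).trans (hLle y hy))).1
    linarith
  obtain ⟨q, R, hR⟩ := hloc n hn1 hn G hGd hG0 hGle hGge
  have hinj : ∀ F : Set ℂ, InjOn (fun ξ : ℂ => w + s * ξ) F := fun F x _ y _ hxy => by
    simpa [hsC] using hxy
  have hprod : ∀ (F : Finset ℂ) z, ∏ p ∈ F.image (fun ξ => w + s * ξ), (z - p) =
      s ^ F.card * ∏ ξ ∈ F, ((z - w) / s - ξ) := by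
    intro F z
    rw [Finset.prod_image (hinj _), ← Finset.prod_const, ← Finset.prod_mul_distrib]
    refine Finset.prod_congr rfl fun ξ _ => ?_
    field_simp
    ring
  refine ⟨fun t => (R t).image fun ξ => w + s * ξ, fun t t' z h1 h2 h1' h2' => ?_,
    fun t h1 h2 => ?_⟩
  · obtain ⟨e1, k1, -⟩ := hR t h1 h2
    obtain ⟨e2, k2, -⟩ := hR t' h1' h2'
    have h3 : ∏ p ∈ (R t).image (fun ξ => w + s * ξ), (z - p) -
        ∏ p ∈ (R t').image (fun ξ => w + s * ξ), (z - p) = (((t' - t) * b * s ^ n : ℝ) : ℂ) := by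
      rw [hprod, hprod, e1, e2, k1, k2]; push_cast; ring
    rw [h3, Complex.norm_real, Real.norm_eq_abs, abs_mul, abs_mul, abs_sub_comm t' t,
      abs_of_nonneg (zero_le_one.trans hb1), abs_of_pos (pow_pos hs n)]
    have h4 : r ^ n ≤ s ^ n := by gcongr; simp only [s]; linarith
    calc |t - t'| * r ^ n ≤ |t - t'| * s ^ n := by gcongr
      _ ≤ |t - t'| * b * s ^ n := by
        gcongr; exact le_mul_of_one_le_right (abs_nonneg _) hb1
  · obtain ⟨e1, k1, kB, ksep, kH⟩ := hR t h1 h2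
    refine ⟨by rw [Finset.card_image_of_injOn (hinj _), k1], fun p hp => ?_,
      fun p hp p' hp' hne => ?_, ?_⟩
    · obtain ⟨ξ, hξ, rfl⟩ := Finset.mem_image.1 hp
      rw [dist_eq_norm, add_sub_cancel_left, norm_mul, Complex.norm_real,
        Real.norm_of_nonneg hs.le]
      have := mul_le_mul_of_nonneg_left (kB ξ hξ) hs.le
      simp only [s] at *; linarith
    · obtain ⟨ξ, hξ, rfl⟩ := Finset.mem_image.1 hp
      obtain ⟨ξ', hξ', rfl⟩ := Finset.mem_image.1 hp'
      have := ksep ξ hξ ξ' hξ' fun hc => hne (by rw [hc])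
      rw [add_sub_add_left_eq_sub, ← mul_sub, norm_mul, Complex.norm_real,
        Real.norm_of_nonneg hs.le]
      have := mul_le_mul_of_nonneg_left this hs.le
      simp only [s] at *; linarith
    · have hx : ∀ z, s < dist z w → 1 < ‖(z - w) / (s : ℂ)‖ := fun z hz => by
        rw [norm_div, Complex.norm_real, Real.norm_of_nonneg hs.le, one_lt_div hs, ← dist_eq_norm]
        exact hz
      have hG0 : ∀ y, G y ≠ 0 := fun y => Complex.exp_ne_zero _
      refine ⟨fun z => (∏ ξ ∈ R t, ((z - w) / s - ξ)) / (((z - w) / s) ^ n * G ((z - w) / s)⁻¹),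
        ?_, fun z hz => ⟨?_, ?_⟩⟩
      · have hxd : Differentiable ℂ fun z : ℂ => (z - w) / (s : ℂ) := by fun_prop
        have hxinv : DifferentiableOn ℂ (fun z : ℂ => ((z - w) / (s : ℂ))⁻¹)
            {z | s < dist z w} := hxd.differentiableOn.inv fun z hz => by
          have := hx z hz
          intro hc
          rw [hc, norm_zero] at this; linarith
        refine DifferentiableOn.div ?_ ?_ fun z hz => ?_
        · exact DifferentiableOn.fun_finsetProd fun ξ _ => (hxd.sub_const ξ).differentiableOn
        · refine (hxd.pow n).differentiableOn.mul (hGd.comp hxinv fun z hz => ?_)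
          rw [mem_ball, dist_zero_right, norm_inv]
          exact inv_lt_one_of_one_lt₀ (hx z hz)
        · refine mul_ne_zero (pow_ne_zero _ fun hc => ?_) (hG0 _)
          have := hx z hz
          rw [hc, norm_zero] at this; linarith
      · have hzw : z ≠ w := by
          rintro rfl; rw [dist_self] at hz; linarith
        have hzw' : 0 < ‖z - w‖ := norm_pos_iff.2 (sub_ne_zero.2 hzw)
        have hzp : ∀ p ∈ S, z ≠ p := fun p hp => by
          rintro rfl; have := hS z hp; simp only [s] at hz; linarith
        have hGn : ‖G ((z - w) / s)⁻¹‖ * potentialFactor μ α S β z = (‖z - w‖ ^ n)⁻¹ := by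
          have h3 : (L ((z - w) / s)⁻¹).re = logPotential μ α z - Real.log ‖z - w‖ * n -
              ∑ p ∈ S, β p * Real.log ‖z - p‖ := by
            simp only [L]
            rw [Complex.sub_re, h.re_logIntegral hαc hr hα hz, hmass, Complex.re_sum]
            have h4 : ∀ p ∈ S, ((β p : ℂ) * Complex.log (1 - ((z - w) / s)⁻¹ *
                ((p - w) / s))).re = β p * Real.log ‖z - p‖ - β p * Real.log ‖z - w‖ := by
              intro p hp
              rw [Complex.re_ofReal_mul, log_norm_one_sub hs hzw (hzp p hp)]
              ring
            rw [Finset.sum_congr rfl h4, Finset.sum_sub_distrib, ← Finset.sum_mul]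
            ring
          have h5 : ∏ p ∈ S, ‖z - p‖ ^ β p = Real.exp (∑ p ∈ S, β p * Real.log ‖z - p‖) := by
            rw [Real.exp_sum]
            refine Finset.prod_congr rfl fun p hp => ?_
            rw [Real.rpow_def_of_pos (norm_pos_iff.2 (sub_ne_zero.2 (hzp p hp))), mul_comm]
          rw [potentialFactor, h5, Complex.norm_exp, h3, ← Real.exp_add, ← Real.exp_add,
            ← Real.exp_log (inv_pos.2 (pow_pos hzw' n)), Real.log_inv, Real.log_pow]
          congr 1
          ring
        have h6 : (∏ p ∈ (R t).image (fun ξ => w + s * ξ), ‖z - p‖) =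
            s ^ n * ∏ ξ ∈ R t, ‖(z - w) / s - ξ‖ := by
          rw [← norm_prod, hprod, norm_mul, norm_pow, Complex.norm_real,
            Real.norm_of_nonneg hs.le, k1, norm_prod]
        have hGn0 : ‖G ((z - w) / s)⁻¹‖ ≠ 0 := norm_ne_zero_iff.2 (hG0 _)
        have h7 : potentialFactor μ α S β z = (‖z - w‖ ^ n)⁻¹ / ‖G ((z - w) / s)⁻¹‖ := by
          rw [eq_div_iff hGn0, mul_comm, hGn]
        rw [h6, h7, norm_div, norm_prod, norm_mul, norm_pow, norm_div, Complex.norm_real,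
          Real.norm_of_nonneg hs.le, div_pow]
        field_simp
      · have h3 := kH _ (hx z hz)
        refine h3.trans ?_
        rw [norm_div, Complex.norm_real, Real.norm_of_nonneg hs.le, ← dist_eq_norm]
        have h4 : B / (dist z w / s) ^ n = B * (s / dist z w) ^ n := by
          rw [div_pow, div_pow]; field_simp
        rw [h4]
        have : 0 ≤ (s / dist z w) ^ n := by positivity
        nlinarith

/-! ### Separated choice of zeros -/

/-- Greedy choice along an enumeration: a choice at `i` that is possible whatever the choices made
elsewhere can be made compatible with the earlier choices. -/
theorem exists_greedy {ι J : Type*} [Inhabited J] (f : ι → ℕ) (Q : ι → J → (ι → J) → Prop)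
    (hQ : ∀ i a, ∃ j, Q i j a) :
    ∃ a : ι → J, ∀ i, ∃ a' : ι → J, (∀ k, f k < f i → a' k = a k) ∧ Q i (a i) a' := by
  classical
  choose g hg using hQ
  let wf : WellFounded fun x y : ι => f x < f y := (measure f).wf
  let F : ∀ i, (∀ k, f k < f i → J) → J := fun i ih =>
    g i fun k => if hk : f k < f i then ih k hk else default
  refine ⟨wf.fix F, fun i => ⟨fun k => if f k < f i then wf.fix F k else default,
    fun k hk => if_pos hk, ?_⟩⟩
  have h1 : wf.fix F i = g i fun k => if f k < f i then wf.fix F k else default := by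
    rw [wf.fix_eq]
    simp [F]
  rw [h1]
  exact hg _ _

/-- Among more than `N` functions whose values differ pairwise by at least `c`, one is at least
`c / 2` in modulus at `N` given points. -/
theorem exists_half_le_norm {N : ℕ} {P : Fin (N + 1) → ℂ → ℂ} {c : ℝ}
    (hP : ∀ j j', j ≠ j' → ∀ p, c ≤ ‖P j p - P j' p‖) {O : Finset ℂ} (hO : O.card ≤ N) :
    ∃ j, ∀ p ∈ O, c / 2 ≤ ‖P j p‖ := by
  by_contra hc
  push Not at hc
  choose p hp hlt using hc
  obtain ⟨j, -, j', -, hne, hpp⟩ := Finset.exists_ne_map_eq_of_card_lt_of_maps_to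
    (s := Finset.univ) (t := O) (f := p) (by simpa using Nat.lt_succ_of_le hO) fun j _ => hp j
  have h1 := hlt j
  have h2 := hlt j'
  rw [← hpp] at h2
  linarith [hP j j' hne (p j), norm_sub_le (P j (p j)) (P j' (p j))]

/-- A lower bound for a monic polynomial keeps a point away from its zeros. -/
theorem le_norm_sub_of_le_norm_prod {R : Finset ℂ} {p : ℂ} {D r c : ℝ} (hr : 0 < r) (hD : 1 ≤ D)
    (hp : ∀ q ∈ R, ‖p - q‖ ≤ D * r) {n : ℕ} (hn : R.card ≤ n)
    (hc : c * r ^ R.card ≤ ‖∏ q ∈ R, (p - q)‖) {q : ℂ} (hq : q ∈ R) :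
    c / D ^ n * r ≤ ‖p - q‖ := by
  classical
  rw [← Finset.mul_prod_erase R _ hq, norm_mul, norm_prod] at hc
  have hcard : R.card = (R.erase q).card + 1 := (Finset.card_erase_add_one hq).symm
  have h1 : ∏ x ∈ R.erase q, ‖p - x‖ ≤ (D * r) ^ (R.erase q).card := by
    rw [← Finset.prod_const]
    exact Finset.prod_le_prod (fun _ _ => norm_nonneg _) fun x hx => hp x (Finset.mem_of_mem_erase hx)
  set k := (R.erase q).card
  have h2 : c * r * r ^ k ≤ ‖p - q‖ * D ^ n * r ^ k := by
    calc c * r * r ^ k = c * r ^ R.card := by rw [hcard]; ring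
      _ ≤ ‖p - q‖ * (D * r) ^ k := hc.trans (mul_le_mul_of_nonneg_left h1 (norm_nonneg _))
      _ = ‖p - q‖ * D ^ k * r ^ k := by rw [mul_pow]; ring
      _ ≤ _ := by
        gcongr
        omega
  rw [div_mul_eq_mul_div, div_le_iff₀ (by positivity)]
  exact le_of_mul_le_mul_right h2 (by positivity)

/-- The zeros `R w`, `w ∈ W`, balance the charges `α_w μ - β_w` up to factors that converge, and
together with `Λ` they form a separated set. The charge `β_w` lives on the finite set `S w`. -/
structure IsBalancing (μ : Measure ℂ) (M δ B : ℝ) (n₀ : ℕ) (Λ W : Set ℂ) (α β : ℂ → ℂ → ℝ)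
    (S R : ℂ → Finset ℂ) (H : ℂ → ℂ → ℂ) : Prop where
  nonempty : ∀ w ∈ W, (R w).Nonempty
  integral_eq : ∀ w ∈ W, ∫ ζ, α w ζ ∂μ = (R w).card + ∑ p ∈ S w, β w p
  dist_le : ∀ w ∈ W, ∀ p ∈ R w, dist p w ≤ B * rad μ M w
  disjoint : ∀ w ∈ W, ∀ p ∈ R w, p ∉ Λ
  pairwiseDisjoint : ∀ w ∈ W, ∀ w' ∈ W, w ≠ w' → Disjoint (R w) (R w')
  separated : SeparatedBy (rad μ M) δ (Λ ∪ ⋃ w ∈ W, (R w : Set ℂ))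
  differentiableOn : ∀ w ∈ W, DifferentiableOn ℂ (H w) {z | B * rad μ M w < dist z w}
  norm_eq : ∀ w ∈ W, ∀ z, B * rad μ M w < dist z w →
    ‖H w z‖ = (∏ p ∈ R w, ‖z - p‖) * potentialFactor μ (α w) (S w) (β w) z
  norm_sub_one_le : ∀ w ∈ W, ∀ z, B * rad μ M w < dist z w →
    ‖H w z - 1‖ ≤ B * (rad μ M w / dist z w) ^ n₀

/-- The zeros are chosen for one net point after another. There are more candidate configurations at
`w` than obstacles nearby (points of `Λ` and zeros chosen before), and the monic polynomials of two
candidates differ by a constant bounded below, so one candidate stays away from all obstacles. -/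
theorem exists_isBalancing {μ : Measure ℂ} {K : ℕ} (h : DoublingWith μ K) {a M A C : ℝ}
    (hM : 0 < M) (hA : 1 ≤ A) {n₀ n₁ : ℕ} (hn₀ : 1 ≤ n₀) {Λ W : Set ℂ} {α β : ℂ → ℂ → ℝ}
    {deg : ℂ → ℕ}
    (D : IsDecomposition μ (Measure.count.restrict Λ) a M A C n₀ n₁ W α β deg)
    {δ₀ : ℝ} (hδ₀ : 0 < δ₀) (hΛ : SeparatedBy (rad μ M) δ₀ Λ) {S : ℂ → Finset ℂ}
    (hS : ∀ w p, p ∈ S w ↔ p ∈ Λ ∧ dist p w ≤ A * rad μ M w) :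
    ∃ δ > 0, ∃ B ≥ 1, ∃ R H, IsBalancing μ M δ B n₀ Λ W α β S R H := by
  classical
  have := h.locallyFinite
  have hρ := h.rad_pos hM
  have hC0 : 0 ≤ C := (abs_nonneg _).trans (D.abs_α_le 0 0)
  obtain ⟨N₁, hN₁⟩ := exists_ncard_le K A hδ₀
  have hN₁ := hN₁ μ h M hM Λ hΛ
  have hScard : ∀ w, (S w).card ≤ N₁ := fun w => by
    have := (hN₁ w).2
    rw [show {p ∈ Λ | dist p w ≤ A * rad μ M w} = (S w : Set ℂ) by ext p; simp [hS],
      ncard_coe_finset] at this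
    exact this
  have hmass : ∀ w ∈ W, ∫ ζ, β w ζ ∂(Measure.count.restrict Λ) = ∑ p ∈ S w, β w p := by
    intro w hw
    have hfin : (Λ ∩ closedBall w (A * rad μ M w)).Finite := (hN₁ w).1
    rw [integral_count_restrict hfin (D.β_eq_zero w hw)]
    refine Finset.sum_congr (Finset.ext fun p => ?_) fun _ _ => rfl
    rw [hS, hfin.mem_toFinset]
    rfl
  obtain ⟨l, hl⟩ := pow_unbounded_of_one_lt A (one_lt_two (α := ℝ))
  have hαint : ∀ w ∈ W, ∫ ζ, |α w ζ| ∂μ ≤ C * (2 ^ (K * l) * M) := by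
    intro w hw
    calc ∫ ζ, |α w ζ| ∂μ ≤ ∫ ζ, (ball w (2 ^ l * rad μ M w)).indicator (fun _ => C) ζ ∂μ := by
          refine integral_mono (integrable_abs_of_support (D.continuous_α w) (D.α_eq_zero w hw))
            ((integrable_indicator_iff measurableSet_ball).2
              (integrableOn_const (h.measure_ball_lt_top _ _).ne)) fun ζ => ?_
          by_cases hζ : ζ ∈ ball w (2 ^ l * rad μ M w)
          · rw [indicator_of_mem hζ]; exact D.abs_α_le w ζ
          · rw [indicator_of_notMem hζ]
            rw [mem_ball, not_lt] at hζ
            rw [D.α_eq_zero w hw ζ (by have := hρ w; nlinarith), abs_zero]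
      _ = μ.real (ball w (2 ^ l * rad μ M w)) * C := by
          rw [integral_indicator_const _ measurableSet_ball, smul_eq_mul]
      _ ≤ _ := by
          have := h.real_pow_le w (hρ w) l
          rw [h.real_ball_rad hM] at this
          rw [mul_comm]; gcongr
  obtain ⟨B, hB1, c, hc, hloc⟩ := exists_localFactor_disc h n₁ (C * (2 ^ (K * l) * M) + N₁)
  have hloc' : ∀ w, ∃ R : ℝ → Finset ℂ, w ∈ W →
      (∀ t t' z, 1 ≤ t → t ≤ 2 → 1 ≤ t' → t' ≤ 2 → |t - t'| * (A * rad μ M w) ^ deg w ≤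
          ‖∏ p ∈ R t, (z - p) - ∏ p ∈ R t', (z - p)‖) ∧
        ∀ t, 1 ≤ t → t ≤ 2 → (R t).card = deg w ∧
          (∀ p ∈ R t, dist p w ≤ B * (A * rad μ M w)) ∧
          (∀ p ∈ R t, ∀ p' ∈ R t, p ≠ p' → c * (A * rad μ M w) ≤ ‖p - p'‖) ∧
          ∃ H : ℂ → ℂ, DifferentiableOn ℂ H {z | 2 * (A * rad μ M w) < dist z w} ∧
            ∀ z, 2 * (A * rad μ M w) < dist z w →
              ‖H z‖ = (∏ p ∈ R t, ‖z - p‖) * potentialFactor μ (α w) (S w) (β w) z ∧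
              ‖H z - 1‖ ≤ B * (2 * (A * rad μ M w) / dist z w) ^ deg w := by
    intro w
    by_cases hw : w ∈ W
    · obtain ⟨R, hR⟩ := hloc w (A * rad μ M w) (by have := hρ w; positivity) (α w) (S w) (β w)
        (deg w) (D.continuous_α w) (D.α_eq_zero w hw) (fun p hp => ((hS w p).1 hp).2)
        (D.β_nonneg w) (hn₀.trans (D.le_deg w hw)) (D.deg_le w hw)
        (by rw [D.integral_eq w hw, hmass w hw]) (by
          refine add_le_add (hαint w hw) ((Finset.sum_le_card_nsmul _ _ 1
            fun p _ => D.β_le_one w p).trans ?_)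
          rw [nsmul_eq_mul, mul_one]; exact_mod_cast hScard w)
      exact ⟨R, fun _ => hR⟩
    · exact ⟨fun _ => ∅, fun hc => absurd hc hw⟩
  choose R₀ hR₀ using hloc'
  -- obstacles for the zeros belonging to `w`
  set B₂ := (B + 1) * A
  have hB₂ : 0 ≤ B₂ := by positivity
  obtain ⟨N₂, hN₂⟩ := exists_ncard_le K B₂ hδ₀
  have hN₂ := hN₂ μ h M hM Λ hΛ
  obtain ⟨C₁, hC₁, hrad₁⟩ := exists_rad_le_mul K (B * A)
  have hrad₁ := hrad₁ μ h M hM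
  set D₁ := B₂ + B * A * (C₁ * (1 + B₂))
  obtain ⟨N₃, hN₃⟩ := exists_ncard_le K D₁ (δ := 1 / 4) (by norm_num)
  have hN₃ := hN₃ μ h M hM W D.isScaleNet.separated
  set N := N₂ + N₃ * n₁
  -- the candidates
  set t : Fin (N + 1) → ℝ := fun j => 1 + j / (N + 1)
  have ht1 : ∀ j, 1 ≤ t j := fun j => by
    have : (0 : ℝ) ≤ (j : ℝ) / (N + 1) := by positivity
    simp only [t]; linarith
  have ht2 : ∀ j, t j ≤ 2 := fun j => by
    have : ((j : ℕ) : ℝ) / (N + 1) ≤ 1 := by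
      rw [div_le_one (by positivity)]
      exact_mod_cast j.2.le
    simp only [t]; linarith
  have htt : ∀ j j', j ≠ j' → 1 / ((N : ℝ) + 1) ≤ |t j - t j'| := fun j j' hne => by
    have h1 : t j - t j' = (((j : ℕ) : ℤ) - ((j' : ℕ) : ℤ) : ℤ) / ((N : ℝ) + 1) := by
      simp only [t]; push_cast; ring
    have h2 : (1 : ℝ) ≤ |((((j : ℕ) : ℤ) - ((j' : ℕ) : ℤ) : ℤ) : ℝ)| := by
      rw [← Int.cast_abs]
      have : (0 : ℤ) < |((j : ℕ) : ℤ) - ((j' : ℕ) : ℤ)| := abs_pos.2 (by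
        rw [sub_ne_zero]; exact_mod_cast fun hc => hne (Fin.ext hc))
      exact_mod_cast this
    rw [h1, abs_div, abs_of_pos (by positivity : (0 : ℝ) < (N : ℝ) + 1)]
    gcongr
  set O : ℂ → (ℂ → Fin (N + 1)) → Finset ℂ := fun w a =>
    (hN₂ w).1.toFinset ∪ (hN₃ w).1.toFinset.biUnion fun w' => R₀ w' (t (a w'))
  have hO : ∀ w a, (O w a).card ≤ N := by
    intro w a
    refine (Finset.card_union_le _ _).trans (add_le_add ?_ ?_)
    · rw [← ncard_eq_toFinset_card _ (hN₂ w).1]; exact (hN₂ w).2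
    · refine (Finset.card_biUnion_le_card_mul _ _ n₁ fun w' hw' => ?_).trans
        (Nat.mul_le_mul_right _ ?_)
      · have hw'W := ((hN₃ w).1.mem_toFinset.1 hw').1
        rw [((hR₀ w' hw'W).2 _ (ht1 _) (ht2 _)).1]
        exact D.deg_le w' hw'W
      · rw [← ncard_eq_toFinset_card _ (hN₃ w).1]; exact (hN₃ w).2
  have hWc : W.Countable := by
    have : W = ⋃ n : ℕ, W ∩ ball 0 n := by
      rw [← inter_iUnion, iUnion_ball_nat, inter_univ]
    rw [this]
    exact countable_iUnion fun n =>
      (D.isScaleNet.separated.finite_inter h hM (by norm_num) isBounded_ball).countable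
  obtain ⟨f, hf⟩ := countable_iff_exists_injOn.1 hWc
  obtain ⟨a, ha⟩ := exists_greedy f (fun w j a => w ∈ W → ∀ p ∈ O w a,
    1 / ((N : ℝ) + 1) / 2 * (A * rad μ M w) ^ deg w ≤ ‖∏ q ∈ R₀ w (t j), (p - q)‖) (by
      intro w a
      by_cases hw : w ∈ W
      · obtain ⟨j, hj⟩ := exists_half_le_norm (N := N)
          (P := fun j p => ∏ q ∈ R₀ w (t j), (p - q))
          (c := 1 / ((N : ℝ) + 1) * (A * rad μ M w) ^ deg w) (fun j j' hne p => by
            refine le_trans ?_ ((hR₀ w hw).1 (t j) (t j') p (ht1 _) (ht2 _) (ht1 _) (ht2 _))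
            have := hρ w
            gcongr
            exact htt j j' hne) (hO w a)
        exact ⟨j, fun _ p hp => by rw [div_mul_eq_mul_div]; exact hj p hp⟩
      · exact ⟨0, fun hc => absurd hc hw⟩)
  set R : ℂ → Finset ℂ := fun w => R₀ w (t (a w))
  have hR := fun w hw => (hR₀ w hw).2 (t (a w)) (ht1 _) (ht2 _)
  have hRd : ∀ w ∈ W, ∀ p ∈ R w, dist p w ≤ B * A * rad μ M w := fun w hw p hp => by
    rw [mul_assoc]; exact (hR w hw).2.1 p hp
  set c₁ := 1 / ((N : ℝ) + 1) / 2 / (2 * B + 1) ^ n₁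
  have hc₁ : 0 < c₁ := by positivity
  -- zeros are far from obstacles
  have hobs : ∀ w ∈ W, ∀ p, dist p w ≤ B₂ * rad μ M w →
      1 / ((N : ℝ) + 1) / 2 * (A * rad μ M w) ^ deg w ≤ ‖∏ q ∈ R w, (p - q)‖ →
      ∀ q ∈ R w, c₁ * (A * rad μ M w) ≤ ‖p - q‖ := by
    intro w hw p hp hle q hq
    have hr : 0 < A * rad μ M w := by have := hρ w; positivity
    refine le_norm_sub_of_le_norm_prod hr (by linarith) (fun q hq => ?_)
      ((hR w hw).1.trans_le (D.deg_le w hw)) (by rwa [(hR w hw).1]) hq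
    have h1 := (hR w hw).2.1 q hq
    have h2 := dist_triangle p w q
    rw [dist_comm w q] at h2
    rw [← dist_eq_norm]
    simp only [B₂] at hp
    linarith
  have hfar : ∀ w ∈ W, ∀ p, B₂ * rad μ M w < dist p w → ∀ q ∈ R w, A * rad μ M w ≤ ‖p - q‖ := by
    intro w hw p hp q hq
    have h1 := hRd w hw q hq
    have h2 := dist_triangle p q w
    rw [← dist_eq_norm]
    simp only [B₂] at hp
    linarith
  have hc₁1 : c₁ ≤ 1 := by
    have h1 : 1 / ((N : ℝ) + 1) ≤ 1 := by
      rw [div_le_one (by positivity)]; linarith [(Nat.cast_nonneg N : (0 : ℝ) ≤ N)]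
    refine div_le_one_of_le₀ ?_ (by positivity)
    have : (1 : ℝ) ≤ (2 * B + 1) ^ n₁ := one_le_pow₀ (by linarith)
    linarith
  have hΛR : ∀ w ∈ W, ∀ p ∈ Λ, ∀ q ∈ R w, c₁ * (A * rad μ M w) ≤ ‖p - q‖ := by
    intro w hw p hp q hq
    have hr : 0 < A * rad μ M w := by have := hρ w; positivity
    rcases le_or_gt (dist p w) (B₂ * rad μ M w) with h1 | h1
    · obtain ⟨a', -, ha'⟩ := ha w
      exact hobs w hw p h1 (ha' hw p (Finset.mem_union_left _ ((hN₂ w).1.mem_toFinset.2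
        ⟨hp, h1⟩))) q hq
    · exact (mul_le_of_le_one_left hr.le hc₁1).trans (hfar w hw p h1 q hq)
  have hRR : ∀ w ∈ W, ∀ w' ∈ W, f w' < f w → ∀ q ∈ R w, ∀ p ∈ R w',
      c₁ * (A * rad μ M w) ≤ ‖p - q‖ := by
    intro w hw w' hw' hlt q hq p hp
    have hr : 0 < A * rad μ M w := by have := hρ w; positivity
    rcases le_or_gt (dist p w) (B₂ * rad μ M w) with h1 | h1
    · obtain ⟨a', ha1, ha'⟩ := ha w
      refine hobs w hw p h1 (ha' hw p (Finset.mem_union_right _ (Finset.mem_biUnion.2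
        ⟨w', (hN₃ w).1.mem_toFinset.2 ⟨hw', ?_⟩, by rw [ha1 w' hlt]; exact hp⟩))) q hq
      have h2 := hRd w' hw' p hp
      have h3 := hrad₁ w' p h2
      have h4 := h.rad_le_add_dist hM p w
      have h5 := dist_triangle w' p w
      rw [dist_comm w' p] at h5
      have h6 : rad μ M w' ≤ C₁ * (1 + B₂) * rad μ M w := by
        calc rad μ M w' ≤ C₁ * rad μ M p := h3
          _ ≤ C₁ * ((1 + B₂) * rad μ M w) := by gcongr; linarith
          _ = _ := by ring
      calc dist w' w ≤ B * A * rad μ M w' + B₂ * rad μ M w := by linarith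
        _ ≤ B * A * (C₁ * (1 + B₂) * rad μ M w) + B₂ * rad μ M w := by gcongr
        _ = D₁ * rad μ M w := by simp only [D₁]; ring
    · exact (mul_le_of_le_one_left hr.le hc₁1).trans (hfar w hw p h1 q hq)
  -- distances measured by the scale at the centre `w` control the scale at both points
  set c₂ := min c₁ c * A
  have hc₂ : 0 < c₂ := by positivity
  set δ := min δ₀ (1 / ((1 + B * A) / c₂ + 1))
  have hδ : 0 < δ := by positivity
  have hconv : ∀ w ∈ W, ∀ q ∈ R w, ∀ p, c₂ * rad μ M w ≤ ‖p - q‖ →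
      δ * max (rad μ M p) (rad μ M q) ≤ ‖p - q‖ := by
    intro w hw q hq p hle
    have h1 := h.rad_le_add_dist hM q w
    have h2 := hRd w hw q hq
    have h3 := h.rad_le_add_dist hM p q
    rw [dist_eq_norm p q] at h3
    have h4 : rad μ M w ≤ ‖p - q‖ / c₂ := by rw [le_div_iff₀ hc₂]; linarith
    have h5 : rad μ M q ≤ (1 + B * A) / c₂ * ‖p - q‖ := by
      calc rad μ M q ≤ (1 + B * A) * rad μ M w := by linarith
        _ ≤ (1 + B * A) * (‖p - q‖ / c₂) := by gcongr
        _ = _ := by ring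
    have h6 : max (rad μ M p) (rad μ M q) ≤ ((1 + B * A) / c₂ + 1) * ‖p - q‖ := by
      have := norm_nonneg (p - q)
      refine max_le ?_ ?_ <;> linarith
    calc δ * max (rad μ M p) (rad μ M q)
        ≤ 1 / ((1 + B * A) / c₂ + 1) * (((1 + B * A) / c₂ + 1) * ‖p - q‖) := by
          gcongr
          · exact le_max_of_le_left (hρ p).le
          · exact min_le_right _ _
      _ = ‖p - q‖ := by field_simp
  have hc₂₁ : ∀ w, c₂ * rad μ M w ≤ c₁ * (A * rad μ M w) := fun w => by
    have := hρ w
    simp only [c₂]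
    rw [mul_assoc]
    gcongr
    exact min_le_left _ _
  have hc₂c : ∀ w, c₂ * rad μ M w ≤ c * (A * rad μ M w) := fun w => by
    have := hρ w
    simp only [c₂]
    rw [mul_assoc]
    gcongr
    exact min_le_right _ _
  have hpos : ∀ w, 0 < c₁ * (A * rad μ M w) := fun w => by have := hρ w; positivity
  have hHex : ∀ w, ∃ H : ℂ → ℂ, w ∈ W → DifferentiableOn ℂ H {z | 2 * (A * rad μ M w) < dist z w} ∧
      ∀ z, 2 * (A * rad μ M w) < dist z w →
        ‖H z‖ = (∏ p ∈ R w, ‖z - p‖) * potentialFactor μ (α w) (S w) (β w) z ∧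
        ‖H z - 1‖ ≤ B * (2 * (A * rad μ M w) / dist z w) ^ deg w := fun w => by
    by_cases hw : w ∈ W
    · obtain ⟨H, hH⟩ := (hR w hw).2.2.2
      exact ⟨H, fun _ => hH⟩
    · exact ⟨0, fun hc => absurd hc hw⟩
  choose H hH using hHex
  set B₃ := B * (2 * A) ^ n₀ + 2 * A + B * A
  have hB₃A : ∀ w z, B₃ * rad μ M w < dist z w → 2 * (A * rad μ M w) < dist z w := fun w z hz => by
    refine lt_of_le_of_lt ?_ hz
    have := hρ w
    rw [← mul_assoc]
    gcongr
    have h1 : 0 ≤ B * (2 * A) ^ n₀ := by positivity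
    have h2 : 0 ≤ B * A := by positivity
    simp only [B₃]; linarith
  refine ⟨δ, hδ, B₃, ?_, R, H, ⟨fun w hw => ?_, fun w hw => ?_, fun w hw p hp => ?_,
    fun w hw p hp hpΛ => ?_, fun w hw w' hw' hne => ?_, ?_, fun w hw => ?_, fun w hw z hz => ?_,
    fun w hw z hz => ?_⟩⟩
  · have h1 : 0 ≤ B * (2 * A) ^ n₀ := by positivity
    have h2 : 0 ≤ B * A := by positivity
    simp only [B₃]; linarith
  · rw [← Finset.card_pos, (hR w hw).1]
    exact hn₀.trans (D.le_deg w hw)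
  · rw [(hR w hw).1, D.integral_eq w hw, hmass w hw]
  · refine (hRd w hw p hp).trans ?_
    have := hρ w
    gcongr
    have h1 : 0 ≤ B * (2 * A) ^ n₀ := by positivity
    simp only [B₃]; linarith
  · have := hΛR w hw p hpΛ p hp
    rw [sub_self, norm_zero] at this
    linarith [hpos w]
  · rw [Finset.disjoint_left]
    intro p hp hp'
    rcases lt_trichotomy (f w) (f w') with hlt | heq | hlt
    · have := hRR w' hw' w hw hlt p hp' p hp
      rw [sub_self, norm_zero] at this
      linarith [hpos w']
    · exact hne (hf hw hw' heq)
    · have := hRR w hw w' hw' hlt p hp p hp'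
      rw [sub_self, norm_zero] at this
      linarith [hpos w]
  · have hmem : ∀ p, p ∈ ⋃ w ∈ W, (R w : Set ℂ) → ∃ w ∈ W, p ∈ R w := fun p hp => by
      simpa using hp
    have hswap : ∀ p q, δ * max (rad μ M p) (rad μ M q) ≤ ‖p - q‖ →
        δ * max (rad μ M q) (rad μ M p) ≤ ‖q - p‖ := fun p q hpq => by
      rwa [max_comm, norm_sub_rev]
    rintro p (hp | hp) q (hq | hq) hne
    · refine le_trans ?_ (hΛ p hp q hq hne)
      have := hρ p
      gcongr
      exact min_le_left _ _
    · obtain ⟨w, hw, hq⟩ := hmem q hq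
      exact hconv w hw q hq p ((hc₂₁ w).trans (hΛR w hw p hp q hq))
    · obtain ⟨w, hw, hp⟩ := hmem p hp
      exact hswap _ _ (hconv w hw p hp q ((hc₂₁ w).trans (hΛR w hw q hq p hp)))
    · obtain ⟨w, hw, hp⟩ := hmem p hp
      obtain ⟨w', hw', hq⟩ := hmem q hq
      rcases lt_trichotomy (f w) (f w') with hlt | heq | hlt
      · exact hconv w' hw' q hq p ((hc₂₁ w').trans (hRR w' hw' w hw hlt q hq p hp))
      · obtain rfl := hf hw hw' heq
        exact hconv w hw q hq p ((hc₂c w).trans ((hR w hw).2.2.1 p hp q hq hne))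
      · exact hswap _ _ (hconv w hw p hp q ((hc₂₁ w).trans (hRR w hw w' hw' hlt p hp q hq)))
  · exact (hH w hw).1.mono fun z hz => hB₃A w z hz
  · exact ((hH w hw).2 z (hB₃A w z hz)).1
  · refine ((hH w hw).2 z (hB₃A w z hz)).2.trans ?_
    have hz' := hB₃A w z hz
    have hr := hρ w
    have hr' : 0 < 2 * (A * rad μ M w) := by positivity
    have hx1 : 2 * (A * rad μ M w) / dist z w ≤ 1 := (div_le_one (hr'.trans hz')).2 hz'.le
    calc B * (2 * (A * rad μ M w) / dist z w) ^ deg w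
        ≤ B * (2 * (A * rad μ M w) / dist z w) ^ n₀ := by
          gcongr ?_ * ?_
          exact pow_le_pow_of_le_one (div_nonneg hr'.le dist_nonneg) hx1 (D.le_deg w hw)
      _ = B * (2 * A) ^ n₀ * (rad μ M w / dist z w) ^ n₀ := by
          rw [mul_assoc, ← mul_pow]; congr 2; ring
      _ ≤ B₃ * (rad μ M w / dist z w) ^ n₀ := by
          gcongr
          have h2 : 0 ≤ B * A := by positivity
          simp only [B₃]; linarith

/-! ### Entire functions of prescribed modulus -/

/-- Two holomorphic functions of equal modulus on a disc, equal and nonzero at one point, agree. -/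
theorem eqOn_ball_of_norm_eq {R : ℝ} {f g : ℂ → ℂ} (hf : DifferentiableOn ℂ f (ball 0 R))
    (hg : DifferentiableOn ℂ g (ball 0 R)) (hfg : ∀ z ∈ ball (0 : ℂ) R, ‖f z‖ = ‖g z‖) {z₀ : ℂ}
    (hz₀ : z₀ ∈ ball (0 : ℂ) R) (h0 : f z₀ = g z₀) (hne : g z₀ ≠ 0) : EqOn f g (ball 0 R) := by
  have hnhds : ∀ z ∈ ball (0 : ℂ) R, ball (0 : ℂ) R ∈ 𝓝 z := fun z hz => isOpen_ball.mem_nhds hz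
  have hgne : ∀ᶠ z in 𝓝 z₀, g z ≠ 0 :=
    (hg.continuousOn.continuousAt (hnhds z₀ hz₀)).eventually_ne hne
  have hball : ∀ᶠ z in 𝓝 z₀, z ∈ ball (0 : ℂ) R := hnhds z₀ hz₀
  have hone : ∀ᶠ z in 𝓝 z₀, ‖(f / g) z‖ = 1 := by
    filter_upwards [hgne, hball] with z hz hzb
    rw [Pi.div_apply, norm_div, hfg z hzb, div_self (norm_ne_zero_iff.2 hz)]
  have hmax : IsLocalMax (norm ∘ (f / g)) z₀ := by
    filter_upwards [hone] with z hz
    rw [Function.comp_apply, Function.comp_apply, hz, hone.self_of_nhds]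
  have hdiff : ∀ᶠ z in 𝓝 z₀, DifferentiableAt ℂ (f / g) z := by
    filter_upwards [hgne, hball] with z hz hzb
    exact (hf.differentiableAt (hnhds z hzb)).div (hg.differentiableAt (hnhds z hzb)) hz
  have heq := Complex.eventually_eq_of_isLocalMax_norm hdiff hmax
  have hev : f =ᶠ[𝓝 z₀] g := by
    filter_upwards [heq, hgne] with z hz hzne
    rw [Pi.div_apply, Pi.div_apply, h0, div_self hne, div_eq_one_iff_eq hzne] at hz
    exact hz
  exact (hf.analyticOnNhd isOpen_ball).eqOn_of_preconnected_of_eventuallyEq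
    (hg.analyticOnNhd isOpen_ball) (convex_ball 0 R).isPreconnected hz₀ hev

/-- A function that is on every disc the modulus of a holomorphic function is the modulus of an
entire function. -/
theorem exists_differentiable_norm_eq {U : ℂ → ℝ}
    (hU : ∀ N : ℕ, ∃ g : ℂ → ℂ, DifferentiableOn ℂ g (ball 0 N) ∧
      ∀ z ∈ ball (0 : ℂ) N, ‖g z‖ = U z) :
    ∃ g : ℂ → ℂ, Differentiable ℂ g ∧ ∀ z, ‖g z‖ = U z := by
  by_cases hne : ∀ z, U z = 0
  · exact ⟨0, differentiable_const 0, fun z => by simp [hne z]⟩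
  push Not at hne
  obtain ⟨z₀, hz₀⟩ := hne
  obtain ⟨m, hm⟩ := exists_nat_gt ‖z₀‖
  -- normalize at `z₀` so that the local functions agree
  have hU' : ∀ N : ℕ, ∃ g : ℂ → ℂ, DifferentiableOn ℂ g (ball 0 (m + N : ℕ)) ∧
      (∀ z ∈ ball (0 : ℂ) (m + N : ℕ), ‖g z‖ = U z) ∧ g z₀ = U z₀ := by
    intro N
    obtain ⟨g, hg, hgU⟩ := hU (m + N)
    have hmem : z₀ ∈ ball (0 : ℂ) (m + N : ℕ) := by
      rw [mem_ball, dist_zero_right]; push_cast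
      linarith [(Nat.cast_nonneg N : (0 : ℝ) ≤ N)]
    have hn := hgU z₀ hmem
    have hg0 : g z₀ ≠ 0 := fun hc => hz₀ (by rw [← hn, hc, norm_zero])
    refine ⟨fun z => (‖g z₀‖ / g z₀) * g z, hg.const_mul _, fun z hz => ?_, ?_⟩
    · rw [norm_mul, norm_div, Complex.norm_real, norm_norm, div_self (norm_ne_zero_iff.2 hg0),
        one_mul, hgU z hz]
    · simp only [div_mul_cancel₀ _ hg0, hn]
  choose g hg hgU hgz using hU'
  have hmem : ∀ N : ℕ, z₀ ∈ ball (0 : ℂ) (m + N : ℕ) := fun N => by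
    rw [mem_ball, dist_zero_right]; push_cast
    linarith [(Nat.cast_nonneg N : (0 : ℝ) ≤ N)]
  have hagree : ∀ N N', N ≤ N' → EqOn (g N') (g N) (ball 0 (m + N : ℕ)) := fun N N' hNN => by
    have hsub : ball (0 : ℂ) (m + N : ℕ) ⊆ ball 0 (m + N' : ℕ) :=
      ball_subset_ball (by exact_mod_cast Nat.add_le_add_left hNN m)
    refine eqOn_ball_of_norm_eq ((hg N').mono hsub) (hg N) (fun z hz => ?_) (hmem N) ?_ ?_
    · rw [hgU N' z (hsub hz), hgU N z hz]
    · rw [hgz, hgz]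
    · rw [hgz]; exact_mod_cast hz₀
  set G : ℂ → ℂ := fun z => g ⌈‖z‖ + 1⌉₊ z
  have hGmem : ∀ z : ℂ, z ∈ ball (0 : ℂ) (m + ⌈‖z‖ + 1⌉₊ : ℕ) := fun z => by
    rw [mem_ball, dist_zero_right]; push_cast
    linarith [Nat.le_ceil (‖z‖ + 1), (Nat.cast_nonneg m : (0 : ℝ) ≤ m)]
  have hGeq : ∀ N, EqOn G (g N) (ball 0 (m + N : ℕ)) := fun N z hz => by
    rcases le_total N ⌈‖z‖ + 1⌉₊ with h1 | h1
    · exact hagree _ _ h1 hz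
    · exact (hagree _ _ h1 (hGmem z)).symm
  refine ⟨G, fun z => ?_, fun z => hgU _ z (hGmem z)⟩
  have hn := isOpen_ball.mem_nhds (hGmem z)
  refine ((hg ⌈‖z‖ + 1⌉₊).differentiableAt hn).congr_of_eventuallyEq ?_
  filter_upwards [hn] with x hx using hGeq _ hx

/-! ### The product of the local factors -/

/-- The factor `∏ |z - p| · ∏ |z - λ| ^ β_w(λ) · exp (-∫ α_w(ζ) log |z - ζ| dμ(ζ))` at `w`. -/
def localFactor (μ : Measure ℂ) (α β : ℂ → ℂ → ℝ) (S R : ℂ → Finset ℂ) (w z : ℂ) : ℝ :=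
  (∏ p ∈ R w, ‖z - p‖) * potentialFactor μ (α w) (S w) (β w) z

open Classical in
/-- The product of the local factors over the net `W`. -/
def factorProduct (μ : Measure ℂ) (W : Set ℂ) (α β : ℂ → ℂ → ℝ) (S R : ℂ → Finset ℂ) (z : ℂ) : ℝ :=
  ∏' w, if w ∈ W then localFactor μ α β S R w z else 1

open Classical in
/-- The sum of the logarithms of the factors outside `F`. -/
def tailLog (W : Set ℂ) (H : ℂ → ℂ → ℂ) (F : Finset ℂ) (z w : ℂ) : ℂ :=
  if w ∈ W ∧ w ∉ F then Complex.log (H w z) else 0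

section Product

variable {μ : Measure ℂ} {K : ℕ} {M δ B : ℝ} {n₀ : ℕ} {Λ W : Set ℂ} {α β : ℂ → ℂ → ℝ}
  {S R : ℂ → Finset ℂ} {H : ℂ → ℂ → ℂ}

theorem IsBalancing.norm_sub_one_le_half (hb : IsBalancing μ M δ B n₀ Λ W α β S R H)
    (h : DoublingWith μ K) (hM : 0 < M) (hB : 1 ≤ B) (hn₀ : 1 ≤ n₀) {w z : ℂ} (hw : w ∈ W)
    (hz : 2 * B * rad μ M w < dist z w) : ‖H w z - 1‖ ≤ 1 / 2 := by
  have hρ := h.rad_pos hM w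
  have hz' : B * rad μ M w < dist z w := by nlinarith
  have hd : 0 < dist z w := by nlinarith
  refine (hb.norm_sub_one_le w hw z hz').trans ?_
  have h1 : rad μ M w / dist z w ≤ 1 / (2 * B) := by
    rw [div_le_div_iff₀ hd (by linarith)]; linarith
  have h2 : (1 : ℝ) / (2 * B) ≤ 1 := by rw [div_le_one (by linarith)]; linarith
  calc B * (rad μ M w / dist z w) ^ n₀ ≤ B * (rad μ M w / dist z w) := by
        gcongr
        exact pow_le_of_le_one (by positivity) (h1.trans h2) (by omega)
    _ ≤ B * (1 / (2 * B)) := by gcongr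
    _ = 1 / 2 := by field_simp

theorem IsBalancing.norm_log_le (hb : IsBalancing μ M δ B n₀ Λ W α β S R H)
    (h : DoublingWith μ K) (hM : 0 < M) (hB : 1 ≤ B) (hn₀ : 1 ≤ n₀) {w z : ℂ} (hw : w ∈ W)
    (hz : 2 * B * rad μ M w < dist z w) :
    ‖Complex.log (H w z)‖ ≤ 3 / 2 * B * (rad μ M w / dist z w) ^ n₀ := by
  have hz' : B * rad μ M w < dist z w := by nlinarith [h.rad_pos hM w]
  have h1 := Complex.norm_log_one_add_half_le_self
    (hb.norm_sub_one_le_half h hM hB hn₀ hw hz)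
  rw [add_sub_cancel] at h1
  refine h1.trans ?_
  rw [mul_assoc]
  gcongr
  exact hb.norm_sub_one_le w hw z hz'

theorem IsBalancing.exp_re_log (hb : IsBalancing μ M δ B n₀ Λ W α β S R H)
    (h : DoublingWith μ K) (hM : 0 < M) (hB : 1 ≤ B) (hn₀ : 1 ≤ n₀) {w z : ℂ} (hw : w ∈ W)
    (hz : 2 * B * rad μ M w < dist z w) :
    Real.exp (Complex.log (H w z)).re = localFactor μ α β S R w z := by
  have hz' : B * rad μ M w < dist z w := by nlinarith [h.rad_pos hM w]
  have h1 := hb.norm_sub_one_le_half h hM hB hn₀ hw hz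
  have hne : H w z ≠ 0 := fun hc => by
    rw [hc, zero_sub, norm_neg, norm_one] at h1; linarith
  rw [← Complex.norm_exp, Complex.exp_log hne, hb.norm_eq w hw z hz', localFactor]

/-- The factors outside the discs `D(w, 2 B ρ(w))` have absolutely summable logarithms. -/
theorem IsBalancing.exists_factorProduct_eq (K : ℕ) {B : ℝ} (hB : 1 ≤ B) (hn₀ : 1 ≤ n₀)
    (hKn : 2 * K ≤ n₀) :
    ∃ C, ∀ μ : Measure ℂ, DoublingWith μ K → ∀ M : ℝ, 0 < M → ∀ (δ : ℝ) (Λ W : Set ℂ)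
      (α β : ℂ → ℂ → ℝ) (S R : ℂ → Finset ℂ) (H : ℂ → ℂ → ℂ),
      IsBalancing μ M δ B n₀ Λ W α β S R H → SeparatedBy (rad μ M) (1 / 4) W →
      ∀ (z : ℂ) (F : Finset ℂ), (F : Set ℂ) ⊆ W →
      (∀ w ∈ W, w ∉ F → 2 * B * rad μ M w < dist z w) →
        (∀ u : Finset ℂ, ∑ w ∈ u, ‖tailLog W H F z w‖ ≤ C) ∧
        ‖∑' w, tailLog W H F z w‖ ≤ C ∧ factorProduct μ W α β S R z =
          (∏ w ∈ F, localFactor μ α β S R w z) * Real.exp (∑' w, tailLog W H F z w).re := by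
  classical
  obtain ⟨C, hC0, hC⟩ := exists_sum_pow_le K
  refine ⟨3 / 2 * B * C, fun μ h M hM δ Λ W α β S R H hb hW z F hF hfar => ?_⟩
  have hsum : ∀ u : Finset ℂ, ∑ w ∈ u, ‖tailLog W H F z w‖ ≤ 3 / 2 * B * C := by
    intro u
    set v := u.filter fun w => w ∈ W ∧ w ∉ F
    have hv : ∀ w ∈ v, w ∈ W ∧ w ∉ F := fun w hw => (Finset.mem_filter.1 hw).2
    calc ∑ w ∈ u, ‖tailLog W H F z w‖ = ∑ w ∈ v, ‖tailLog W H F z w‖ := by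
          refine (Finset.sum_subset (Finset.filter_subset _ _) fun w hw hwv => ?_).symm
          have : ¬(w ∈ W ∧ w ∉ F) := fun hc => hwv (Finset.mem_filter.2 ⟨hw, hc⟩)
          rw [tailLog, if_neg this, norm_zero]
      _ ≤ ∑ w ∈ v, 3 / 2 * B * (rad μ M w / dist z w) ^ n₀ := by
          refine Finset.sum_le_sum fun w hw => ?_
          rw [tailLog, if_pos (hv w hw)]
          exact hb.norm_log_le h hM hB hn₀ (hv w hw).1 (hfar w (hv w hw).1 (hv w hw).2)
      _ = 3 / 2 * B * ∑ w ∈ v, (rad μ M w / dist z w) ^ n₀ := by rw [Finset.mul_sum]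
      _ ≤ _ := by
          gcongr
          refine hC μ h M hM v (fun x hx y hy => hW x (hv x hx).1 y (hv y hy).1) z
            (fun w hw => ?_) n₀ hKn
          have h1 := hfar w (hv w hw).1 (hv w hw).2
          nlinarith [h.rad_pos hM w]
  have hs : Summable fun w => ‖tailLog W H F z w‖ :=
    summable_of_sum_le (fun w => norm_nonneg _) hsum
  have hs' : Summable fun w => tailLog W H F z w := hs.of_norm
  refine ⟨hsum, (norm_tsum_le_tsum_norm hs).trans (hs.tsum_le_of_sum_le hsum), ?_⟩
  have h1 := (Complex.hasSum_re hs'.hasSum).rexp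
  have h2 : HasProd (fun w => if w ∈ F then localFactor μ α β S R w z else 1)
      (∏ w ∈ F, localFactor μ α β S R w z) := by
    have h3 := hasProd_prod_of_ne_finset_one
      (f := fun w => if w ∈ F then localFactor μ α β S R w z else 1) (s := F)
      (fun w hw => if_neg hw) (L := SummationFilter.unconditional ℂ)
    rwa [Finset.prod_congr rfl fun w hw => if_pos hw] at h3
  rw [factorProduct, ← (h2.mul h1).tprod_eq]
  refine tprod_congr fun w => ?_
  simp only [Function.comp_apply]
  by_cases hwF : w ∈ F
  · rw [if_pos (hF hwF), if_pos hwF, tailLog, if_neg (fun hc => hc.2 hwF)]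
    simp
  · by_cases hwW : w ∈ W
    · rw [if_pos hwW, if_neg hwF, tailLog, if_pos ⟨hwW, hwF⟩, one_mul,
        hb.exp_re_log h hM hB hn₀ hwW (hfar w hwW hwF)]
    · rw [if_neg hwW, if_neg hwF, tailLog, if_neg (fun hc => hwW hc.1)]
      simp

end Product

/-! ### Holomorphy of the product -/

/-- A power `|z - p| ^ b` is the modulus of a holomorphic function on a disc that does not contain
`p`. -/
theorem exists_norm_eq_rpow {N b : ℝ} {p : ℂ} (hb : p ∈ ball (0 : ℂ) N → b = 1) :
    ∃ g : ℂ → ℂ, DifferentiableOn ℂ g (ball 0 N) ∧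
      ∀ z ∈ ball (0 : ℂ) N, ‖g z‖ = ‖z - p‖ ^ b := by
  by_cases hp : p ∈ ball (0 : ℂ) N
  · refine ⟨fun z => z - p, by fun_prop, fun z _ => ?_⟩
    rw [hb hp, Real.rpow_one]
  · have hpN : N ≤ ‖p‖ := by simpa using hp
    rcases le_or_gt N 0 with hN | hN
    · refine ⟨0, differentiableOn_const 0, fun z hz => ?_⟩
      rw [ball_eq_empty.2 hN] at hz
      exact absurd hz (notMem_empty z)
    have hp0 : p ≠ 0 := fun hc => by rw [hc, norm_zero] at hpN; linarith
    have hlt : ∀ z ∈ ball (0 : ℂ) N, ‖-(z / p)‖ < 1 := fun z hz => by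
      rw [norm_neg, norm_div, div_lt_one (by linarith)]
      rw [mem_ball, dist_zero_right] at hz
      linarith
    have hslit : ∀ z ∈ ball (0 : ℂ) N, 1 + -(z / p) ∈ Complex.slitPlane := fun z hz =>
      Complex.mem_slitPlane_of_norm_lt_one (hlt z hz)
    refine ⟨fun z => Complex.exp (b * (Real.log ‖p‖ + Complex.log (1 + -(z / p)))), ?_,
      fun z hz => ?_⟩
    · refine DifferentiableOn.cexp (DifferentiableOn.const_mul ?_ _)
      refine DifferentiableOn.const_add _ (DifferentiableOn.clog ?_ hslit)
      fun_prop
    · have h1 : 1 + -(z / p) = (p - z) / p := by field_simp; ring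
      have hzp : z - p ≠ 0 := fun hc => by
        have : 1 + -(z / p) = 0 := by rw [h1, ← neg_sub, hc]; simp
        exact Complex.slitPlane_ne_zero (hslit z hz) this
      rw [Complex.norm_exp, Complex.re_ofReal_mul, Complex.add_re, Complex.ofReal_re,
        Complex.log_re, h1, norm_div, norm_sub_rev p z,
        Real.log_div (norm_ne_zero_iff.2 hzp) (norm_ne_zero_iff.2 hp0),
        Real.rpow_def_of_pos (norm_pos_iff.2 hzp)]
      congr 1
      ring

theorem hasCompactSupport_of_support {α : ℂ → ℝ} {w : ℂ} {r : ℝ}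
    (hα : ∀ ζ, r < dist ζ w → α ζ = 0) : HasCompactSupport α :=
  HasCompactSupport.intro (isCompact_closedBall w r)
    fun ζ hζ => by rw [mem_closedBall, not_le] at hζ; exact hα ζ hζ

section Entire

variable {μ : Measure ℂ} {K : ℕ} {a c M A C δ B : ℝ} {n₀ n₁ : ℕ} {Λ W : Set ℂ}
  {α β : ℂ → ℂ → ℝ} {deg : ℂ → ℕ} {S R : ℂ → Finset ℂ} {H : ℂ → ℂ → ℂ} {n : Measure ℂ}

theorem logPotential_sum (h : DoublingWith μ K) (D : IsDecomposition μ n a M A C n₀ n₁ W α β deg)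
    {F : Finset ℂ} (hF : (F : Set ℂ) ⊆ W) (b : ℝ) (z : ℂ) :
    logPotential μ (fun ζ => b * ∑ w ∈ F, α w ζ) z = b * ∑ w ∈ F, logPotential μ (α w) z := by
  simp only [logPotential]
  rw [← integral_finsetSum F fun w hw => h.integrable_mul_log (D.continuous_α w)
    (hasCompactSupport_of_support (D.α_eq_zero w (hF hw))) z, ← integral_const_mul]
  refine integral_congr_ae (Eventually.of_forall fun ζ => ?_)
  simp only
  rw [mul_assoc, Finset.sum_mul]

open Classical in
/-- Over finitely many pieces, the powers of the same base are collected. -/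
theorem prod_prod_rpow (D : IsDecomposition μ n a M A C n₀ n₁ W α β deg)
    (hS : ∀ w p, p ∈ S w ↔ p ∈ Λ ∧ dist p w ≤ A * rad μ M w)
    {F : Finset ℂ} (hF : (F : Set ℂ) ⊆ W) {x : ℂ → ℝ} (hx : ∀ p, 0 ≤ x p) :
    ∏ w ∈ F, ∏ p ∈ S w, x p ^ β w p = ∏ p ∈ F.biUnion S, x p ^ ∑ w ∈ F, β w p := by
  simp_rw [fun p => Real.rpow_sum_of_nonneg (hx p) (s := F) (f := fun w => β w p)
    fun w _ => D.β_nonneg w p]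
  rw [Finset.prod_comm]
  refine Finset.prod_congr rfl fun w hw => ?_
  refine Finset.prod_subset (Finset.subset_biUnion_of_mem S hw) fun p hp hpS => ?_
  obtain ⟨w', hw', hp'⟩ := Finset.mem_biUnion.1 hp
  rw [D.β_eq_zero w (hF hw) p (not_le.1 fun hc => hpS ((hS w p).2 ⟨((hS w' p).1 hp').1, hc⟩)),
    Real.rpow_zero]

open Classical in
theorem prod_localFactor (D : IsDecomposition μ n a M A C n₀ n₁ W α β deg)
    (hS : ∀ w p, p ∈ S w ↔ p ∈ Λ ∧ dist p w ≤ A * rad μ M w)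
    {F : Finset ℂ} (hF : (F : Set ℂ) ⊆ W) (z : ℂ) :
    ∏ w ∈ F, localFactor μ α β S R w z = (∏ w ∈ F, ∏ p ∈ R w, ‖z - p‖) *
      (∏ p ∈ F.biUnion S, ‖z - p‖ ^ ∑ w ∈ F, β w p) *
      Real.exp (-∑ w ∈ F, logPotential μ (α w) z) := by
  simp only [localFactor, potentialFactor]
  rw [Finset.prod_mul_distrib, Finset.prod_mul_distrib, ← Real.exp_sum, Finset.sum_neg_distrib,
    ← mul_assoc, prod_prod_rpow D hS hF fun p => norm_nonneg (z - p)]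

/-- The weight `e ^ {c φ}` times the product of the local factors is the modulus of an entire
function: on each disc the Riesz decomposition turns `c φ` and the finitely many potentials that
matter into the real part of a holomorphic function. -/
theorem exists_differentiable_norm_eq_factorProduct {φ : ℂ → ℝ} (hφ : IsSubharmonic φ)
    (h : DoublingWith μ K) (hL : IsDistributionalLaplacian φ μ) (hM : 0 < M) (hc : 0 < c)
    (D : IsDecomposition μ n (c / (2 * Real.pi)) M A C n₀ n₁ W α β deg)
    (hS : ∀ w p, p ∈ S w ↔ p ∈ Λ ∧ dist p w ≤ A * rad μ M w)
    (hb : IsBalancing μ M δ B n₀ Λ W α β S R H) (hB : 1 ≤ B) (hn₀ : 1 ≤ n₀)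
    (hKn : 2 * K ≤ n₀) :
    ∃ g : ℂ → ℂ, Differentiable ℂ g ∧
      ∀ z, ‖g z‖ = Real.exp (c * φ z) * factorProduct μ W α β S R z := by
  classical
  have hρ := h.rad_pos hM
  refine exists_differentiable_norm_eq fun N => ?_
  obtain ⟨l, hl⟩ := pow_unbounded_of_one_lt (2 * B + A) (one_lt_two (α := ℝ))
  obtain ⟨s, hs⟩ := h.exists_add_rad_le (M₁ := 2 ^ (K * l) * M + 1) (by positivity) N
  have hsc := h.pow_mul_rad_le hM (M' := 2 ^ (K * l) * M + 1) l (by linarith)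
  set T := max s (2 * N + 1)
  have hfin := D.isScaleNet.separated.finite_inter h hM (by norm_num)
    (isBounded_ball (x := (0 : ℂ)) (r := T))
  set F := hfin.toFinset
  have hFmem : ∀ w, w ∈ F ↔ w ∈ W ∧ ‖w‖ < T := fun w => by
    rw [hfin.mem_toFinset, mem_inter_iff, mem_ball, dist_zero_right]
  have hFW : (F : Set ℂ) ⊆ W := fun w hw => ((hFmem w).1 hw).1
  have hout : ∀ w ∈ W, w ∉ F → T ≤ ‖w‖ := fun w hw hwF => by
    by_contra hcon
    exact hwF ((hFmem w).2 ⟨hw, not_le.1 hcon⟩)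
  have hfar : ∀ w ∈ W, w ∉ F → N + (2 * B + A) * rad μ M w ≤ ‖w‖ := fun w hw hwF => by
    have h1 := hs w ((le_max_left _ _).trans (hout w hw hwF))
    have h2 := hsc w
    have h3 : (2 * B + A) * rad μ M w ≤ 2 ^ l * rad μ M w := by
      have := hρ w; gcongr
    linarith
  have hdist : ∀ z ∈ ball (0 : ℂ) N, ∀ w ∈ W, w ∉ F → (2 * B + A) * rad μ M w < dist z w := by
    intro z hz w hw hwF
    rw [mem_ball, dist_zero_right] at hz
    have h1 := hfar w hw hwF
    have h2 := norm_sub_norm_le w z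
    rw [dist_comm, dist_eq_norm]
    linarith
  by_cases hA : A < 0
  · -- the partition of `a > 0` would be empty
    exfalso
    have h1 := D.sum_α 0 ∅ (by simp) fun w _ hd => absurd hd (not_le.2 (by
      have := hρ w
      nlinarith [dist_nonneg (x := (0 : ℂ)) (y := w)]))
    rw [Finset.sum_empty] at h1
    have : 0 < c / (2 * Real.pi) := by positivity
    linarith
  rw [not_lt] at hA
  have hdB : ∀ z ∈ ball (0 : ℂ) N, ∀ w ∈ W, w ∉ F → 2 * B * rad μ M w < dist z w :=
    fun z hz w hw hwF => by
      have := hdist z hz w hw hwF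
      nlinarith [hρ w]
  have hdA : ∀ z ∈ ball (0 : ℂ) N, ∀ w ∈ W, dist z w ≤ A * rad μ M w → w ∈ F :=
    fun z hz w hw hd => by
      by_contra hwF
      have := hdist z hz w hw hwF
      nlinarith [hρ w]
  -- the potentials of the pieces near the disc
  obtain ⟨G, hG, hGre⟩ := exists_holomorphic_re_eq_sub_logPotential hφ h hL (R := N)
    (A := fun ζ => 1 / c * ∑ w ∈ F, α w ζ)
    (continuous_const.mul (continuous_finsetSum _ fun w _ => D.continuous_α w)) (by
      refine HasCompactSupport.mul_left (HasCompactSupport.intro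
        (F.isCompact_biUnion fun w _ => isCompact_closedBall w (A * rad μ M w)) fun ζ hζ => ?_)
      refine Finset.sum_eq_zero fun w hw => D.α_eq_zero w (hFW hw) ζ (not_le.1 fun hcon => hζ ?_)
      exact mem_biUnion (Finset.mem_coe.2 hw) (mem_closedBall.2 hcon)) (fun z hz => by
      rw [D.sum_α z F hFW (hdA z hz)]; field_simp)
  -- the powers of `|z - λ|`
  have hpow : ∀ p, ∃ g : ℂ → ℂ, DifferentiableOn ℂ g (ball 0 N) ∧
      ∀ z ∈ ball (0 : ℂ) N, ‖g z‖ = ‖z - p‖ ^ ∑ w ∈ F, β w p := fun p =>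
    exists_norm_eq_rpow fun hp => D.sum_β p F hFW (hdA p hp)
  choose P hP hPn using hpow
  -- the tail
  have htail : DifferentiableOn ℂ (fun z => ∑' w, tailLog W H F z w) (ball 0 N) := by
    obtain ⟨C', hC'0, hC'⟩ := exists_sum_pow_le K
    set u : ℂ → ℝ := fun w =>
      if w ∈ W ∧ w ∉ F then 3 / 2 * B * (2 * rad μ M w / dist 0 w) ^ n₀ else 0
    refine Complex.differentiableOn_tsum_of_summable_norm (u := u) ?_ (fun w => ?_) isOpen_ball
      fun w z hz => ?_
    · refine summable_of_sum_le (c := 3 / 2 * B * (2 ^ n₀ * C')) (fun w => ?_) fun v => ?_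
      · simp only [u]
        split_ifs
        · have := hρ w
          exact mul_nonneg (by linarith) (by positivity)
        · exact le_rfl
      · set v' := v.filter fun w => w ∈ W ∧ w ∉ F
        have hv : ∀ w ∈ v', w ∈ W ∧ w ∉ F := fun w hw => (Finset.mem_filter.1 hw).2
        calc ∑ w ∈ v, u w = ∑ w ∈ v', 3 / 2 * B * (2 ^ n₀ * (rad μ M w / dist 0 w) ^ n₀) := by
              rw [Finset.sum_filter]
              refine Finset.sum_congr rfl fun w _ => ?_
              simp only [u]
              rw [mul_div_assoc, mul_pow]
          _ = 3 / 2 * B * (2 ^ n₀ * ∑ w ∈ v', (rad μ M w / dist 0 w) ^ n₀) := by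
              rw [Finset.mul_sum, Finset.mul_sum]
          _ ≤ _ := by
              gcongr
              refine hC' μ h M hM v' (fun x hx y hy => D.isScaleNet.separated x (hv x hx).1 y
                (hv y hy).1) 0 (fun w hw => ?_) n₀ hKn
              rw [dist_zero_left]
              have h1 := hfar w (hv w hw).1 (hv w hw).2
              have h2 : (0 : ℝ) ≤ N := Nat.cast_nonneg N
              nlinarith [hρ w]
    · simp only [tailLog]
      by_cases hw : w ∈ W ∧ w ∉ F
      · simp only [if_pos hw]
        refine DifferentiableOn.clog ((hb.differentiableOn w hw.1).mono fun z hz => ?_)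
          fun z hz => ?_
        · have := hdB z hz w hw.1 hw.2
          have h2 := hρ w
          change B * rad μ M w < dist z w
          nlinarith
        · have h1 := hb.norm_sub_one_le_half h hM hB hn₀ hw.1 (hdB z hz w hw.1 hw.2)
          have h2 := Complex.mem_slitPlane_of_norm_lt_one (z := H w z - 1) (by linarith)
          rwa [add_sub_cancel] at h2
      · simp only [if_neg hw]
        exact differentiableOn_const 0
    · simp only [tailLog, u]
      by_cases hw : w ∈ W ∧ w ∉ F
      · rw [if_pos hw, if_pos hw]
        refine (hb.norm_log_le h hM hB hn₀ hw.1 (hdB z hz w hw.1 hw.2)).trans ?_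
        have h1 := (le_max_right _ _).trans (hout w hw.1 hw.2)
        rw [mem_ball, dist_zero_right] at hz
        have h2 := norm_sub_norm_le w z
        rw [← dist_eq_norm, dist_comm] at h2
        have h3 : ‖w‖ / 2 ≤ dist z w := by linarith
        have h4 : 0 < ‖w‖ := by
          have : (0 : ℝ) ≤ N := Nat.cast_nonneg N
          linarith
        have h5 := hρ w
        gcongr ?_ * ?_ ^ _
        rw [dist_zero_left, div_le_div_iff₀ (by linarith) h4]
        nlinarith
      · rw [if_neg hw, if_neg hw, norm_zero]
  obtain ⟨C₁, hC₁⟩ := IsBalancing.exists_factorProduct_eq K hB hn₀ hKn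
  refine ⟨fun z => Complex.exp (c * G z) * ((∏ w ∈ F, ∏ p ∈ R w, (z - p)) *
    (∏ p ∈ F.biUnion S, P p z)) * Complex.exp (∑' w, tailLog W H F z w), ?_, fun z hz => ?_⟩
  · refine ((hG.const_mul _).cexp.mul (DifferentiableOn.mul ?_ ?_)).mul htail.cexp
    · exact DifferentiableOn.fun_finsetProd fun w _ => DifferentiableOn.fun_finsetProd
        fun p _ => by fun_prop
    · exact DifferentiableOn.fun_finsetProd fun p _ => hP p
  · obtain ⟨-, -, hfac⟩ := hC₁ μ h M hM δ Λ W α β S R H hb D.isScaleNet.separated z F hFW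
      (hdB z hz)
    rw [hfac, prod_localFactor D hS hFW, norm_mul, norm_mul, norm_mul, Complex.norm_exp,
      Complex.norm_exp, Complex.re_ofReal_mul, hGre z hz, logPotential_sum h D hFW]
    simp only [norm_prod]
    rw [Finset.prod_congr rfl fun p _ => hPn p z hz, mul_sub, ← mul_assoc c, mul_one_div_cancel hc.ne',
      one_mul, sub_eq_add_neg, Real.exp_add]
    ring

end Entire

/-! ### Size of the product -/

/-- At scale `r` the logarithmic potential of `α μ` is `log r` times the mass, up to a bounded
error. -/
theorem DoublingWith.abs_logPotential_sub_le {μ : Measure ℂ} {K : ℕ} (h : DoublingWith μ K)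
    {α : ℂ → ℝ} (hc : Continuous α) {C : ℝ} (hαC : ∀ ζ, |α ζ| ≤ C) {w : ℂ} {s : ℝ}
    (hα : ∀ ζ, s < dist ζ w → α ζ = 0) {z : ℂ} {r D : ℝ} (hr : 0 < r) (hD : 1 ≤ D)
    (hs : s + dist w z < D * r) :
    |logPotential μ α z - Real.log r * ∫ ζ, α ζ ∂μ| ≤
      C * (Real.log D + logConst K) * μ.real (ball z (D * r)) := by
  have := h.locallyFinite
  have hcs := hasCompactSupport_of_support hα
  have hi1 := h.integrable_mul_log hc hcs z
  have hi2 : Integrable (fun ζ => Real.log r * α ζ) μ :=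
    (hc.integrable_of_hasCompactSupport hcs).const_mul _
  have hC0 : 0 ≤ C := (abs_nonneg _).trans (hαC 0)
  have hDr : 0 < D * r := by positivity
  have hint : IntegrableOn (fun ζ => C * (Real.log D + Real.log (D * r / dist z ζ)))
      (ball z (D * r)) μ :=
    ((integrableOn_const (h.measure_ball_lt_top _ _).ne).add
      (h.integrableOn_log_div z hDr)).const_mul C
  have hint2 : IntegrableOn (fun _ => Real.log D) (ball z (D * r)) μ :=
    integrableOn_const (h.measure_ball_lt_top _ _).ne
  rw [logPotential, ← integral_const_mul, ← integral_sub hi1 hi2, ← Real.norm_eq_abs]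
  refine (norm_integral_le_of_norm_le ((integrable_indicator_iff measurableSet_ball).2 hint)
    ?_).trans ?_
  · filter_upwards [h.ae_ne z] with ζ hζ
    by_cases hmem : ζ ∈ ball z (D * r)
    · have hd : 0 < dist z ζ := dist_pos.2 (Ne.symm hζ)
      have h1 : Real.log ‖z - ζ‖ = Real.log r + (Real.log D - Real.log (D * r / dist z ζ)) := by
        rw [← dist_eq_norm, Real.log_div hDr.ne' hd.ne', Real.log_mul (by positivity) hr.ne']
        ring
      rw [indicator_of_mem hmem, h1, Real.norm_eq_abs,
        show α ζ * (Real.log r + (Real.log D - Real.log (D * r / dist z ζ))) - Real.log r * α ζ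
          = α ζ * (Real.log D - Real.log (D * r / dist z ζ)) by ring, abs_mul]
      have h2 := log_div_dist_nonneg hmem
      have h3 := Real.log_nonneg hD
      refine mul_le_mul (hαC ζ) ?_ (abs_nonneg _) hC0
      rw [abs_le]
      constructor <;> linarith
    · rw [indicator_of_notMem hmem]
      rw [mem_ball, not_lt] at hmem
      have := dist_triangle ζ w z
      rw [hα ζ (by linarith)]
      simp
  · rw [integral_indicator measurableSet_ball, integral_const_mul,
      integral_add hint2 (h.integrableOn_log_div z hDr), setIntegral_const, smul_eq_mul]
    have := h.setIntegral_log_div_le z hDr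
    calc _ ≤ C * (μ.real (ball z (D * r)) * Real.log D + logConst K * μ.real (ball z (D * r))) := by
          gcongr
      _ = _ := by ring

/-- A product of powers of bounded quantities `x p`, all but at most one of them bounded below, is
comparable to the smallest quantity `v`. -/
theorem prod_rpow_comparable {Y : Finset ℂ} {x e : ℂ → ℝ} {δ D v : ℝ} {N : ℕ} (hδ : 0 < δ)
    (hδ1 : δ ≤ 1) (hD : 1 ≤ D) (he0 : ∀ p ∈ Y, 0 ≤ e p) (he1 : ∀ p ∈ Y, e p ≤ 1)
    (hx0 : ∀ p ∈ Y, 0 ≤ x p) (hxD : ∀ p ∈ Y, x p ≤ D) (hN : Y.card ≤ N) (hv0 : 0 ≤ v)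
    (hvD : v ≤ D) (hfar : δ ≤ v → ∀ p ∈ Y, δ ≤ x p)
    (hnear : v < δ → ∃ p ∈ Y, x p = v ∧ e p = 1 ∧ ∀ q ∈ Y, q ≠ p → δ ≤ x q) :
    δ ^ N * v ≤ D * ∏ p ∈ Y, x p ^ e p ∧ δ * ∏ p ∈ Y, x p ^ e p ≤ D ^ N * v := by
  have hup : ∀ T ⊆ Y, ∏ p ∈ T, x p ^ e p ≤ D ^ N := fun T hT => by
    calc ∏ p ∈ T, x p ^ e p ≤ ∏ p ∈ T, D := by
          refine Finset.prod_le_prod (fun p hp => Real.rpow_nonneg (hx0 p (hT hp)) _)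
            fun p hp => ?_
          calc x p ^ e p ≤ D ^ e p := Real.rpow_le_rpow (hx0 p (hT hp)) (hxD p (hT hp))
                (he0 p (hT hp))
            _ ≤ D ^ (1 : ℝ) := Real.rpow_le_rpow_of_exponent_le hD (he1 p (hT hp))
            _ = D := Real.rpow_one D
      _ = D ^ T.card := by rw [Finset.prod_const]
      _ ≤ D ^ N := pow_le_pow_right₀ hD ((Finset.card_le_card hT).trans hN)
  have hlow : ∀ T ⊆ Y, (∀ p ∈ T, δ ≤ x p) → δ ^ N ≤ ∏ p ∈ T, x p ^ e p := fun T hT hδT => by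
    calc δ ^ N ≤ δ ^ T.card :=
          pow_le_pow_of_le_one hδ.le hδ1 ((Finset.card_le_card hT).trans hN)
      _ = ∏ p ∈ T, δ := by rw [Finset.prod_const]
      _ ≤ ∏ p ∈ T, x p ^ e p := by
          refine Finset.prod_le_prod (fun p _ => hδ.le) fun p hp => ?_
          calc δ = δ ^ (1 : ℝ) := (Real.rpow_one δ).symm
            _ ≤ δ ^ e p := Real.rpow_le_rpow_of_exponent_ge hδ hδ1 (he1 p (hT hp))
            _ ≤ x p ^ e p := Real.rpow_le_rpow hδ.le (hδT p hp) (he0 p (hT hp))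
  rcases le_or_gt δ v with hv | hv
  · have h1 := hup Y subset_rfl
    have h2 := hlow Y subset_rfl (hfar hv)
    have h3 : 0 < δ ^ N := by positivity
    have h4 : 0 < D ^ N := by positivity
    constructor
    · rw [mul_comm D]
      exact mul_le_mul h2 hvD hv0 (h3.le.trans h2)
    · rw [mul_comm δ]
      exact mul_le_mul h1 hv hδ.le h4.le
  · obtain ⟨p, hp, hxp, hep, hq⟩ := hnear hv
    have h1 := hup _ (Finset.erase_subset p Y)
    have h2 := hlow _ (Finset.erase_subset p Y) fun q hq' =>
      hq q (Finset.mem_of_mem_erase hq') (Finset.ne_of_mem_erase hq')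
    have h3 : 0 < δ ^ N := by positivity
    rw [← Finset.mul_prod_erase Y _ hp, hxp, hep, Real.rpow_one]
    set P := ∏ q ∈ Y.erase p, x q ^ e q
    have h4 : 0 ≤ v * P := mul_nonneg hv0 (h3.le.trans h2)
    constructor
    · calc δ ^ N * v ≤ P * v := by gcongr
        _ = v * P := mul_comm _ _
        _ ≤ D * (v * P) := le_mul_of_one_le_left h4 hD
    · calc δ * (v * P) ≤ 1 * (v * P) := by gcongr
        _ = P * v := by ring
        _ ≤ D ^ N * v := by gcongr

/-- A separated set contains a nearest point to any given point. -/
theorem SeparatedBy.exists_infDist_eq {μ : Measure ℂ} {K : ℕ} (h : DoublingWith μ K) {M : ℝ}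
    (hM : 0 < M) {δ : ℝ} (hδ : 0 < δ) {Z : Set ℂ} (hZ : SeparatedBy (rad μ M) δ Z)
    (hne : Z.Nonempty) (z : ℂ) : ∃ p ∈ Z, infDist z Z = dist z p := by
  obtain ⟨q, hq⟩ := hne
  have hfin := hZ.finite_inter h hM hδ (isBounded_closedBall (x := z) (r := dist q z))
  obtain ⟨p, hp, hmin⟩ := hfin.isCompact.exists_isMinOn ⟨q, hq, by simp⟩
    (continuous_const.dist continuous_id : Continuous fun p => dist z p).continuousOn
  refine ⟨p, hp.1, le_antisymm (infDist_le_dist_of_mem hp.1) ?_⟩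
  refine (le_infDist ⟨q, hq⟩).2 fun y hy => ?_
  rcases le_or_gt (dist y z) (dist q z) with hyq | hyq
  · exact hmin ⟨hy, hyq⟩
  · have h1 : dist z p ≤ dist z q := hmin ⟨hq, by simp⟩
    rw [dist_comm z q] at h1
    rw [dist_comm z y]
    linarith

section Size

variable {μ : Measure ℂ} {K : ℕ} {a M A C δ B : ℝ} {n₀ n₁ : ℕ} {Λ W : Set ℂ}
  {α β : ℂ → ℂ → ℝ} {deg : ℂ → ℕ} {S R : ℂ → Finset ℂ} {H : ℂ → ℂ → ℂ} {n : Measure ℂ}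

/-- The local factor is invariant under scaling because the charges are balanced. -/
theorem IsBalancing.localFactor_eq (hb : IsBalancing μ M δ B n₀ Λ W α β S R H) {w : ℂ}
    (hw : w ∈ W) (z : ℂ) {r : ℝ} (hr : 0 < r) :
    localFactor μ α β S R w z = (∏ p ∈ R w, dist z p / r) * (∏ p ∈ S w, (dist z p / r) ^ β w p) *
      Real.exp (-(logPotential μ (α w) z - Real.log r * ∫ ζ, α w ζ ∂μ)) := by
  have h1 : ∀ p, ‖z - p‖ = dist z p / r * r := fun p => by
    rw [div_mul_cancel₀ _ hr.ne', dist_eq_norm]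
  rw [localFactor, potentialFactor, hb.integral_eq w hw, neg_sub, Real.exp_sub, mul_add,
    Real.exp_add, Real.exp_neg, Real.exp_mul, Real.exp_mul, Real.exp_log hr, Real.rpow_natCast,
    Real.rpow_sum_of_pos hr]
  simp_rw [h1]
  rw [Finset.prod_mul_distrib, Finset.prod_const,
    Finset.prod_congr rfl fun p _ => Real.mul_rpow (z := β w p)
      (div_nonneg (dist_nonneg (x := z) (y := p)) hr.le) hr.le, Finset.prod_mul_distrib]
  ring

theorem sum_β_le_one (h : DoublingWith μ K) (hM : 0 < M)
    (D : IsDecomposition μ n a M A C n₀ n₁ W α β deg) {F : Finset ℂ} (hF : (F : Set ℂ) ⊆ W)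
    (p : ℂ) : ∑ w ∈ F, β w p ≤ 1 := by
  classical
  obtain ⟨N, -, hN⟩ := exists_overlap_le K A (δ := 1 / 4) (by norm_num)
  have hfin := (hN μ h M hM W D.isScaleNet.separated p).1
  rw [← D.sum_β p (F ∪ hfin.toFinset) (by
    intro w hw
    rw [Finset.coe_union, Finite.coe_toFinset] at hw
    exact hw.elim (fun h => hF h) fun h => h.1)
    fun w hw hd => Finset.mem_union_right _ (hfin.mem_toFinset.2 ⟨hw, hd⟩)]
  exact Finset.sum_le_sum_of_subset_of_nonneg Finset.subset_union_left fun w _ _ =>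
    D.β_nonneg w p

/-- The product of all local factors is comparable to the scaled distance to the set
`Z = Λ ∪ ⋃ R w`. -/
theorem IsBalancing.exists_factorProduct_comparable (h : DoublingWith μ K) (hM : 0 < M)
    (hA : 1 ≤ A) (hB : 1 ≤ B) (hδ : 0 < δ) (hn₀ : 1 ≤ n₀) (hKn : 2 * K ≤ n₀)
    (D : IsDecomposition μ n a M A C n₀ n₁ W α β deg)
    (hS : ∀ w p, p ∈ S w ↔ p ∈ Λ ∧ dist p w ≤ A * rad μ M w)
    (hb : IsBalancing μ M δ B n₀ Λ W α β S R H) :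
    ∃ C' > 0, ∀ z, infDist z (Λ ∪ ⋃ w ∈ W, (R w : Set ℂ)) / rad μ M z ≤ C' ∧
      factorProduct μ W α β S R z ≤
        C' * (infDist z (Λ ∪ ⋃ w ∈ W, (R w : Set ℂ)) / rad μ M z) ∧
      infDist z (Λ ∪ ⋃ w ∈ W, (R w : Set ℂ)) / rad μ M z ≤
        C' * factorProduct μ W α β S R z := by
  classical
  set Z := Λ ∪ ⋃ w ∈ W, (R w : Set ℂ) with hZ
  have hρ := h.rad_pos hM
  have hC0 : 0 ≤ C := (abs_nonneg _).trans (D.abs_α_le 0 0)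
  have hRZ : ∀ w ∈ W, ∀ p ∈ R w, p ∈ Z := fun w hw p hp =>
    Or.inr (mem_iUnion₂.2 ⟨w, hw, hp⟩)
  have hZne : Z.Nonempty := by
    obtain ⟨w, hw, -⟩ := D.isScaleNet.exists_near 0
    obtain ⟨p, hp⟩ := hb.nonempty w hw
    exact ⟨p, hRZ w hw p hp⟩
  -- a point of `Z` close to `z` belongs to net points `w` with `|z - w| ≤ B₁ ρ(w)`; the factors of the
  -- other net points form the tail of the product
  set B₁ := 2 * B + 2 * A + 1
  obtain ⟨C₅, hC₅1, hC₅⟩ := exists_rad_le_mul K B₁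
  obtain ⟨N₅, -, hN₅⟩ := exists_overlap_le K B₁ (δ := 1 / 4) (by norm_num)
  obtain ⟨l, hl⟩ := pow_unbounded_of_one_lt ((B₁ + A + B) * C₅) (one_lt_two (α := ℝ))
  set E : ℝ := 2 ^ l
  have hE1 : 1 ≤ E := one_le_pow₀ (by norm_num)
  obtain ⟨N, hN⟩ := exists_ncard_le K E hδ
  obtain ⟨CT, hCT⟩ := IsBalancing.exists_factorProduct_eq K hB hn₀ hKn
  set Q := C * (Real.log E + logConst K) * (2 ^ (K * l) * M)
  have hQ0 : 0 ≤ Q := by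
    have := logConst_nonneg K
    have := Real.log_nonneg hE1
    positivity
  -- at most one point of `Z` is closer to `z` than `δ' ρ(z)`
  set δ' := min (δ / 4) (1 / 2)
  have hδ' : 0 < δ' := lt_min (by positivity) (by norm_num)
  have hδ'1 : δ' ≤ 1 := (min_le_right _ _).trans (by norm_num)
  set X := N₅ * Q + CT
  set C' := E + E ^ N / δ' * Real.exp X + E / δ' ^ N * Real.exp X with hC'
  have hEpos : 0 < E := by linarith
  have hC'1 : E ≤ C' := by rw [hC', add_assoc]; exact le_add_of_nonneg_right (by positivity)
  have hC'2 : E ^ N / δ' * Real.exp X ≤ C' := by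
    rw [hC']
    have : 0 ≤ E / δ' ^ N * Real.exp X := by positivity
    linarith
  have hC'3 : E / δ' ^ N * Real.exp X ≤ C' := by
    rw [hC']
    have : 0 ≤ E ^ N / δ' * Real.exp X := by positivity
    linarith
  refine ⟨C', by linarith, fun z => ?_⟩
  set r := rad μ M z
  have hr : 0 < r := hρ z
  set v := infDist z Z / r
  have hv0 : 0 ≤ v := div_nonneg infDist_nonneg hr.le
  have hBC : B₁ + A + B ≤ (B₁ + A + B) * C₅ := le_mul_of_one_le_right (by
    simp only [B₁]; linarith) hC₅1
  have hvE : v ≤ E := by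
    obtain ⟨w, hw, hzw⟩ := D.isScaleNet.exists_near z
    obtain ⟨p, hp⟩ := hb.nonempty w hw
    have h1 := hb.dist_le w hw p hp
    have h2 := h.rad_le_add_dist hM w z
    have h3 := infDist_le_dist_of_mem (x := z) (hRZ w hw p hp)
    have h4 := dist_triangle_right z p w
    rw [dist_comm w z] at h2
    rw [div_le_iff₀ hr]
    have h5 : B * rad μ M w ≤ B * (4 / 3 * r) := by gcongr; linarith
    have h6 : (B₁ + A + B) * r ≤ E * r := by gcongr; linarith
    simp only [B₁] at h6
    nlinarith
  have hfin := (hN₅ μ h M hM W D.isScaleNet.separated z).1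
  set F := hfin.toFinset
  have hFmem : ∀ w, w ∈ F ↔ w ∈ W ∧ dist z w ≤ B₁ * rad μ M w := fun w => hfin.mem_toFinset
  have hFW : (F : Set ℂ) ⊆ W := fun w hw => ((hFmem w).1 hw).1
  have hFcard : F.card ≤ N₅ := by
    have := (hN₅ μ h M hM W D.isScaleNet.separated z).2
    rwa [ncard_eq_toFinset_card _ hfin] at this
  have hFrad : ∀ w ∈ F, rad μ M w ≤ C₅ * r := fun w hw => hC₅ μ h M hM w z ((hFmem w).1 hw).2
  have hFfar : ∀ w ∈ W, w ∉ F → 2 * B * rad μ M w < dist z w := fun w hw hwF => by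
    by_contra hcon
    refine hwF ((hFmem w).2 ⟨hw, ?_⟩)
    have := hρ w
    simp only [B₁]
    nlinarith
  obtain ⟨-, hT, hfac⟩ := hCT μ h M hM δ Λ W α β S R H hb D.isScaleNet.separated z F hFW hFfar
  set T := ∑' w, tailLog W H F z w
  set x : ℂ → ℝ := fun p => dist z p / r
  -- the exponent of `|z - p|` in the factors near `z`; it is `1` for `p` close to `z`
  set e : ℂ → ℝ := fun p => if p ∈ Λ then ∑ w ∈ F, β w p else 1
  set Y := F.biUnion R ∪ F.biUnion S
  -- collecting the factors near `z`
  have hprod : ∏ w ∈ F, localFactor μ α β S R w z = (∏ p ∈ Y, x p ^ e p) *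
      Real.exp (-∑ w ∈ F, (logPotential μ (α w) z - Real.log r * ∫ ζ, α w ζ ∂μ)) := by
    have hRd : ((F : Finset ℂ) : Set ℂ).PairwiseDisjoint R := fun w hw w' hw' hne =>
      hb.pairwiseDisjoint w (hFW hw) w' (hFW hw') hne
    have hdis : Disjoint (F.biUnion R) (F.biUnion S) := by
      rw [Finset.disjoint_left]
      intro p hp hp'
      obtain ⟨w, hw, hpw⟩ := Finset.mem_biUnion.1 hp
      obtain ⟨w', -, hpw'⟩ := Finset.mem_biUnion.1 hp'
      exact hb.disjoint w (hFW hw) p hpw ((hS w' p).1 hpw').1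
    rw [Finset.prod_congr rfl fun w hw => hb.localFactor_eq (hFW hw) z hr,
      Finset.prod_mul_distrib, Finset.prod_mul_distrib, ← Real.exp_sum, Finset.sum_neg_distrib,
      ← Finset.prod_biUnion hRd, prod_prod_rpow D hS hFW (x := x) fun p => by positivity,
      Finset.prod_union hdis]
    congr 2
    · refine Finset.prod_congr rfl fun p hp => ?_
      obtain ⟨w, hw, hpw⟩ := Finset.mem_biUnion.1 hp
      simp only [e]
      rw [if_neg (hb.disjoint w (hFW hw) p hpw), Real.rpow_one]
    · refine Finset.prod_congr rfl fun p hp => ?_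
      obtain ⟨w, hw, hpw⟩ := Finset.mem_biUnion.1 hp
      simp only [e]
      rw [if_pos ((hS w p).1 hpw).1]
  have hpot : |∑ w ∈ F, (logPotential μ (α w) z - Real.log r * ∫ ζ, α w ζ ∂μ)| ≤ N₅ * Q := by
    calc _ ≤ ∑ w ∈ F, |logPotential μ (α w) z - Real.log r * ∫ ζ, α w ζ ∂μ| :=
          Finset.abs_sum_le_sum_abs _ _
      _ ≤ ∑ w ∈ F, Q := by
          refine Finset.sum_le_sum fun w hw => ?_
          refine (h.abs_logPotential_sub_le (D.continuous_α w) (D.abs_α_le w)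
            (D.α_eq_zero w (hFW hw)) hr hE1 ?_).trans ?_
          · have h1 := hFrad w hw
            have h2 := ((hFmem w).1 hw).2
            rw [dist_comm w z]
            calc A * rad μ M w + dist z w ≤ (B₁ + A) * rad μ M w := by linarith
              _ ≤ (B₁ + A + B) * rad μ M w :=
                  mul_le_mul_of_nonneg_right (by linarith) (hρ w).le
              _ ≤ (B₁ + A + B) * (C₅ * r) := by
                  gcongr
              _ = (B₁ + A + B) * C₅ * r := by ring
              _ < E * r := by gcongr
          · have h1 := h.real_pow_le z hr l
            rw [h.real_ball_rad hM] at h1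
            have := logConst_nonneg K
            have := Real.log_nonneg hE1
            simp only [Q]
            gcongr
      _ = F.card * Q := by rw [Finset.sum_const, nsmul_eq_mul]
      _ ≤ _ := by gcongr
  have hYZ : ∀ p ∈ Y, p ∈ Z := fun p hp => by
    rcases Finset.mem_union.1 hp with hp | hp
    · obtain ⟨w, hw, hpw⟩ := Finset.mem_biUnion.1 hp
      exact hRZ w (hFW hw) p hpw
    · obtain ⟨w, hw, hpw⟩ := Finset.mem_biUnion.1 hp
      exact Or.inl ((hS w p).1 hpw).1
  have hYE : ∀ p ∈ Y, dist z p ≤ E * r := fun p hp => by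
    have key : ∀ w ∈ F, dist p w ≤ (A + B) * rad μ M w → dist z p ≤ E * r := fun w hw hd => by
      have h1 := hFrad w hw
      have h2 := ((hFmem w).1 hw).2
      have h3 := dist_triangle_right z p w
      calc dist z p ≤ (B₁ + A + B) * rad μ M w := by linarith
        _ ≤ (B₁ + A + B) * (C₅ * r) := by
            gcongr
        _ = (B₁ + A + B) * C₅ * r := by ring
        _ ≤ E * r := by gcongr
    rcases Finset.mem_union.1 hp with hp | hp
    · obtain ⟨w, hw, hpw⟩ := Finset.mem_biUnion.1 hp
      refine key w hw ((hb.dist_le w (hFW hw) p hpw).trans ?_)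
      have := hρ w
      gcongr
      linarith
    · obtain ⟨w, hw, hpw⟩ := Finset.mem_biUnion.1 hp
      refine key w hw (((hS w p).1 hpw).2.trans ?_)
      have := hρ w
      gcongr
      linarith
  have hYcard : Y.card ≤ N := by
    obtain ⟨h1, h2⟩ := hN μ h M hM Z hb.separated z
    refine le_trans ?_ h2
    rw [← ncard_coe_finset]
    refine ncard_le_ncard (fun p hp => ⟨hYZ p hp, ?_⟩) h1
    rw [dist_comm]
    exact hYE p hp
  obtain ⟨hlow, hup⟩ := prod_rpow_comparable (Y := Y) (x := x) (e := e) (v := v) hδ' hδ'1 hE1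
    (fun p _ => by
      simp only [e]
      split_ifs
      · exact Finset.sum_nonneg fun w _ => D.β_nonneg w p
      · norm_num)
    (fun p _ => by
      simp only [e]
      split_ifs
      · exact sum_β_le_one h hM D hFW p
      · exact le_rfl)
    (fun p _ => by positivity) (fun p hp => (div_le_iff₀ hr).2 (hYE p hp)) hYcard hv0 hvE
    (fun hv p hp => hv.trans (by
      simp only [v, x]
      gcongr
      exact infDist_le_dist_of_mem (hYZ p hp)))
    (fun hv => by
      obtain ⟨p, hp, hpd⟩ := hb.separated.exists_infDist_eq h hM hδ hZne z
      have hxv : x p = v := by simp only [x, v]; rw [hpd]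
      have hdp : dist z p < δ' * r := by
        rw [← hxv] at hv
        exact (div_lt_iff₀ hr).1 hv
      have hdp2 : dist z p < 1 / 2 * r := hdp.trans_le (by gcongr; exact min_le_right _ _)
      have hdp4 : dist z p < δ / 4 * r := hdp.trans_le (by gcongr; exact min_le_left _ _)
      have hrp := h.rad_le_add_dist hM z p
      have hmemF : ∀ w ∈ W, ∀ A', 0 ≤ A' → 2 * A' + 1 ≤ B₁ → dist p w ≤ A' * rad μ M w →
          w ∈ F := fun w hw A' hA'0 hA' hd => by
        refine (hFmem w).2 ⟨hw, ?_⟩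
        have h1 := h.rad_le_add_dist hM p w
        have h2 := dist_triangle z p w
        have h3 : (2 * A' + 1) * rad μ M w ≤ B₁ * rad μ M w := by
          have := hρ w; gcongr
        linarith
      refine ⟨p, ?_, hxv, ?_, fun q hq hqp => ?_⟩
      · rcases hp with hp | hp
        · obtain ⟨w, hw, hd⟩ := D.isScaleNet.exists_dist_le_half h hM p
          have := hρ w
          refine Finset.mem_union_right _ (Finset.mem_biUnion.2 ⟨w, ?_, (hS w p).2 ⟨hp, ?_⟩⟩)
          · refine hmemF w hw 1 (by norm_num) (by simp only [B₁]; linarith) (by linarith)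
          · nlinarith
        · obtain ⟨w, hw, hpw⟩ := mem_iUnion₂.1 hp
          exact Finset.mem_union_left _ (Finset.mem_biUnion.2 ⟨w, hmemF w hw B (by linarith)
            (by simp only [B₁]; linarith) (hb.dist_le w hw p hpw), hpw⟩)
      · simp only [e]
        split_ifs with hpΛ
        · exact D.sum_β p F hFW fun w hw hd => hmemF w hw A (by linarith)
            (by simp only [B₁]; linarith) hd
        · rfl
      · have h1 := hb.separated q (hYZ q hq) p hp hqp
        rw [← dist_eq_norm] at h1
        have h2 : δ * (r / 2) ≤ δ * max (rad μ M q) (rad μ M p) := by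
          gcongr
          exact le_trans (by linarith) (le_max_right _ _)
        have h3 := dist_triangle_left q p z
        simp only [x]
        rw [le_div_iff₀ hr]
        have h4 : δ' * r ≤ δ / 4 * r := by gcongr; exact min_le_left _ _
        linarith)
  rw [hfac, hprod]
  set P := ∏ p ∈ Y, x p ^ e p
  have hP0 : 0 ≤ P := Finset.prod_nonneg fun p _ => Real.rpow_nonneg (by positivity) _
  set G := ∑ w ∈ F, (logPotential μ (α w) z - Real.log r * ∫ ζ, α w ζ ∂μ)
  have hGT : |-G + T.re| ≤ X := by
    calc |-G + T.re| ≤ |-G| + |T.re| := abs_add_le _ _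
      _ ≤ N₅ * Q + CT := by
          rw [abs_neg]
          exact add_le_add hpot ((Complex.abs_re_le_norm T).trans hT)
  rw [mul_assoc, ← Real.exp_add]
  obtain ⟨hX1, hX2⟩ := abs_le.1 hGT
  refine ⟨hvE.trans hC'1, ?_, ?_⟩
  · have hP : P ≤ E ^ N / δ' * v := by
      rw [div_mul_eq_mul_div, le_div_iff₀ hδ', mul_comm]; exact hup
    calc P * Real.exp (-G + T.re) ≤ (E ^ N / δ' * v) * Real.exp X := by gcongr
      _ = E ^ N / δ' * Real.exp X * v := by ring
      _ ≤ C' * v := by gcongr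
  · have hP : v ≤ E / δ' ^ N * P := by
      rw [div_mul_eq_mul_div, le_div_iff₀ (by positivity), mul_comm]; exact hlow
    have hexp : 1 ≤ Real.exp X * Real.exp (-G + T.re) := by
      rw [← Real.exp_add]
      exact Real.one_le_exp (by linarith)
    calc v ≤ E / δ' ^ N * P := hP
      _ ≤ E / δ' ^ N * P * (Real.exp X * Real.exp (-G + T.re)) :=
          le_mul_of_one_le_right (by positivity) hexp
      _ = E / δ' ^ N * Real.exp X * (P * Real.exp (-G + T.re)) := by ring
      _ ≤ C' * (P * Real.exp (-G + T.re)) := by gcongr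

end Size

/-! ### The distance `d_φ` -/

theorem IsPiecewiseC1.exists_finset_differentiableAt {γ : ℝ → ℂ} (hγ : IsPiecewiseC1 γ) :
    ∃ S : Finset ℝ, ∀ t ∈ Ioo (0 : ℝ) 1, t ∉ S → DifferentiableAt ℝ γ t := by
  obtain ⟨-, S, hS⟩ := hγ
  refine ⟨S, fun t ht htS => ?_⟩
  have hU : Ioo (0 : ℝ) 1 ∩ (S : Set ℝ)ᶜ ∈ 𝓝 t :=
    (isOpen_Ioo.inter S.finite_toSet.isClosed.isOpen_compl).mem_nhds ⟨ht, htS⟩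
  obtain ⟨a, b, hab, hsub⟩ := mem_nhds_iff_exists_Ioo_subset.1 hU
  have hab' : a < b := hab.1.trans hab.2
  have hcl : Icc a b ⊆ Icc (0 : ℝ) 1 := by
    rw [← closure_Ioo hab'.ne, ← closure_Ioo (zero_ne_one' ℝ)]
    exact closure_mono (hsub.trans inter_subset_left)
  have h0 := hcl (left_mem_Icc.2 hab'.le)
  have h1 := hcl (right_mem_Icc.2 hab'.le)
  have hC := hS a b h0.1 hab' h1.2 fun s hs hs' => (hsub hs').2 hs
  exact (hC.contDiffAt (Icc_mem_nhds hab.1 hab.2)).differentiableAt one_ne_zero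

/-- The Euclidean length of a curve is at least the distance of its end points. -/
theorem IsPiecewiseC1.enorm_sub_le_lintegral {γ : ℝ → ℂ} (hγ : IsPiecewiseC1 γ) {b : ℝ}
    (hb0 : 0 ≤ b) (hb1 : b ≤ 1) : ‖γ b - γ 0‖ₑ ≤ ∫⁻ t in Icc 0 b, ‖deriv γ t‖ₑ := by
  by_cases htop : ∫⁻ t in Icc 0 b, ‖deriv γ t‖ₑ = ⊤
  · rw [htop]; exact le_top
  have hint : IntegrableOn (deriv γ) (Icc 0 b) :=
    ⟨(measurable_deriv γ).aestronglyMeasurable, lt_top_iff_ne_top.2 htop⟩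
  have hint' : IntervalIntegrable (deriv γ) volume 0 b :=
    (intervalIntegrable_iff_integrableOn_Icc_of_le hb0).2 hint
  obtain ⟨S, hS⟩ := hγ.exists_finset_differentiableAt
  have h1 := integral_eq_of_hasDerivAt_off_countable_of_le γ (deriv γ) hb0
    S.countable_toSet (hγ.1.mono (Icc_subset_Icc_right hb1))
    (fun t ht => (hS t ⟨ht.1.1, ht.1.2.trans_le hb1⟩ ht.2).hasDerivAt) hint'
  rw [← h1, intervalIntegral.integral_of_le hb0, ← integral_Icc_eq_integral_Ioc]
  exact enorm_integral_le_lintegral_enorm _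

section Distance

variable {φ : ℂ → ℝ}

/-- The segment from `z` to `ζ` bounds `d_φ(z, ζ)` from above. -/
theorem rhoDist_le {z ζ : ℂ} {ρ₀ : ℝ} (hρ₀ : 0 < ρ₀)
    (hle : ∀ ξ, dist ξ z ≤ dist ζ z → ρ₀ ≤ rho φ ξ) :
    rhoDist φ z ζ ≤ ENNReal.ofReal (dist z ζ / ρ₀) := by
  set γ : ℝ → ℂ := fun t => z + t • (ζ - z)
  have hd : ∀ t, HasDerivAt γ (ζ - z) t := fun t => by
    have h1 := ((hasDerivAt_id t).smul_const (ζ - z)).const_add z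
    rwa [one_smul] at h1
  have hγ : ContDiff ℝ 1 γ := contDiff_const.add (contDiff_id.smul contDiff_const)
  refine (iInf₂_le_of_le γ ⟨hγ.continuous.continuousOn, ∅, fun _ _ _ _ _ _ => hγ.contDiffOn⟩
    (iInf₂_le (by simp [γ]) (by simp [γ]))).trans ?_
  calc rhoLength φ γ ≤ ∫⁻ t in Icc (0 : ℝ) 1, ENNReal.ofReal (dist z ζ / ρ₀) := by
        refine setLIntegral_mono measurable_const fun t ht => ?_
        rw [(hd t).deriv, ENNReal.ofReal_div_of_pos hρ₀, ← ofReal_norm, ← dist_eq_norm,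
          dist_comm z ζ]
        gcongr
        refine hle _ ?_
        simp only [γ, dist_self_add_left]
        rw [norm_smul, Real.norm_of_nonneg ht.1, ← dist_eq_norm]
        exact mul_le_of_le_one_left dist_nonneg ht.2
    _ = _ := by simp

/-- A curve from `z` that leaves the disc `D(z, s)` has `d_φ`-length at least `s / ρ₁` if
`ρ_φ ≤ ρ₁` on that disc. -/
theorem le_rhoDist {z ζ : ℂ} {s ρ₁ : ℝ} (hs : s ≤ dist z ζ) (hρ₁ : 0 < ρ₁)
    (hle : ∀ ξ, dist ξ z ≤ s → rho φ ξ ≤ ρ₁) : ENNReal.ofReal (s / ρ₁) ≤ rhoDist φ z ζ := by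
  rcases lt_or_ge s 0 with hs0 | hs0
  · rw [ENNReal.ofReal_of_nonpos (div_nonpos_of_nonpos_of_nonneg hs0.le hρ₁.le)]
    exact zero_le
  refine le_iInf₂ fun γ hγ => le_iInf₂ fun h0 h1 => ?_
  set f : ℝ → ℝ := fun t => dist (γ t) z
  have hf : ContinuousOn f (Icc 0 1) := (continuous_id.dist continuous_const).comp_continuousOn hγ.1
  -- the first time at distance `s` from `z`
  have hcl : IsClosed (Icc (0 : ℝ) 1 ∩ f ⁻¹' Ici s) := hf.preimage_isClosed_of_isClosed
    isClosed_Icc isClosed_Ici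
  have hcomp : IsCompact (Icc (0 : ℝ) 1 ∩ f ⁻¹' Ici s) :=
    isCompact_Icc.of_isClosed_subset hcl inter_subset_left
  obtain ⟨b, ⟨hb, hbs⟩, hmin⟩ := hcomp.exists_isLeast ⟨1, right_mem_Icc.2 zero_le_one, by
    simp only [f, mem_preimage, h1, mem_Ici]; rwa [dist_comm]⟩
  have hbs : s ≤ dist (γ b) z := hbs
  have hlt : ∀ t ∈ Ico 0 b, dist (γ t) z ≤ s := fun t ht => by
    by_contra hcon
    have := hmin ⟨⟨ht.1, ht.2.le.trans hb.2⟩, (not_le.1 hcon).le⟩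
    exact absurd ht.2 (not_lt.2 this)
  calc ENNReal.ofReal (s / ρ₁) ≤ ‖γ b - γ 0‖ₑ / ENNReal.ofReal ρ₁ := by
        rw [ENNReal.ofReal_div_of_pos hρ₁, ← ofReal_norm, h0, ← dist_eq_norm]
        gcongr
    _ ≤ (∫⁻ t in Icc 0 b, ‖deriv γ t‖ₑ) / ENNReal.ofReal ρ₁ := by
        gcongr
        exact hγ.enorm_sub_le_lintegral hb.1 hb.2
    _ = (∫⁻ t in Ico 0 b, ‖deriv γ t‖ₑ) / ENNReal.ofReal ρ₁ := by
        rw [setLIntegral_congr Ico_ae_eq_Icc]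
    _ = ∫⁻ t in Ico 0 b, ‖deriv γ t‖ₑ / ENNReal.ofReal ρ₁ := by
        simp_rw [div_eq_mul_inv]
        rw [lintegral_mul_const _ (measurable_deriv γ).enorm]
    _ ≤ ∫⁻ t in Ico 0 b, ‖deriv γ t‖ₑ / ENNReal.ofReal (rho φ (γ t)) := by
        refine setLIntegral_mono' measurableSet_Ico fun t ht => ?_
        gcongr
        exact hle _ (hlt t ht)
    _ ≤ rhoLength φ γ :=
        lintegral_mono_set (Ico_subset_Icc_self.trans (Icc_subset_Icc_right hb.2))

/-- Within a bounded multiple of the scale, the distance `d_φ` to a set is comparable to the scaled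
Euclidean distance. -/
theorem exists_distToSet_comparable {μ : Measure ℂ} {K : ℕ} (h : DoublingWith μ K) {M : ℝ}
    (hM : 0 < M) (hrho : rho φ = rad μ M) {Z : Set ℂ}
    (hZ : ∀ z, ∃ p ∈ Z, infDist z Z = dist z p) {A : ℝ} (hA : 1 ≤ A)
    (hZA : ∀ z, infDist z Z ≤ A * rad μ M z) :
    ∃ C : ℝ, 1 ≤ C ∧ ∀ z, distToSet φ z Z ≤ ENNReal.ofReal (C * (infDist z Z / rad μ M z)) ∧
      ENNReal.ofReal (infDist z Z / rad μ M z) ≤ ENNReal.ofReal C * distToSet φ z Z := by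
  obtain ⟨C, hC1, hC⟩ := exists_rad_le_mul K A
  refine ⟨max C (2 * A), le_max_of_le_left hC1, fun z => ?_⟩
  have hr := h.rad_pos hM z
  have hv0 : 0 ≤ infDist z Z / rad μ M z := div_nonneg infDist_nonneg hr.le
  constructor
  · obtain ⟨p, hp, hpd⟩ := hZ z
    refine (iInf₂_le p hp).trans ((rhoDist_le (ρ₀ := rad μ M z / C) (by positivity)
      fun ξ hξ => ?_).trans (ENNReal.ofReal_le_ofReal ?_))
    · rw [hrho, div_le_iff₀ (by linarith), mul_comm]
      refine hC μ h M hM z ξ (hξ.trans ?_)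
      rw [dist_comm, ← hpd]
      exact hZA z
    · rw [← hpd, div_div_eq_mul_div, mul_comm, mul_div_assoc]
      gcongr
      exact le_max_left _ _
  · have hlow : ENNReal.ofReal (infDist z Z / A / (2 * rad μ M z)) ≤ distToSet φ z Z := by
      refine le_iInf₂ fun ζ hζ => le_rhoDist ?_ (by positivity) fun ξ hξ => ?_
      · exact (div_le_self infDist_nonneg hA).trans (infDist_le_dist_of_mem hζ)
      · have h1 : infDist z Z / A ≤ rad μ M z := by
          rw [div_le_iff₀ (by linarith), mul_comm]; exact hZA z
        have h2 := h.rad_le_add_dist hM ξ z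
        rw [hrho]
        linarith
    calc ENNReal.ofReal (infDist z Z / rad μ M z)
        = ENNReal.ofReal (2 * A) * ENNReal.ofReal (infDist z Z / A / (2 * rad μ M z)) := by
          rw [← ENNReal.ofReal_mul (by positivity)]
          congr 1
          field_simp
      _ ≤ _ := by
          gcongr
          exact le_max_right _ _

end Distance

/-! ### Nets containing a set of small density -/

theorem SeparatedBy.mono {ρ ρ' : ℂ → ℝ} {δ C : ℝ} {S : Set ℂ} (hS : SeparatedBy ρ δ S)
    (hC : 0 < C) (hδ : 0 < δ) (hρ : ∀ z, ρ' z ≤ C * ρ z) : SeparatedBy ρ' (δ / C) S := by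
  intro a ha b hb hab
  refine le_trans ?_ (hS a ha b hb hab)
  rw [div_mul_eq_mul_div, div_le_iff₀ hC, mul_assoc]
  gcongr
  refine max_le ((hρ a).trans ?_) ((hρ b).trans ?_)
  · rw [mul_comm]; gcongr; exact le_max_left _ _
  · rw [mul_comm]; gcongr; exact le_max_right _ _

/-- A function of the size of `e ^ ψ` times the scaled distance to a separated set, none of whose
complementary discs is large, is a multiplier. -/
theorem isMultiplier_of_norm_comparable {ψ : ℂ → ℝ} {μ : Measure ℂ} {K : ℕ}
    (h : DoublingWith μ K) {M M' : ℝ} (hM : 0 < M) (hM' : 0 < M') (hrho : rho ψ = rad μ M')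
    {Z : Set ℂ} (hne : Z.Nonempty) {δ : ℝ} (hδ : 0 < δ) (hZ : SeparatedBy (rad μ M) δ Z)
    {g : ℂ → ℂ} (hg : Differentiable ℂ g) {f : ℂ → ℝ} (hgf : ∀ z, ‖g z‖ = Real.exp (ψ z) * f z)
    {C : ℝ} (hC : 0 < C) (hf : ∀ z, infDist z Z / rad μ M z ≤ C ∧
      f z ≤ C * (infDist z Z / rad μ M z) ∧ infDist z Z / rad μ M z ≤ C * f z) :
    IsMultiplier ψ g ∧ zeroSet g = Z := by
  obtain ⟨C₁, hC₁1, hC₁⟩ := exists_rad_le_mul_rad K hM hM'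
  obtain ⟨C₂, hC₂1, hC₂⟩ := exists_rad_le_mul_rad K hM' hM
  have hC₁ := hC₁ μ h
  have hC₂ := hC₂ μ h
  have hnear := hZ.exists_infDist_eq h hM hδ hne
  have hr := h.rad_pos hM
  have hr' := h.rad_pos hM'
  have hzero : zeroSet g = Z := by
    ext z
    obtain ⟨h1, h2, h3⟩ := hf z
    obtain ⟨p, hp, hpd⟩ := hnear z
    rw [zeroSet, mem_ofPred_eq, ← norm_eq_zero, hgf, mul_eq_zero,
      or_iff_right (Real.exp_pos _).ne']
    constructor
    · intro hfz
      rw [hfz, mul_zero] at h3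
      have h4 : infDist z Z ≤ 0 := by
        by_contra hcon
        exact absurd h3 (not_le.2 (div_pos (not_le.1 hcon) (hr z)))
      have h5 : z = p := dist_le_zero.1 (hpd ▸ h4)
      exact h5 ▸ hp
    · intro hz
      rw [infDist_zero_of_mem hz, zero_div] at h2 h3
      refine le_antisymm (by simpa using h2) (le_of_mul_le_mul_left ?_ hC)
      simpa using h3
  have hsep : SeparatedBy (rad μ M') (δ / C₁) Z := hZ.mono (by linarith) hδ hC₁
  have hZA : ∀ z, infDist z Z ≤ max 1 (C * C₂) * rad μ M' z := fun z => by
    have h1 := (div_le_iff₀ (hr z)).1 (hf z).1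
    calc infDist z Z ≤ C * rad μ M z := h1
      _ ≤ C * (C₂ * rad μ M' z) := by gcongr; exact hC₂ z
      _ = C * C₂ * rad μ M' z := by ring
      _ ≤ _ := by
          have := hr' z
          gcongr
          exact le_max_right _ _
  obtain ⟨C₃, hC₃1, hC₃⟩ := exists_distToSet_comparable h hM' hrho hnear (le_max_left _ _) hZA
  -- the two scaled distances are comparable
  have hv1 : ∀ z, infDist z Z / rad μ M z ≤ C₁ * (infDist z Z / rad μ M' z) := fun z => by
    rw [← mul_div_assoc, div_le_div_iff₀ (hr z) (hr' z)]
    have := mul_le_mul_of_nonneg_left (hC₁ z) (infDist_nonneg (x := z) (s := Z))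
    linarith
  have hv2 : ∀ z, infDist z Z / rad μ M' z ≤ C₂ * (infDist z Z / rad μ M z) := fun z => by
    rw [← mul_div_assoc, div_le_div_iff₀ (hr' z) (hr z)]
    have := mul_le_mul_of_nonneg_left (hC₂ z) (infDist_nonneg (x := z) (s := Z))
    linarith
  have hC0 : (0 : ℝ) < C₁ := by linarith
  have hC20 : (0 : ℝ) < C₂ := by linarith
  have hC30 : (0 : ℝ) < C₃ := by linarith
  refine ⟨⟨hg, ?_, ?_, ?_⟩, hzero⟩
  · rw [hzero]
    exact ⟨δ / C₁, by positivity, by rw [hrho]; exact hsep⟩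
  · rw [hzero]
    refine (iSup_le fun z => (hC₃ z).1.trans (ENNReal.ofReal_le_ofReal ?_)).trans_lt
      (ENNReal.ofReal_lt_top (r := C₃ * max 1 (C * C₂)))
    gcongr
    exact (div_le_iff₀ (hr' z)).2 (hZA z)
  · rw [hzero]
    refine ⟨(C * C₁ * C₃ + C * C₂ * C₃).toNNReal, fun z => ?_⟩
    rw [ENNReal.ofNNReal_toNNReal]
    obtain ⟨-, h2, h3⟩ := hf z
    obtain ⟨h4, h5⟩ := hC₃ z
    have hexp := Real.exp_pos (ψ z)
    have hv0 : 0 ≤ infDist z Z / rad μ M' z := div_nonneg infDist_nonneg (hr' z).le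
    have hf0 : 0 ≤ f z := by
      have := div_nonneg (infDist_nonneg (x := z) (s := Z)) (hr z).le
      exact le_of_mul_le_mul_left (by simpa using this.trans h3) hC
    rw [← ofReal_norm, hgf]
    constructor
    · calc ENNReal.ofReal (Real.exp (ψ z) * f z)
          ≤ ENNReal.ofReal (C * C₁ * (Real.exp (ψ z) * (infDist z Z / rad μ M' z))) := by
            refine ENNReal.ofReal_le_ofReal ?_
            calc Real.exp (ψ z) * f z
                ≤ Real.exp (ψ z) * (C * (C₁ * (infDist z Z / rad μ M' z))) := by
                  gcongr
                  exact h2.trans (by gcongr; exact hv1 z)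
              _ = _ := by ring
        _ = ENNReal.ofReal (C * C₁) * (ENNReal.ofReal (Real.exp (ψ z)) *
              ENNReal.ofReal (infDist z Z / rad μ M' z)) := by
            rw [ENNReal.ofReal_mul (by positivity), ENNReal.ofReal_mul hexp.le]
        _ ≤ ENNReal.ofReal (C * C₁) * (ENNReal.ofReal (Real.exp (ψ z)) *
              (ENNReal.ofReal C₃ * distToSet ψ z Z)) := by gcongr
        _ = ENNReal.ofReal (C * C₁ * C₃) *
              (ENNReal.ofReal (Real.exp (ψ z)) * distToSet ψ z Z) := by
            rw [ENNReal.ofReal_mul (p := C * C₁) (by positivity)]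
            ring
        _ ≤ _ := by
            gcongr
            have : 0 ≤ C * C₂ * C₃ := by positivity
            linarith
    · calc ENNReal.ofReal (Real.exp (ψ z)) * distToSet ψ z Z
          ≤ ENNReal.ofReal (Real.exp (ψ z)) *
              ENNReal.ofReal (C₃ * (infDist z Z / rad μ M' z)) := by gcongr
        _ = ENNReal.ofReal (Real.exp (ψ z) * (C₃ * (infDist z Z / rad μ M' z))) := by
            rw [ENNReal.ofReal_mul hexp.le]
        _ ≤ ENNReal.ofReal (C * C₂ * C₃ * (Real.exp (ψ z) * f z)) := by
            refine ENNReal.ofReal_le_ofReal ?_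
            calc Real.exp (ψ z) * (C₃ * (infDist z Z / rad μ M' z))
                ≤ Real.exp (ψ z) * (C₃ * (C₂ * (C * f z))) := by
                  gcongr
                  exact (hv2 z).trans (by gcongr)
              _ = _ := by ring
        _ = ENNReal.ofReal (C * C₂ * C₃) * ENNReal.ofReal (Real.exp (ψ z) * f z) := by
            rw [ENNReal.ofReal_mul (by positivity)]
        _ ≤ _ := by
            gcongr
            have : 0 ≤ C * C₁ * C₃ := by positivity
            linarith

end DoublingFock

end

theorem mainTheorem11 (φ : ℂ → ℝ) (hφ : DoublingFock.IsSubharmonic φ)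
    (hne : DoublingFock.laplacianMeasure φ ≠ 0)
    (hdoubling : DoublingFock.IsDoubling (DoublingFock.laplacianMeasure φ))
    (Λ : Set ℂ) (hsep : DoublingFock.IsRhoSeparated φ Λ)
    (hdens : DoublingFock.upperDensity φ Λ < ENNReal.ofReal (1 / (2 * Real.pi))) :
    ∃ ε : ℝ, 0 < ε ∧ ε < 1 ∧ ∃ Γ : Set ℂ,
      DoublingFock.IsRhoSeparated φ (Λ ∪ Γ) ∧
      DoublingFock.IsNet (fun z => (1 - ε) * φ z) (Λ ∪ Γ) := by
  obtain ⟨hL, K, h⟩ := DoublingFock.exists_doublingWith hne hdoubling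
  set μ := DoublingFock.laplacianMeasure φ with hμ
  obtain ⟨δ₁, hδ₁, hΛ⟩ := hsep
  rw [DoublingFock.rho_eq_rad, ← hμ] at hΛ
  have hΛ : DoublingFock.SeparatedBy (DoublingFock.rad μ 1) δ₁ Λ := hΛ
  have hfin : ∀ R, (Λ ∩ Metric.ball (0 : ℂ) R).Finite := fun R =>
    hΛ.finite_inter h one_pos hδ₁ Metric.isBounded_ball
  have := DoublingFock.isLocallyFiniteMeasure_count hfin
  obtain ⟨κ, hκ0, hκ, M₀, hM₀, hdom⟩ := DoublingFock.exists_dominatedOnDiscs h hfin hdens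
  -- `ε` leaves room between the density of `Λ` and that of `(1 - ε) Δφ / (2π)`
  have hpi := Real.pi_pos
  have hκ' : 2 * Real.pi * κ < 1 := by
    rw [lt_div_iff₀ (by positivity)] at hκ; linarith
  have hκ'' : 0 ≤ 2 * Real.pi * κ := by positivity
  set ε := (1 - 2 * Real.pi * κ) / 2 with hε
  have hε0 : 0 < ε := by linarith
  have hε1 : ε < 1 := by linarith
  have hc : 0 < 1 - ε := by linarith
  have hκa : κ < (1 - ε) / (2 * Real.pi) := by
    rw [lt_div_iff₀ (by positivity)]; linarith
  obtain ⟨M, hM, A, hA, C, -, n₁, W, α, β, deg, D⟩ :=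
    DoublingFock.exists_isDecomposition hκ0 hκa h hM₀ hdom (2 * K + 1)
  obtain ⟨C₁, hC₁, hrad⟩ := DoublingFock.exists_rad_le_mul_rad K one_pos hM
  have hΛM : DoublingFock.SeparatedBy (DoublingFock.rad μ M) (δ₁ / C₁) Λ :=
    hΛ.mono (by linarith) hδ₁ (hrad μ h)
  have hδ₀ : 0 < δ₁ / C₁ := div_pos hδ₁ (by linarith)
  have hfinS : ∀ w, (Λ ∩ Metric.closedBall w (A * DoublingFock.rad μ M w)).Finite := fun w =>
    hΛ.finite_inter h one_pos hδ₁ Metric.isBounded_closedBall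
  set S : ℂ → Finset ℂ := fun w => (hfinS w).toFinset
  have hS : ∀ w p, p ∈ S w ↔ p ∈ Λ ∧ dist p w ≤ A * DoublingFock.rad μ M w := fun w p =>
    (hfinS w).mem_toFinset
  obtain ⟨δ, hδ, B, hB, R, H, hb⟩ :=
    DoublingFock.exists_isBalancing h hM hA (Nat.le_add_left 1 (2 * K)) D hδ₀ hΛM hS
  have hn₀ : 1 ≤ 2 * K + 1 := by omega
  have hKn : 2 * K ≤ 2 * K + 1 := by omega
  obtain ⟨g, hg, hgn⟩ := DoublingFock.exists_differentiable_norm_eq_factorProduct hφ h hL hM hc D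
    hS hb hB hn₀ hKn
  obtain ⟨C', hC', hcomp⟩ := hb.exists_factorProduct_comparable h hM hA hB hδ hn₀ hKn D hS
  refine ⟨ε, hε0, hε1, ⋃ w ∈ W, (R w : Set ℂ), ?_, g, ?_⟩
  · obtain ⟨C₂, hC₂, hrad'⟩ := DoublingFock.exists_rad_le_mul_rad K hM one_pos
    refine ⟨δ / C₂, div_pos hδ (by linarith), ?_⟩
    rw [DoublingFock.rho_eq_rad]
    exact hb.separated.mono (by linarith) hδ (hrad' μ h)
  · refine DoublingFock.isMultiplier_of_norm_comparable h hM (one_div_pos.2 hc)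
      (DoublingFock.rho_const_mul hL hc) ?_ hδ hb.separated hg hgn hC' hcomp
    obtain ⟨w, hw, -⟩ := D.isScaleNet.exists_near 0
    obtain ⟨p, hp⟩ := hb.nonempty w hw
    exact ⟨p, Or.inr (Set.mem_iUnion₂.2 ⟨w, hw, hp⟩)⟩
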